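/- Fix $c_\beta>0$ and $\alpha^*\in(0,1)$. For each $p$ let $k=k(p)$ and $n=n(p)$ be integers with $k\to\infty$ and $k=o(p)$ as $p\to\infty$, and let $\sigma=\sigma(p)>0$ with $\sigma^2=\Theta(1)$ (for instance constant). Let $S$ be uniformly distributed on the $\binom{p}{k}$ subsets of $\{1,\dots,p\}$ of size $k$. Given $S$, let $\beta\in\mathbb{R}^p$ vanish outside $S$ and have i.i.d. $N(0,c_\beta/k)$ entries on $S$. Let $\mathbf{X}\in\mathbb{R}^{n\times p}$ have i.i.d. $N(0,1)$ entries, let $\mathbf{Z}\in\mathbb{R}^n$ have i.i.d. $N(0,\sigma^2)$ entries, with $(S,\beta)$, $\mathbf{X}$, $\mathbf{Z}$ independent, and let $\mathbf{Y}=\mathbf{X}\beta+\mathbf{Z}$. A decoder is a deterministic measurable map $(\mathbf{X},\mathbf{Y})\mapsto\hat S\subseteq\{1,\dots,p\}$; it may depend on all parameters of the model. With $d_{\max}=\lfloor\alpha^*k\rfloor$, its error probability is $$P_e(d_{\max})=\mathbb{P}\big[\,|S\setminus\hat S|>d_{\max}\ \text{ or }\ |\hat S\setminus S|>d_{\max}\,\big].$$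 Let $g(\alpha)=\int_0^\infty[\alpha-F_{\chi^2}(u)]^+\,du$, where $[x]^+=\max\{0,x\}$ and $F_{\chi^2}$ is the cumulative distribution function of a $\chi^2$ random variable with one degree of freedom. (i) If for some constant $\eta>0$ and all sufficiently large $p$ $$n\ \ge\ \max_{\alpha\in[\alpha^*,1]}\frac{\alpha\,k\log\frac pk}{\frac12\log\big(1+\frac{c_\beta}{\sigma^2}g(\alpha)\big)}\,(1+\eta),$$ then there is a sequence of decoders for which $P_e(d_{\max})\to0$ as $p\to\infty$. (ii) Conversely, if for some constant $\eta>0$ and all sufficiently large $p$ $$n\ \le\ \max_{\alpha\in[\alpha^*,1]}\frac{(\alpha-\alpha^*)\,k\log\frac pk}{\frac12\log\big(1+\frac{c_\beta}{\sigma^2}g(\alpha)\big)}\,(1-\eta),$$ then $P_e(d_{\max})\to1$ as $p\to\infty$ for every sequence of decoders. -/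

import Mathlib

open MeasureTheory ProbabilityTheory Filter Topology Asymptotics

noncomputable section

namespace SupportRecovery

/-- The chi-squared distribution with one degree of freedom: the law of `W ^ 2`, `W ∼ N(0,1)`. -/
def chiSqLaw : Measure ℝ := (gaussianReal 0 1).map (fun w => w ^ 2)

/-- The cumulative distribution function of the chi-squared law with one degree of freedom. -/
def chiSqCDF (u : ℝ) : ℝ := chiSqLaw.real (Set.Iic u)

/-- `g(α) = ∫₀^∞ [α - F(u)]⁺ du`, with `F` the chi-squared distribution function. -/
def g (α : ℝ) : ℝ := ∫ u in Set.Ioi (0 : ℝ), max 0 (α - chiSqCDF u)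

/-- `½ log (1 + (c_β / σ²) g(α))`. -/
def rate (cβ σ α : ℝ) : ℝ := 1 / 2 * Real.log (1 + cβ / σ ^ 2 * g α)

/-- The maximum over `α ∈ [α⋆, 1]` of `α k log (p/k) / rate α`. -/
def achThreshold (cβ σ αs : ℝ) (k p : ℕ) : ℝ :=
  sSup ((fun α : ℝ => α * k * Real.log ((p : ℝ) / k) / rate cβ σ α) '' Set.Icc αs 1)

/-- The maximum over `α ∈ [α⋆, 1]` of `(α - α⋆) k log (p/k) / rate α`. -/
def convThreshold (cβ σ αs : ℝ) (k p : ℕ) : ℝ :=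
  sSup ((fun α : ℝ => (α - αs) * k * Real.log ((p : ℝ) / k) / rate cβ σ α) '' Set.Icc αs 1)

/-- The vector with entries `w i` on the support `S` and zero elsewhere. -/
def sparseVector {p : ℕ} (S : Finset (Fin p)) (w : Fin p → ℝ) : Fin p → ℝ :=
  fun i => if i ∈ S then w i else 0

/-- The observations `Y = X β + Z` of the linear model. -/
def observation {n p : ℕ} (β : Fin p → ℝ) (X : Fin n → Fin p → ℝ) (Z : Fin n → ℝ) :
    Fin n → ℝ :=
  fun i => (∑ j, X i j * β j) + Z i

/-- The joint law of `(w, X, Z)`, three independent blocks with i.i.d. entries: coefficients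
`w j ∼ N(0, c_β / k)` (only those on the support enter the model), measurement matrix
`X i j ∼ N(0, 1)` and noise `Z i ∼ N(0, σ²)`. -/
def randomnessLaw (cβ σ : ℝ) (k n p : ℕ) :
    Measure ((Fin p → ℝ) × (Fin n → Fin p → ℝ) × (Fin n → ℝ)) :=
  (Measure.pi fun _ : Fin p => gaussianReal 0 (cβ / k).toNNReal).prod
    ((Measure.pi fun _ : Fin n => Measure.pi fun _ : Fin p => gaussianReal 0 1).prod
      (Measure.pi fun _ : Fin n => gaussianReal 0 (σ ^ 2).toNNReal))

/-- A deterministic (measurable) decoder: it sees the measurement matrix and the observations and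
returns an estimate of the support, of any cardinality. -/
structure Decoder (n p : ℕ) where
  /-- the estimate of the support -/
  est : (Fin n → Fin p → ℝ) → (Fin n → ℝ) → Finset (Fin p)
  measurableSet_est : ∀ T : Finset (Fin p),
    MeasurableSet {xy : (Fin n → Fin p → ℝ) × (Fin n → ℝ) | est xy.1 xy.2 = T}

/-- The error event of partial recovery with at most `dmax` misses and `dmax` false alarms. -/
def IsError {p : ℕ} (dmax : ℕ) (S T : Finset (Fin p)) : Prop :=
  dmax < (S \ T).card ∨ dmax < (T \ S).card

/-- The error probability `P_e(dmax)` given that the support is `S`. -/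
def condErrorProb (cβ σ : ℝ) (k : ℕ) {n p : ℕ} (dmax : ℕ) (dec : Decoder n p)
    (S : Finset (Fin p)) : ℝ :=
  (randomnessLaw cβ σ k n p).real
    {ω | IsError dmax S (dec.est ω.2.1 (observation (sparseVector S ω.1) ω.2.1 ω.2.2))}

/-- The error probability `P_e(dmax)`, the support being uniform on the `p.choose k` subsets of
size `k` and independent of `(w, X, Z)`. -/
def errorProb (cβ σ : ℝ) (k : ℕ) {n p : ℕ} (dmax : ℕ) (dec : Decoder n p) : ℝ :=
  (∑ S ∈ (Finset.univ : Finset (Fin p)).powersetCard k, condErrorProb cβ σ k dmax dec S) /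
    (p.choose k : ℝ)

end SupportRecovery

end

noncomputable section

namespace SupportRecovery

open scoped NNReal ENNReal

/-! Everything is measured on the scale k log(p/k): factors exp(O(k)) are negligible because
log(p/k) → ∞. The function g enters because g(α) is the second moment of a standard Gaussian
restricted to the α-fraction of smallest absolute values (`setIntegral_sq_quantile`). By the law of
large numbers, every set of αk coefficients therefore has energy at least about c_β g(α), and the
smallest αk attain it.

Achievability. Coefficients are quantized to a bounded number of levels, so each support carries
only exp(O(k)) candidate vectors. The decoder outputs a support of size k on which some candidate
leaves a residual close to noise level. The true support passes. If T misses ℓ = αk elements of S,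
the residual before using the columns in T \ S has squared norm about n(σ² + c_β g(α)). Those
columns are independent of it, so they bring it down to noise level with probability about exp(-n ·
rate(α)) (`designLaw_cross_le`). There are at most exp(O(k) + ℓ log(p/k)) such T, and a union bound
concludes (`exists_decoder_error_le`).

Converse. A genie reveals the part E of the support with large coefficients, together with their
values. The hidden part D, about αk coordinates of energy c_β g(α), acts as extra noise. On typical
outcomes, replacing that contribution by independent noise costs a factor exp(n · rate(α))
(`designLaw_change_of_measure`). After the replacement the data say nothing about D beyond E, and
one estimate is correct for only a fraction exp(O(k) - (α - α*) k log(p/k)) of the possible D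
(`card_le_of_not_isError`, `count_ratio_le`). Hence below the threshold the success probability
itself vanishes (`one_sub_errorProb_le`). -/

/-! ### Gaussian Laplace transforms and Chernoff bounds. -/

theorem exp_neg_half_log {x : ℝ} (hx : 0 < x) : Real.exp (-(1 / 2) * Real.log x) = (√x)⁻¹ := by
  rw [neg_mul, Real.exp_neg, Real.sqrt_eq_rpow, Real.rpow_def_of_pos hx, mul_comm]

/-- The Laplace transform of the square of a shifted centred Gaussian variable. -/
theorem lintegral_exp_neg_mul_sq_sub (v : ℝ≥0) (s r : ℝ) (hx : 0 < 1 + 2 * s * v) :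
    ∫⁻ u, ENNReal.ofReal (Real.exp (-s * (r - u) ^ 2)) ∂(gaussianReal 0 v)
      = ENNReal.ofReal (Real.exp (-(1 / 2) * Real.log (1 + 2 * s * v)
          - s / (1 + 2 * s * v) * r ^ 2)) := by
  rcases eq_or_ne v 0 with rfl | hv
  · simp [gaussianReal_zero_var]
  set x : ℝ := 1 + 2 * s * v with hxdef
  have hv0 : (0 : ℝ) < v := by positivity
  -- Completing the square: tilting N(0, v) by exp(-s(r - u)²) gives, up to a constant factor,
  -- N(2srv/x, v/x).
  let v' : ℝ≥0 := v / x.toNNReal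
  have hv' : (v' : ℝ) = v / x := by simp [v', Real.coe_toNNReal _ hx.le]
  have hv'0 : v' ≠ 0 := by
    intro h
    have := congrArg ((↑) : ℝ≥0 → ℝ) h
    rw [hv'] at this
    have h2 : (0 : ℝ) < v / x := by positivity
    simp at this
    rcases this with h | h
    · exact hv h
    · exact hx.ne' h
  have hpt : ∀ u, gaussianPDF 0 v u * ENNReal.ofReal (Real.exp (-s * (r - u) ^ 2))
      = ENNReal.ofReal (Real.exp (-(1 / 2) * Real.log x - s / x * r ^ 2)) *
        gaussianPDF (2 * s * r * v / x) v' u := by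
    intro u
    rw [gaussianPDF, gaussianPDF, ← ENNReal.ofReal_mul (gaussianPDFReal_nonneg _ _ _),
      ← ENNReal.ofReal_mul (Real.exp_pos _).le]
    congr 1
    rw [gaussianPDFReal, gaussianPDFReal,
      sub_eq_add_neg (-(1 / 2) * Real.log x), Real.exp_add, exp_neg_half_log hx, hv',
      ← mul_div_assoc, Real.sqrt_div (by positivity)]
    have h1 : (√x)⁻¹ * (√(2 * Real.pi * v) / √x)⁻¹ = (√(2 * Real.pi * v))⁻¹ := by
      have : √x ≠ 0 := by positivity
      have : √(2 * Real.pi * v) ≠ 0 := by positivity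
      field_simp
    have h2 : -(u - 0) ^ 2 / (2 * (v : ℝ)) + -s * (r - u) ^ 2
        = -(s / x * r ^ 2) + -(u - 2 * s * r * v / x) ^ 2 / (2 * (v / x)) := by
      field_simp
      rw [hxdef]
      ring
    calc _ = (√(2 * Real.pi * v))⁻¹ * (Real.exp (-(u - 0) ^ 2 / (2 * (v : ℝ)))
              * Real.exp (-s * (r - u) ^ 2)) := by ring
      _ = _ := by
        rw [← Real.exp_add, h2, Real.exp_add, ← h1, mul_div_assoc]
        ring
  rw [gaussianReal_of_var_ne_zero _ hv,
    lintegral_withDensity_eq_lintegral_mul _ (measurable_gaussianPDF _ _) (by fun_prop)]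
  simp only [Pi.mul_apply, hpt]
  rw [lintegral_const_mul _ (measurable_gaussianPDF _ _), lintegral_gaussianPDF_eq_one _ hv'0,
    mul_one]

theorem lintegral_prod_pi {ι : Type*} [Fintype ι] {α : Type*} [MeasurableSpace α]
    (μ : ι → Measure α) [∀ i, IsProbabilityMeasure (μ i)] (f : ι → α → ℝ≥0∞)
    (hf : ∀ i, Measurable (f i)) :
    ∫⁻ ω, ∏ i, f i (ω i) ∂(Measure.pi μ) = ∏ i, ∫⁻ a, f i a ∂(μ i) := by
  have hind : iIndepFun (fun i (ω : ι → α) => f i (ω i)) (Measure.pi μ) :=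
    iIndepFun_pi fun i => (hf i).aemeasurable
  rw [lintegral_prod_eq_prod_lintegral_of_indepFun _ _ hind
    (fun i => (hf i).comp (measurable_pi_apply i))]
  refine Finset.prod_congr rfl fun i _ => ?_
  rw [← (measurePreserving_eval μ i).lintegral_comp (hf i)]

/-- Chernoff's bound for a sum over i.i.d. rows. -/
theorem pi_measure_le_exp {α : Type*} [MeasurableSpace α] (ξ : Measure α) [IsProbabilityMeasure ξ]
    (n : ℕ) (φ : α → ℝ) (hφ : Measurable φ) (c : ℝ)
    (hc : ∫⁻ a, ENNReal.ofReal (Real.exp (φ a)) ∂ξ ≤ ENNReal.ofReal (Real.exp c)) (t : ℝ)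
    (A : Set (Fin n → α)) (hA : ∀ ω ∈ A, t ≤ ∑ i, φ (ω i)) :
    (Measure.pi fun _ : Fin n => ξ) A ≤ ENNReal.ofReal (Real.exp (n * c - t)) := by
  have h1 : ∫⁻ ω, ENNReal.ofReal (Real.exp (∑ i, φ (ω i))) ∂(Measure.pi fun _ : Fin n => ξ)
      ≤ ENNReal.ofReal (Real.exp (n * c)) := by
    simp_rw [Real.exp_sum]
    simp_rw [ENNReal.ofReal_prod_of_nonneg (fun i _ => (Real.exp_pos _).le)]
    rw [lintegral_prod_pi _ (fun _ a => ENNReal.ofReal (Real.exp (φ a))) (fun _ => by fun_prop)]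
    rw [Finset.prod_const, Finset.card_univ, Fintype.card_fin]
    calc _ ≤ (ENNReal.ofReal (Real.exp c)) ^ n := pow_le_pow_left' hc n
      _ = _ := by rw [← ENNReal.ofReal_pow (Real.exp_pos _).le, ← Real.exp_nat_mul]
  have hsub : A ⊆ {ω | ENNReal.ofReal (Real.exp t) ≤ ENNReal.ofReal (Real.exp (∑ i, φ (ω i)))} :=
    fun ω hω => ENNReal.ofReal_le_ofReal (Real.exp_le_exp.2 (hA ω hω))
  refine (measure_mono hsub).trans ?_
  refine (meas_ge_le_lintegral_div (Measurable.aemeasurable (by fun_prop)) (by simp [Real.exp_pos]) (by simp)).trans ?_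
  refine (ENNReal.div_le_div_right h1 _).trans ?_
  rw [← ENNReal.ofReal_div_of_pos (Real.exp_pos _), ← Real.exp_sub]

/-- Makes the log-Laplace transform of a squared Gaussian quadratic in θ, so that both chi-squared
tails get the same exponent θx - nθ². -/
theorem neg_sub_sq_le_log {θ : ℝ} (h0 : 0 ≤ θ) (h1 : θ ≤ 1 / 2) : -θ - θ ^ 2 ≤ Real.log (1 - θ) := by
  have h2 : 0 < 1 - θ := by linarith
  rw [Real.le_log_iff_exp_le h2]
  have h3 : Real.exp (-θ - θ ^ 2) * Real.exp (θ + θ ^ 2) = 1 := by rw [← Real.exp_add]; simp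
  have h4 : 1 + (θ + θ ^ 2) + (θ + θ ^ 2) ^ 2 / 2 ≤ Real.exp (θ + θ ^ 2) :=
    Real.quadratic_le_exp_of_nonneg (by positivity)
  have h5 : 1 ≤ (1 - θ) * (1 + (θ + θ ^ 2) + (θ + θ ^ 2) ^ 2 / 2) := by
    nlinarith [mul_nonneg h0 h0, mul_nonneg (mul_nonneg h0 h0) h0,
      mul_nonneg (mul_nonneg (mul_nonneg h0 h0) h0) h0, sq_nonneg (θ ^ 2),
      mul_nonneg (mul_nonneg h0 h0) (sub_nonneg.2 h1),
      mul_nonneg (mul_nonneg (mul_nonneg h0 h0) h0) (sub_nonneg.2 h1),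
      mul_nonneg (mul_nonneg (mul_nonneg (mul_nonneg h0 h0) h0) h0) (sub_nonneg.2 h1)]
  have h6 : 1 ≤ (1 - θ) * Real.exp (θ + θ ^ 2) :=
    h5.trans (mul_le_mul_of_nonneg_left h4 h2.le)
  calc Real.exp (-θ - θ ^ 2) ≤ Real.exp (-θ - θ ^ 2) * ((1 - θ) * Real.exp (θ + θ ^ 2)) :=
        le_mul_of_one_le_right (Real.exp_pos _).le h6
    _ = (1 - θ) * (Real.exp (-θ - θ ^ 2) * Real.exp (θ + θ ^ 2)) := by ring
    _ = 1 - θ := by rw [h3, mul_one]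

theorem sub_sq_le_log {θ : ℝ} (h0 : 0 ≤ θ) : θ - θ ^ 2 ≤ Real.log (1 + θ) := by
  have h := Real.one_sub_inv_le_log_of_pos (x := 1 + θ) (by linarith)
  have : θ - θ ^ 2 ≤ 1 - (1 + θ)⁻¹ := by
    rw [← sub_nonneg]
    have h1 : 1 - (1 + θ)⁻¹ - (θ - θ ^ 2) = θ ^ 3 / (1 + θ) := by
      field_simp
      ring
    rw [h1]
    positivity
  linarith

/-- Upper tail of a sum of squares of i.i.d. centred Gaussian variables. -/
theorem gaussian_sq_upper_tail {α : Type*} [MeasurableSpace α] (ξ : Measure α)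
    [IsProbabilityMeasure ξ] (n : ℕ) (f : α → ℝ) (hf : Measurable f) (v : ℝ) (hv : 0 < v)
    (hlaw : ξ.map f = gaussianReal 0 v.toNNReal) (V : ℝ) (hV : v ≤ V)
    (x θ : ℝ) (h0 : 0 ≤ θ) (h1 : θ ≤ 1 / 2) (hx : 0 ≤ n + x) :
    (Measure.pi fun _ : Fin n => ξ) {ω | V * (n + x) ≤ ∑ i, f (ω i) ^ 2}
      ≤ ENNReal.ofReal (Real.exp (-(1 / 2) * (θ * x - n * θ ^ 2))) := by
  have hvn : ((v.toNNReal : ℝ≥0) : ℝ) = v := Real.coe_toNNReal _ hv.le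
  -- With exponent θ/(2v) the Laplace transform is (1 - θ)^(-1/2) whatever v is; passing from v to V
  -- only shrinks the event.
  refine (pi_measure_le_exp ξ n (fun a => θ / (2 * v) * f a ^ 2) (by fun_prop)
    (1 / 2 * (θ + θ ^ 2)) ?_ (1 / 2 * (θ * (n + x))) _ ?_).trans_eq ?_
  · have e : ∫⁻ a, ENNReal.ofReal (Real.exp (θ / (2 * v) * f a ^ 2)) ∂ξ
        = ∫⁻ u, ENNReal.ofReal (Real.exp (-(-(θ / (2 * v))) * (0 - u) ^ 2))
            ∂(gaussianReal 0 v.toNNReal) := by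
      rw [← hlaw, lintegral_map (by fun_prop) hf]
      simp
    have hx1 : 1 + 2 * (-(θ / (2 * v))) * ((v.toNNReal : ℝ≥0) : ℝ) = 1 - θ := by
      rw [hvn]; field_simp
      ring
    rw [e, lintegral_exp_neg_mul_sq_sub _ _ _ (by rw [hx1]; linarith), hx1]
    refine ENNReal.ofReal_le_ofReal (Real.exp_le_exp.2 ?_)
    have := neg_sub_sq_le_log h0 h1
    simp only [ne_eq, OfNat.ofNat_ne_zero, not_false_eq_true, zero_pow, mul_zero, sub_zero]
    linarith
  · intro ω hω
    simp only [Set.mem_ofPred_eq] at hω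
    rw [← Finset.mul_sum]
    have : v * (n + x) ≤ ∑ i, f (ω i) ^ 2 := (mul_le_mul_of_nonneg_right hV hx).trans hω
    calc 1 / 2 * (θ * (n + x)) = θ / (2 * v) * (v * (n + x)) := by field_simp
      _ ≤ _ := mul_le_mul_of_nonneg_left this (by positivity)
  · congr 2; ring

/-- Lower tail of a sum of squares of i.i.d. centred Gaussian variables. -/
theorem gaussian_sq_lower_tail {α : Type*} [MeasurableSpace α] (ξ : Measure α)
    [IsProbabilityMeasure ξ] (n : ℕ) (f : α → ℝ) (hf : Measurable f) (v : ℝ) (hv : 0 < v)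
    (hlaw : ξ.map f = gaussianReal 0 v.toNNReal)
    (x θ : ℝ) (h0 : 0 ≤ θ) :
    (Measure.pi fun _ : Fin n => ξ) {ω | ∑ i, f (ω i) ^ 2 ≤ v * (n - x)}
      ≤ ENNReal.ofReal (Real.exp (-(1 / 2) * (θ * x - n * θ ^ 2))) := by
  have hvn : ((v.toNNReal : ℝ≥0) : ℝ) = v := Real.coe_toNNReal _ hv.le
  refine (pi_measure_le_exp ξ n (fun a => -(θ / (2 * v)) * f a ^ 2) (by fun_prop)
    (-(1 / 2) * (θ - θ ^ 2)) ?_ (-(1 / 2) * (θ * (n - x))) _ ?_).trans_eq ?_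
  · have e : ∫⁻ a, ENNReal.ofReal (Real.exp (-(θ / (2 * v)) * f a ^ 2)) ∂ξ
        = ∫⁻ u, ENNReal.ofReal (Real.exp (-(θ / (2 * v)) * (0 - u) ^ 2))
            ∂(gaussianReal 0 v.toNNReal) := by
      rw [← hlaw, lintegral_map (by fun_prop) hf]
      simp
    have hx1 : 1 + 2 * (θ / (2 * v)) * ((v.toNNReal : ℝ≥0) : ℝ) = 1 + θ := by
      rw [hvn]; field_simp
    rw [e, lintegral_exp_neg_mul_sq_sub _ _ _ (by rw [hx1]; linarith), hx1]
    refine ENNReal.ofReal_le_ofReal (Real.exp_le_exp.2 ?_)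
    have := sub_sq_le_log h0
    simp only [ne_eq, OfNat.ofNat_ne_zero, not_false_eq_true, zero_pow, mul_zero, sub_zero]
    linarith
  · intro ω hω
    simp only [Set.mem_ofPred_eq] at hω
    rw [← Finset.mul_sum]
    calc -(1 / 2) * (θ * (n - x)) = -(θ / (2 * v) * (v * (n - x))) := by field_simp
      _ ≤ -(θ / (2 * v) * ∑ i, f (ω i) ^ 2) :=
        neg_le_neg (mul_le_mul_of_nonneg_left hω (by positivity))
      _ = _ := by ring
  · congr 2; ring

theorem map_sum_mul_pi_gaussianReal {ι : Type*} [Fintype ι] (a : ι → ℝ) (s : Finset ι) :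
    (Measure.pi fun _ : ι => gaussianReal 0 1).map (fun x => ∑ j ∈ s, x j * a j)
      = gaussianReal 0 (∑ j ∈ s, a j ^ 2).toNNReal := by
  classical
  induction s using Finset.induction_on with
  | empty => simp [gaussianReal_zero_var, Measure.map_const]
  | insert i s hi ih =>
    have hind : iIndepFun (fun j (x : ι → ℝ) => x j * a j)
        (Measure.pi fun _ : ι => gaussianReal 0 1) :=
      iIndepFun_pi (X := fun j (t : ℝ) => t * a j) fun j => by fun_prop
    have h1 : (Measure.pi fun _ : ι => gaussianReal 0 1).map (fun x => x i * a i)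
        = gaussianReal 0 (a i ^ 2).toNNReal := by
      have : (fun x : ι → ℝ => x i * a i) = (fun t : ℝ => t * a i) ∘ Function.eval i := rfl
      rw [this, ← Measure.map_map (by fun_prop) (by fun_prop),
        (measurePreserving_eval (fun _ : ι => gaussianReal 0 1) i).map_eq, gaussianReal_map_mul_const]
      congr 1
      · simp
      · ext; simp [Real.coe_toNNReal _ (sq_nonneg (a i))]
    have h2 : IndepFun (fun x : ι → ℝ => x i * a i) (fun x => ∑ j ∈ s, x j * a j)
        (Measure.pi fun _ : ι => gaussianReal 0 1) := by
      have := (hind.indepFun_finsetSum_of_notMem (fun j => by fun_prop) hi).symm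
      convert this using 1
      ext x; simp
    have h3 := gaussianReal_add_gaussianReal_of_indepFun h2 h1 ih
    simp only [Finset.sum_insert hi]
    rw [Real.toNNReal_add (sq_nonneg _) (Finset.sum_nonneg fun _ _ => sq_nonneg _)]
    simpa [Pi.add_def] using h3

/-! ### Residuals of the linear model. -/

/-- The law of one row of the design together with its noise term. -/
def rowLaw (p : ℕ) (σ : ℝ) : Measure ((Fin p → ℝ) × ℝ) :=
  (Measure.pi fun _ : Fin p => gaussianReal 0 1).prod (gaussianReal 0 (σ ^ 2).toNNReal)

instance (p : ℕ) (σ : ℝ) : IsProbabilityMeasure (rowLaw p σ) := by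
  unfold rowLaw; infer_instance

/-- The joint law of the design and the noise. -/
def designLaw (n p : ℕ) (σ : ℝ) : Measure ((Fin n → Fin p → ℝ) × (Fin n → ℝ)) :=
  (Measure.pi fun _ : Fin n => Measure.pi fun _ : Fin p => gaussianReal 0 1).prod
      (Measure.pi fun _ : Fin n => gaussianReal 0 (σ ^ 2).toNNReal)

instance (n p : ℕ) (σ : ℝ) : IsProbabilityMeasure (designLaw n p σ) := by
  unfold designLaw; infer_instance

/-- Pairing each row with its own noise term turns residual norms into sums over i.i.d. rows, the
form needed for `pi_measure_le_exp`. -/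
theorem designLaw_apply (n p : ℕ) (σ : ℝ) (A : Set ((Fin n → Fin p → ℝ) × (Fin n → ℝ))) :
    designLaw n p σ A = (Measure.pi fun _ : Fin n => rowLaw p σ)
      {ω | (fun i => (ω i).1, fun i => (ω i).2) ∈ A} := by
  have h := measurePreserving_arrowProdEquivProdArrow (Fin p → ℝ) ℝ (Fin n)
    (fun _ => Measure.pi fun _ : Fin p => gaussianReal 0 1)
    (fun _ => gaussianReal 0 (σ ^ 2).toNNReal)
  exact (h.measure_preimage_equiv A).symm

/-- The residual `⟨x, a⟩ + z` of a row. -/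
def rowResidual {p : ℕ} (a : Fin p → ℝ) (y : (Fin p → ℝ) × ℝ) : ℝ := (∑ j, y.1 j * a j) + y.2

@[fun_prop]
theorem measurable_rowResidual {p : ℕ} (a : Fin p → ℝ) : Measurable (rowResidual a) := by
  unfold rowResidual; fun_prop

/-- The squared norm of the residual vector `X a + Z`. -/
def residualSq {n p : ℕ} (a : Fin p → ℝ) (xz : (Fin n → Fin p → ℝ) × (Fin n → ℝ)) : ℝ :=
  ∑ i, ((∑ j, xz.1 i j * a j) + xz.2 i) ^ 2

theorem map_rowResidual {p : ℕ} (σ : ℝ) (a : Fin p → ℝ) :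
    (rowLaw p σ).map (rowResidual a) = gaussianReal 0 ((∑ j, a j ^ 2) + σ ^ 2).toNNReal := by
  have h := map_sum_mul_pi_gaussianReal a Finset.univ
  have h2 : (rowLaw p σ).map (rowResidual a)
      = ((Measure.pi fun _ : Fin p => gaussianReal 0 1).map (fun x => ∑ j, x j * a j)).conv
        (gaussianReal 0 (σ ^ 2).toNNReal) := by
    rw [Measure.conv, ← Measure.map_id (μ := gaussianReal 0 (σ ^ 2).toNNReal),
      Measure.map_prod_map _ _ (by fun_prop) (by fun_prop), Measure.map_map (by fun_prop)
      (by fun_prop)]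
    rfl
  rw [h2, h, gaussianReal_conv_gaussianReal, add_zero,
    ← Real.toNNReal_add (Finset.sum_nonneg fun _ _ => sq_nonneg _) (sq_nonneg _)]

/-- The two linear forms use disjoint blocks of independent coordinates, so they are independent
Gaussians. -/
theorem lintegral_sum_sum_of_disjoint {ι : Type*} [Fintype ι] [DecidableEq ι] (a b : ι → ℝ)
    (N : Finset ι) (ha : ∀ j ∈ N, a j = 0) (hb : ∀ j ∉ N, b j = 0) (F : ℝ × ℝ → ℝ≥0∞)
    (hF : Measurable F) :
    ∫⁻ x, F (∑ j, x j * a j, ∑ j, x j * b j) ∂(Measure.pi fun _ : ι => gaussianReal 0 1)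
      = ∫⁻ r, ∫⁻ u, F (r, u) ∂(gaussianReal 0 (∑ j, b j ^ 2).toNNReal)
        ∂(gaussianReal 0 (∑ j, a j ^ 2).toNNReal) := by
  set π := Measure.pi fun _ : ι => gaussianReal 0 1
  have hind : iIndepFun (fun j (x : ι → ℝ) => x j) π :=
    iIndepFun_pi (X := fun _ (t : ℝ) => t) fun j => by fun_prop
  have h1 := hind.indepFun_finset Nᶜ N disjoint_compl_left (fun j => by fun_prop)
  have h2 := h1.comp (φ := fun y : (Nᶜ : Finset ι) → ℝ => ∑ j, y j * a j)
    (ψ := fun y : N → ℝ => ∑ j, y j * b j) (by fun_prop) (by fun_prop)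
  have ea : (fun x : ι → ℝ => ∑ j, x j * a j)
      = (fun y : (Nᶜ : Finset ι) → ℝ => ∑ j, y j * a j) ∘ fun x (j : (Nᶜ : Finset ι)) => x j := by
    ext x
    simp only [Function.comp]
    rw [Finset.sum_coe_sort Nᶜ (fun j => x j * a j)]
    refine (Finset.sum_subset (Finset.subset_univ _) fun j _ hj => ?_).symm
    rw [ha j (by simpa using hj), mul_zero]
  have eb : (fun x : ι → ℝ => ∑ j, x j * b j)
      = (fun y : N → ℝ => ∑ j, y j * b j) ∘ fun x (j : N) => x j := by
    ext x
    simp only [Function.comp]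
    rw [Finset.sum_coe_sort N (fun j => x j * b j)]
    refine (Finset.sum_subset (Finset.subset_univ _) fun j _ hj => ?_).symm
    rw [hb j hj, mul_zero]
  rw [← ea, ← eb] at h2
  have h3 := (indepFun_iff_map_prod_eq_prod_map_map (Measurable.aemeasurable (by fun_prop))
    (Measurable.aemeasurable (by fun_prop))).1 h2
  rw [map_sum_mul_pi_gaussianReal a Finset.univ, map_sum_mul_pi_gaussianReal b Finset.univ] at h3
  rw [← lintegral_prod _ hF.aemeasurable, ← h3, lintegral_map hF (by fun_prop)]

/-- Given the residual r of a, the direction b adds an independent centred Gaussian, and averaging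
exp(-s(r - u)²) over it leaves exp(-(s/x) r²) / √x. The weight on `rowResidual a` is chosen to
cancel the dependence on r, so the noise and a drop out. -/
theorem lintegral_exp_residual_cross {p : ℕ} (σ : ℝ) (a b : Fin p → ℝ)
    (N : Finset (Fin p)) (ha : ∀ j ∈ N, a j = 0) (hb : ∀ j ∉ N, b j = 0) (s : ℝ) (hs : 0 ≤ s) :
    ∫⁻ y, ENNReal.ofReal (Real.exp (s / (1 + 2 * s * ∑ j, b j ^ 2) * rowResidual a y ^ 2
        - s * rowResidual (a - b) y ^ 2)) ∂(rowLaw p σ)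
      = ENNReal.ofReal (Real.exp (-(1 / 2) * Real.log (1 + 2 * s * ∑ j, b j ^ 2))) := by
  have hB : 0 ≤ ∑ j, b j ^ 2 := Finset.sum_nonneg fun _ _ => sq_nonneg _
  have hBn : (((∑ j, b j ^ 2).toNNReal : ℝ≥0) : ℝ) = ∑ j, b j ^ 2 := Real.coe_toNNReal _ hB
  set x : ℝ := 1 + 2 * s * ∑ j, b j ^ 2
  have hx : 0 < x := by positivity
  have key : ∀ z : ℝ, ∫⁻ t, ENNReal.ofReal (Real.exp (s / x * rowResidual a (t, z) ^ 2
        - s * rowResidual (a - b) (t, z) ^ 2)) ∂(Measure.pi fun _ : Fin p => gaussianReal 0 1)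
      = ENNReal.ofReal (Real.exp (-(1 / 2) * Real.log x)) := by
    intro z
    have e : ∀ t : Fin p → ℝ, ENNReal.ofReal (Real.exp (s / x * rowResidual a (t, z) ^ 2
        - s * rowResidual (a - b) (t, z) ^ 2))
        = (fun q : ℝ × ℝ => ENNReal.ofReal (Real.exp (s / x * (q.1 + z) ^ 2
        - s * (q.1 + z - q.2) ^ 2))) (∑ j, t j * a j, ∑ j, t j * b j) := by
      intro t
      simp only [rowResidual, Pi.sub_apply, mul_sub, Finset.sum_sub_distrib]
      congr 4
      ring
    rw [lintegral_congr e, lintegral_sum_sum_of_disjoint a b N ha hb (fun q : ℝ × ℝ =>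
      ENNReal.ofReal (Real.exp (s / x * (q.1 + z) ^ 2 - s * (q.1 + z - q.2) ^ 2))) (by fun_prop)]
    have inner : ∀ r : ℝ, ∫⁻ u, ENNReal.ofReal (Real.exp (s / x * (r + z) ^ 2
        - s * (r + z - u) ^ 2)) ∂(gaussianReal 0 (∑ j, b j ^ 2).toNNReal)
        = ENNReal.ofReal (Real.exp (-(1 / 2) * Real.log x)) := by
      intro r
      have e2 : ∀ u : ℝ, ENNReal.ofReal (Real.exp (s / x * (r + z) ^ 2 - s * (r + z - u) ^ 2))
          = ENNReal.ofReal (Real.exp (s / x * (r + z) ^ 2))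
            * ENNReal.ofReal (Real.exp (-s * (r + z - u) ^ 2)) := by
        intro u
        rw [← ENNReal.ofReal_mul (Real.exp_pos _).le, ← Real.exp_add]
        congr 2; ring
      simp_rw [e2]
      rw [lintegral_const_mul _ (by fun_prop), lintegral_exp_neg_mul_sq_sub _ _ _ (by rw [hBn]; exact hx),
        hBn, ← ENNReal.ofReal_mul (Real.exp_pos _).le, ← Real.exp_add]
      congr 2
      ring
    simp_rw [inner]
    simp
  rw [rowLaw, lintegral_prod_symm _ (by fun_prop)]
  simp_rw [key]
  simp

/-- The probability that a fresh Gaussian direction brings a residual of squared norm at least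
`n τ` down to squared norm at most `n ρ`. -/
theorem designLaw_cross_le {n p : ℕ} (σ : ℝ) (a b : Fin p → ℝ)
    (N : Finset (Fin p)) (ha : ∀ j ∈ N, a j = 0) (hb : ∀ j ∉ N, b j = 0) (τ ρ : ℝ) (hτ : 0 < τ)
    (hρ : 0 < ρ) :
    designLaw n p σ {xz | n * τ ≤ residualSq a xz ∧ residualSq (a - b) xz ≤ n * ρ}
      ≤ ENNReal.ofReal (Real.exp (-(n / 2) * Real.log (τ / ρ))) := by
  have hB : 0 ≤ ∑ j, b j ^ 2 := Finset.sum_nonneg fun _ _ => sq_nonneg _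
  -- For this s the Chernoff bound, as a function of x = 1 + 2s‖b‖², is largest at x = τ/ρ, where it
  -- equals the claimed value. The bound is therefore uniform in b; log y ≤ y - 1 at y = τ/(ρx)
  -- expresses this.
  set s : ℝ := 1 / (2 * ρ) with hs
  have hs0 : 0 < s := by positivity
  have h := lintegral_exp_residual_cross σ a b N ha hb s hs0.le
  set x : ℝ := 1 + 2 * s * ∑ j, b j ^ 2
  have hx : 0 < x := by positivity
  rw [designLaw_apply]
  refine (pi_measure_le_exp (rowLaw p σ) n _ (by fun_prop) _ h.le (s / x * (n * τ) - s * (n * ρ)) _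
    ?_).trans (ENNReal.ofReal_le_ofReal (Real.exp_le_exp.2 ?_))
  · rintro ω ⟨h1, h2⟩
    rw [Finset.sum_sub_distrib, ← Finset.mul_sum, ← Finset.mul_sum]
    have h1' : n * τ ≤ ∑ i, rowResidual a (ω i) ^ 2 := h1
    have h2' : ∑ i, rowResidual (a - b) (ω i) ^ 2 ≤ n * ρ := h2
    exact sub_le_sub (mul_le_mul_of_nonneg_left h1' (by positivity))
      (mul_le_mul_of_nonneg_left h2' hs0.le)
  · have hl := Real.log_le_sub_one_of_pos (x := τ / ρ / x) (by positivity)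
    rw [Real.log_div (by positivity) hx.ne'] at hl
    have e : n * (-(1 / 2) * Real.log x) - (s / x * (n * τ) - s * (n * ρ))
        = (n / 2) * (-Real.log x - (τ / ρ / x - 1)) := by
      rw [hs]; field_simp
    rw [e, neg_mul, ← mul_neg]
    exact mul_le_mul_of_nonneg_left (by linarith) (by positivity)

theorem designLaw_upper_tail {n p : ℕ} (σ : ℝ) (hσ : 0 < σ) (a : Fin p → ℝ) (V : ℝ)
    (hV : (∑ j, a j ^ 2) + σ ^ 2 ≤ V)
    (x θ : ℝ) (h0 : 0 ≤ θ) (h1 : θ ≤ 1 / 2) (hx : 0 ≤ n + x) :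
    designLaw n p σ {xz | V * (n + x) ≤ residualSq a xz}
      ≤ ENNReal.ofReal (Real.exp (-(1 / 2) * (θ * x - n * θ ^ 2))) := by
  have hB : 0 ≤ ∑ j, a j ^ 2 := Finset.sum_nonneg fun _ _ => sq_nonneg _
  rw [designLaw_apply]
  exact gaussian_sq_upper_tail (rowLaw p σ) n (rowResidual a) (by fun_prop) _ (by positivity)
    (map_rowResidual σ a) V hV x θ h0 h1 hx

theorem designLaw_lower_tail {n p : ℕ} (σ : ℝ) (hσ : 0 < σ) (a : Fin p → ℝ) (V : ℝ)
    (hV : V ≤ (∑ j, a j ^ 2) + σ ^ 2)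
    (x θ : ℝ) (h0 : 0 ≤ θ) (hx : x ≤ n) :
    designLaw n p σ {xz | residualSq a xz ≤ V * (n - x)}
      ≤ ENNReal.ofReal (Real.exp (-(1 / 2) * (θ * x - n * θ ^ 2))) := by
  have hB : 0 ≤ ∑ j, a j ^ 2 := Finset.sum_nonneg fun _ _ => sq_nonneg _
  have h := gaussian_sq_lower_tail (rowLaw p σ) n (rowResidual a) (by fun_prop) _ (by positivity)
    (map_rowResidual σ a) x θ h0
  refine (measure_mono ?_).trans ((designLaw_apply n p σ
    {xz | residualSq a xz ≤ ((∑ j, a j ^ 2) + σ ^ 2) * (n - x)}).trans_le h)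
  intro xz hxz
  exact le_trans hxz (mul_le_mul_of_nonneg_right hV (by linarith))

/-! ### Laws of large numbers for the coefficients. -/

/-- The weak law of large numbers for coordinates of a product measure, by Chebyshev. -/
theorem pi_chebyshev {ι : Type*} [Fintype ι] (ρ : Measure ℝ) [IsProbabilityMeasure ρ]
    (φ : ℝ → ℝ) (hφ : MemLp φ 2 ρ) (V : ℝ) (hV : ∫ t, φ t ^ 2 ∂ρ ≤ V) (S : Finset ι)
    (hS : S.Nonempty) (δ : ℝ) (hδ : 0 < δ) :
    (Measure.pi fun _ : ι => ρ)
        {w | S.card * δ ≤ |∑ j ∈ S, φ (w j) - S.card * ∫ t, φ t ∂ρ|}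
      ≤ ENNReal.ofReal (V / (S.card * δ ^ 2)) := by
  set π := Measure.pi fun _ : ι => ρ
  have hk : (0 : ℝ) < S.card := by exact_mod_cast hS.card_pos
  have hmp : ∀ j : ι, MeasurePreserving (Function.eval j) π ρ := fun j => measurePreserving_eval _ j
  have hL : ∀ j : ι, MemLp (fun w : ι → ℝ => φ (w j)) 2 π := fun j =>
    hφ.comp_measurePreserving (hmp j)
  have hind : iIndepFun (fun j (w : ι → ℝ) => φ (w j)) π :=
    iIndepFun_pi (X := fun _ (t : ℝ) => φ t) fun j => hφ.aestronglyMeasurable.aemeasurable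
  have hvar1 : ∀ j : ι, Var[fun w : ι → ℝ => φ (w j); π] ≤ V := by
    intro j
    refine (variance_le_expectation_sq (hL j).aestronglyMeasurable).trans ?_
    refine le_trans (le_of_eq ?_) hV
    have := integral_map (μ := π) (φ := Function.eval j) (hmp j).measurable.aemeasurable
      (f := fun t => φ t ^ 2)
      (by rw [(hmp j).map_eq]; exact hφ.aestronglyMeasurable.pow 2)
    rw [(hmp j).map_eq] at this
    exact this.symm
  have hvar : Var[∑ j ∈ S, fun w : ι → ℝ => φ (w j); π] ≤ S.card * V := by
    rw [IndepFun.variance_sum (fun j _ => hL j)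
      (fun i _ j _ hij => hind.indepFun hij)]
    refine (Finset.sum_le_sum fun j _ => hvar1 j).trans ?_
    simp
  have hmean : ∫ w, (∑ j ∈ S, fun w : ι → ℝ => φ (w j)) w ∂π = S.card * ∫ t, φ t ∂ρ := by
    simp only [Finset.sum_apply]
    rw [integral_finsetSum _ fun j _ => (hL j).integrable (by norm_num)]
    rw [Finset.sum_congr rfl (g := fun _ => ∫ t, φ t ∂ρ), Finset.sum_const, nsmul_eq_mul]
    intro j _
    have := integral_map (μ := π) (φ := Function.eval j) (hmp j).measurable.aemeasurable
      (f := φ) (by rw [(hmp j).map_eq]; exact hφ.aestronglyMeasurable)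
    rw [(hmp j).map_eq] at this
    exact this.symm
  have hch := meas_ge_le_variance_div_sq (μ := π)
    (memLp_finsetSum' S fun j _ => hL j) (c := S.card * δ) (by positivity)
  rw [hmean] at hch
  simp only [Finset.sum_apply] at hch
  refine hch.trans (ENNReal.ofReal_le_ofReal ?_)
  calc _ ≤ S.card * V / (S.card * δ) ^ 2 := by gcongr
    _ = _ := by field_simp

theorem map_div_gaussianReal {v : ℝ} (hv : 0 < v) :
    (gaussianReal 0 v.toNNReal).map (fun w => w / √v) = gaussianReal 0 1 := by
  rw [gaussianReal_map_div_const]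
  congr 1
  · simp
  · ext
    simp only [NNReal.coe_div, NNReal.coe_mk, NNReal.coe_one, Real.coe_toNNReal _ hv.le,
      Real.sq_sqrt hv.le]
    exact div_self hv.ne'

/-- The weak law of large numbers for functions of the normalized coefficients. -/
theorem coeff_chebyshev {p : ℕ} (v : ℝ) (hv : 0 < v) (ψ : ℝ → ℝ) (hψm : Measurable ψ)
    (hψ : MemLp ψ 2 (gaussianReal 0 1)) (V : ℝ) (hV : ∫ t, ψ t ^ 2 ∂(gaussianReal 0 1) ≤ V)
    (S : Finset (Fin p)) (hS : S.Nonempty) (δ : ℝ) (hδ : 0 < δ) :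
    (Measure.pi fun _ : Fin p => gaussianReal 0 v.toNNReal)
        {w | S.card * δ ≤ |∑ j ∈ S, ψ (w j / √v) - S.card * ∫ t, ψ t ∂(gaussianReal 0 1)|}
      ≤ ENNReal.ofReal (V / (S.card * δ ^ 2)) := by
  have hm := map_div_gaussianReal hv
  have hmeas : Measurable (fun w : ℝ => w / √v) := by fun_prop
  have e : ∀ f : ℝ → ℝ, Measurable f → ∫ t, f (t / √v) ∂(gaussianReal 0 v.toNNReal)
      = ∫ t, f t ∂(gaussianReal 0 1) := by
    intro f hf
    rw [← hm, integral_map hmeas.aemeasurable hf.aestronglyMeasurable]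
  have hL : MemLp (fun t => ψ (t / √v)) 2 (gaussianReal 0 v.toNNReal) :=
    hψ.comp_measurePreserving ⟨hmeas, hm⟩
  have := pi_chebyshev (gaussianReal 0 v.toNNReal) (fun t => ψ (t / √v)) hL V
    (by rw [e (fun t => ψ t ^ 2) (by fun_prop)]; exact hV) S hS δ hδ
  rwa [e ψ hψm] at this

/-! ### The function g and its affine minorants. -/

theorem chiSqCDF_eq_cdf (u : ℝ) : chiSqCDF u = cdf chiSqLaw u := by
  have : IsProbabilityMeasure chiSqLaw :=
    Measure.isProbabilityMeasure_map (Measurable.aemeasurable (by fun_prop))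
  rw [cdf_eq_real]; rfl

theorem chiSqCDF_eq (u : ℝ) : chiSqCDF u = (gaussianReal 0 1).real {w | w ^ 2 ≤ u} := by
  rw [chiSqCDF, chiSqLaw, map_measureReal_apply (by fun_prop) measurableSet_Iic]
  rfl

theorem monotone_chiSqCDF : Monotone chiSqCDF := by
  intro a b h
  simp only [chiSqCDF_eq_cdf]
  exact monotone_cdf _ h

theorem chiSqCDF_le_one (u : ℝ) : chiSqCDF u ≤ 1 := by
  rw [chiSqCDF_eq]; exact measureReal_le_one

theorem tendsto_chiSqCDF : Tendsto chiSqCDF atTop (𝓝 1) := by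
  simpa only [funext chiSqCDF_eq_cdf] using tendsto_cdf_atTop chiSqLaw

theorem chiSqCDF_zero : chiSqCDF 0 = 0 := by
  have : NullSingletonClass (gaussianReal 0 1) := nullSingletonClass_gaussianReal one_ne_zero
  have e : {w : ℝ | w ^ 2 ≤ 0} = {0} := by
    ext w
    simp only [Set.mem_ofPred_eq, Set.mem_singleton_iff]
    constructor
    · intro h; exact pow_eq_zero_iff (two_ne_zero) |>.1 (le_antisymm h (sq_nonneg w))
    · rintro rfl; simp
  rw [chiSqCDF_eq, e]
  simp [measureReal_def]

theorem continuousOn_chiSqCDF : ContinuousOn chiSqCDF (Set.Ici 0) := by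
  have hi := integrable_gaussianPDFReal 0 1
  have hc : Continuous fun b => ∫ x in (0 : ℝ)..b, gaussianPDFReal 0 1 x :=
    intervalIntegral.continuous_primitive (fun a b => hi.intervalIntegrable) 0
  have e : ∀ u ∈ Set.Ici (0 : ℝ), chiSqCDF u = (∫ x in (0 : ℝ)..√u, gaussianPDFReal 0 1 x)
      - ∫ x in (0 : ℝ)..(-√u), gaussianPDFReal 0 1 x := by
    intro u hu
    have e1 : {w : ℝ | w ^ 2 ≤ u} = Set.Icc (-√u) (√u) := by
      ext w
      simp only [Set.mem_ofPred_eq, Set.mem_Icc]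
      rw [Real.sq_le hu]
    rw [chiSqCDF_eq, e1, measureReal_def, gaussianReal_apply_eq_integral _ one_ne_zero,
      ENNReal.toReal_ofReal (integral_nonneg fun x => gaussianPDFReal_nonneg _ _ _),
      integral_Icc_eq_integral_Ioc,
      ← intervalIntegral.integral_of_le (by linarith [Real.sqrt_nonneg u]),
      intervalIntegral.integral_interval_sub_left hi.intervalIntegrable hi.intervalIntegrable]
  refine ContinuousOn.congr ?_ e
  fun_prop

theorem exists_chiSqCDF_eq {α : ℝ} (h0 : 0 < α) (h1 : α < 1) : ∃ t, 0 < t ∧ chiSqCDF t = α := by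
  obtain ⟨T, hT, hT0⟩ := ((tendsto_chiSqCDF.eventually_const_lt h1).and
    (eventually_ge_atTop 0)).exists
  obtain ⟨t, ht, hα⟩ := intermediate_value_Icc hT0
    (continuousOn_chiSqCDF.mono Set.Icc_subset_Ici_self)
    (show α ∈ Set.Icc (chiSqCDF 0) (chiSqCDF T) by rw [chiSqCDF_zero]; exact ⟨h0.le, hT.le⟩)
  refine ⟨t, lt_of_le_of_ne ht.1 ?_, hα⟩
  rintro rfl
  rw [chiSqCDF_zero] at hα
  exact h0.ne hα

theorem integrable_sq_gaussianReal : Integrable (fun w : ℝ => w ^ 2) (gaussianReal 0 1) :=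
  (memLp_id_gaussianReal 2).integrable_sq

/-- By the layer-cake formula the integral is E[W²], which is finite. -/
theorem integrableOn_one_sub_chiSqCDF :
    IntegrableOn (fun u => 1 - chiSqCDF u) (Set.Ioi 0) := by
  have hm : Measurable fun u => 1 - chiSqCDF u := measurable_const.sub monotone_chiSqCDF.measurable
  refine ⟨hm.aestronglyMeasurable, ?_⟩
  have h := lintegral_eq_lintegral_meas_lt (gaussianReal 0 1) (f := fun w : ℝ => w ^ 2)
    (ae_of_all _ fun w => sq_nonneg w) (by fun_prop)
  have hfin : ∫⁻ w, ENNReal.ofReal (w ^ 2) ∂(gaussianReal 0 1) < ∞ :=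
    integrable_sq_gaussianReal.lintegral_lt_top
  rw [h] at hfin
  rw [hasFiniteIntegral_iff_ofReal (ae_of_all _ fun u => sub_nonneg.2 (chiSqCDF_le_one u))]
  refine lt_of_le_of_lt (le_of_eq ?_) hfin
  refine lintegral_congr fun u => ?_
  have e : {w : ℝ | u < w ^ 2} = {w : ℝ | w ^ 2 ≤ u}ᶜ := by ext w; simp
  rw [e, chiSqCDF_eq, ← probReal_compl_eq_one_sub (measurableSet_le (by fun_prop) (by fun_prop)),
    ofReal_measureReal]

theorem integrableOn_g {α : ℝ} (h1 : α ≤ 1) :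
    IntegrableOn (fun u => max 0 (α - chiSqCDF u)) (Set.Ioi 0) := by
  refine integrableOn_one_sub_chiSqCDF.mono'
    (measurable_const.max (measurable_const.sub monotone_chiSqCDF.measurable)).aestronglyMeasurable
    (ae_of_all _ fun u => ?_)
  rw [Real.norm_of_nonneg (le_max_left _ _)]
  exact max_le (sub_nonneg.2 (chiSqCDF_le_one u)) (by linarith)

/-- For α ≤ 1 the integrands are dominated by 1 - F. Beyond 1 the integrand is not integrable, which
is why the results on g stop there. -/
theorem continuousOn_g : ContinuousOn g (Set.Iic 1) := by
  unfold g
  refine continuousOn_of_dominated (bound := fun u => 1 - chiSqCDF u) (fun α _ =>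
    (measurable_const.max (measurable_const.sub monotone_chiSqCDF.measurable)).aestronglyMeasurable)
    (fun α hα => ae_of_all _ fun u => ?_) integrableOn_one_sub_chiSqCDF
    (ae_of_all _ fun u => by fun_prop)
  rw [Real.norm_of_nonneg (le_max_left _ _)]
  have : α ≤ 1 := hα
  exact max_le (sub_nonneg.2 (chiSqCDF_le_one u)) (by linarith)

theorem monotoneOn_g : MonotoneOn g (Set.Iic 1) := by
  intro α hα β hβ h
  exact integral_mono (integrableOn_g hα) (integrableOn_g hβ) fun u =>
    max_le_max le_rfl (by linarith)

theorem g_pos {α : ℝ} (h0 : 0 < α) (h1 : α ≤ 1) : 0 < g α := by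
  obtain ⟨t, ht, hF⟩ := exists_chiSqCDF_eq (half_pos h0) (by linarith)
  have h2 : ∫ u in Set.Ioc 0 t, (α / 2) ≤ ∫ u in Set.Ioc 0 t, max 0 (α - chiSqCDF u) := by
    refine setIntegral_mono_on (by simp) ((integrableOn_g h1).mono_set Set.Ioc_subset_Ioi_self)
      measurableSet_Ioc fun u hu => ?_
    have := monotone_chiSqCDF hu.2
    exact le_max_of_le_right (by linarith)
  have h3 : ∫ u in Set.Ioc 0 t, max 0 (α - chiSqCDF u) ≤ g α :=
    setIntegral_mono_set (integrableOn_g h1) (ae_of_all _ fun u => le_max_left _ _)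
      Set.Ioc_subset_Ioi_self.eventuallyLE
  have h4 : ∫ u in Set.Ioc 0 t, (α / 2) = t * (α / 2) := by
    simp [measureReal_def, ht.le]
  have : 0 < t * (α / 2) := by positivity
  linarith

/-- Layer cake for w² restricted to B: it suffices to identify the tail masses with the integrand of
g. -/
theorem setIntegral_sq_eq_g {B : Set ℝ} (hB : MeasurableSet B) (α : ℝ)
    (h : ∀ u, 0 < u → (gaussianReal 0 1).real (B ∩ {w | u < w ^ 2}) = max 0 (α - chiSqCDF u)) :
    ∫ w in B, w ^ 2 ∂(gaussianReal 0 1) = g α := by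
  rw [← integral_indicator hB, Integrable.integral_eq_integral_meas_lt
    (integrable_sq_gaussianReal.indicator hB)
    (ae_of_all _ fun w => Set.indicator_nonneg (fun _ _ => sq_nonneg _) w), g]
  refine setIntegral_congr_fun measurableSet_Ioi fun u hu => ?_
  have hu : 0 < u := hu
  rw [← h u hu]
  congr 1
  ext w
  by_cases hw : w ∈ B <;> simp [hw, hu.le]

theorem setIntegral_sq_quantile {t : ℝ} :
    ∫ w in {w : ℝ | w ^ 2 ≤ t}, w ^ 2 ∂(gaussianReal 0 1) = g (chiSqCDF t) := by
  have hm : ∀ u : ℝ, MeasurableSet {w : ℝ | w ^ 2 ≤ u} := fun u =>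
    measurableSet_le (by fun_prop) (by fun_prop)
  refine setIntegral_sq_eq_g (hm t) _ fun u hu => ?_
  have e : {w : ℝ | w ^ 2 ≤ t} ∩ {w | u < w ^ 2} = {w : ℝ | w ^ 2 ≤ t} \ {w : ℝ | w ^ 2 ≤ u} := by
    ext w; simp
  rw [e]
  rcases le_total u t with hut | hut
  · have hsub : {w : ℝ | w ^ 2 ≤ u} ⊆ {w : ℝ | w ^ 2 ≤ t} :=
      fun w hw => le_trans (show w ^ 2 ≤ u from hw) hut
    rw [measureReal_sdiff hsub (hm u), ← chiSqCDF_eq,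
      ← chiSqCDF_eq, max_eq_right (sub_nonneg.2 (monotone_chiSqCDF hut))]
  · have hsub : {w : ℝ | w ^ 2 ≤ t} ⊆ {w : ℝ | w ^ 2 ≤ u} :=
      fun w hw => le_trans (show w ^ 2 ≤ t from hw) hut
    rw [Set.sdiff_eq_empty.2 hsub, measureReal_empty,
      max_eq_left (sub_nonpos.2 (monotone_chiSqCDF hut))]

/-- The sublevel set of the chi-squared law of mass `α`, whose partial second moment is `g α`. -/
theorem exists_measurableSet_g {α : ℝ} (h0 : 0 < α) (h1 : α ≤ 1) :
    ∃ B : Set ℝ, MeasurableSet B ∧ (gaussianReal 0 1).real B = α ∧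
      ∫ w in B, w ^ 2 ∂(gaussianReal 0 1) = g α := by
  rcases h1.lt_or_eq with h1 | rfl
  · obtain ⟨t, ht, rfl⟩ := exists_chiSqCDF_eq h0 h1
    exact ⟨{w | w ^ 2 ≤ t}, measurableSet_le (by fun_prop) (by fun_prop), (chiSqCDF_eq t).symm,
      setIntegral_sq_quantile⟩
  -- Mass 1 has no finite quantile, so the whole line replaces a sublevel set.
  · refine ⟨Set.univ, .univ, by simp, setIntegral_sq_eq_g .univ _ fun u hu => ?_⟩
    have e : {w : ℝ | u < w ^ 2} = {w : ℝ | w ^ 2 ≤ u}ᶜ := by ext w; simp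
    rw [Set.univ_inter, e, max_eq_right (sub_nonneg.2 (chiSqCDF_le_one u)), chiSqCDF_eq,
      probReal_compl_eq_one_sub (measurableSet_le (by fun_prop) (by fun_prop))]

/-- Shows that the line α ↦ tα - E[(t - W²)⁺] meets g at α = F(t). Such lines bound energies of
subsets from below through a single average over S. -/
theorem integral_posPart_quantile (t : ℝ) :
    ∫ w, max 0 (t - w ^ 2) ∂(gaussianReal 0 1) = t * chiSqCDF t - g (chiSqCDF t) := by
  have hm : MeasurableSet {w : ℝ | w ^ 2 ≤ t} := measurableSet_le (by fun_prop) (by fun_prop)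
  have e : (fun w : ℝ => max 0 (t - w ^ 2))
      = Set.indicator {w : ℝ | w ^ 2 ≤ t} fun w => t - w ^ 2 := by
    ext w
    by_cases hw : w ^ 2 ≤ t
    · rw [Set.indicator_of_mem (by exact hw), max_eq_right (by linarith)]
    · rw [Set.indicator_of_notMem (by exact hw), max_eq_left (by linarith)]
  rw [e, integral_indicator hm, integral_sub (integrable_const _)
    integrable_sq_gaussianReal.integrableOn, setIntegral_sq_quantile, chiSqCDF_eq]
  simp [mul_comm]

/-- Finitely many affine minorants approximate `g` from below, uniformly on `[αs, 1]`. -/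
theorem exists_finset_affine_g {αs : ℝ} (h0 : 0 < αs) {δ : ℝ} (hδ : 0 < δ) :
    ∃ T : Finset ℝ, (∀ t ∈ T, 0 ≤ t) ∧ ∀ α ∈ Set.Icc αs 1, ∃ t ∈ T,
      g α - δ ≤ t * α - ∫ w, max 0 (t - w ^ 2) ∂(gaussianReal 0 1) := by
  have hg1 : ContinuousOn g (Set.Icc αs 1) := continuousOn_g.mono Set.Icc_subset_Iic_self
  have hpt : ∀ α ∈ Set.Icc αs 1, ∃ t : ℝ, 0 ≤ t ∧
      g α - δ < t * α - ∫ w, max 0 (t - w ^ 2) ∂(gaussianReal 0 1) := by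
    intro α hα
    have hα0 : 0 < α := h0.trans_le hα.1
    have hc : ContinuousWithinAt g (Set.Iic 1) α := continuousOn_g α hα.2
    -- The quantile is taken at some β slightly below α, since α = 1 has none. The line through (β,
    -- g β) has slope t > 0, so at α it still exceeds g β > g α - δ.
    have hev : ∀ᶠ β in 𝓝[<] α, g α - δ < g β := by
      have h2 : Tendsto g (𝓝[<] α) (𝓝 (g α)) :=
        hc.mono_left (nhdsWithin_mono _ fun β (hβ : β < α) => (hβ.le.trans hα.2))
      exact h2.eventually_const_lt (by linarith)
    have hev2 : ∀ᶠ β in 𝓝[<] α, 0 < β :=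
      (lt_mem_nhds hα0).filter_mono nhdsWithin_le_nhds
    obtain ⟨β, ⟨hβ, hβ0⟩, hβα⟩ := ((hev.and hev2).and self_mem_nhdsWithin).exists
    have hβα : β < α := hβα
    obtain ⟨t, ht, rfl⟩ := exists_chiSqCDF_eq hβ0 (hβα.trans_le hα.2)
    refine ⟨t, ht.le, ?_⟩
    rw [integral_posPart_quantile]
    nlinarith
  choose! t ht0 ht using hpt
  -- The strict inequality persists near each α by continuity, so compactness leaves finitely many
  -- slopes, hence finitely many Chebyshev events.
  obtain ⟨A, hA, hcov⟩ := isCompact_Icc.elim_nhdsWithin_subcover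
    (s := Set.Icc αs 1) (fun α => {β | g β - δ
      < t α * β - ∫ w, max 0 (t α - w ^ 2) ∂(gaussianReal 0 1)}) (fun α hα => by
      have h1 : ContinuousWithinAt (fun β => g β - δ) (Set.Icc αs 1) α :=
        (hg1 α hα).sub continuousWithinAt_const
      have h2 : ContinuousWithinAt (fun β =>
        t α * β - ∫ w, max 0 (t α - w ^ 2) ∂(gaussianReal 0 1)) (Set.Icc αs 1) α := by fun_prop
      exact h1.eventually_lt h2 (ht α hα))
  refine ⟨A.image t, ?_, fun α hα => ?_⟩
  · intro s hs
    obtain ⟨α, hα, rfl⟩ := Finset.mem_image.1 hs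
    exact ht0 α (hA α hα)
  · obtain ⟨β, hβ, h⟩ := Set.mem_iUnion₂.1 (hcov hα)
    exact ⟨t β, Finset.mem_image_of_mem t hβ, le_of_lt h⟩

/-- A bound on the truncated deficits below level `t` bounds the energy of every subset from below. -/
theorem energy_lower_bound {ι : Type*} (S D : Finset ι) (hD : D ⊆ S) (W : ι → ℝ) (t E δ : ℝ)
    (hE : ∑ j ∈ S, max 0 (t - W j ^ 2) ≤ S.card * (E + δ)) :
    t * D.card - S.card * (E + δ) ≤ ∑ j ∈ D, W j ^ 2 := by
  have h1 : ∑ j ∈ D, (t - W j ^ 2) ≤ ∑ j ∈ S, max 0 (t - W j ^ 2) :=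
    (Finset.sum_le_sum fun j _ => le_max_right _ _).trans
      (Finset.sum_le_sum_of_subset_of_nonneg hD fun j _ _ => le_max_left _ _)
  rw [Finset.sum_sub_distrib, Finset.sum_const, nsmul_eq_mul] at h1
  linarith

/-! ### The decoder and its error events. -/

/-- The finitely many candidates are tested one after the other, which keeps the choice measurable;
`i₀` is returned when all tests fail. -/
theorem exists_measurable_selection {α ι : Type*} [MeasurableSpace α] [DecidableEq ι]
    (s : Finset ι) (i₀ : ι) (A : ι → Set α) (hA : ∀ i, MeasurableSet (A i)) :
    ∃ f : α → ι, (∀ i, MeasurableSet {x | f x = i}) ∧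
      ∀ x, (∃ i ∈ s, x ∈ A i) → f x ∈ s ∧ x ∈ A (f x) := by
  classical
  induction s using Finset.induction_on with
  | empty => exact ⟨fun _ => i₀, fun i => .const _, fun x ⟨i, hi, _⟩ => by simp at hi⟩
  | insert a s _ ih =>
    obtain ⟨f, hf, hsel⟩ := ih
    refine ⟨fun x => if x ∈ A a then a else f x, fun i => ?_, fun x hx => ?_⟩
    · have e : {x | (if x ∈ A a then a else f x) = i}
          = (A a ∩ {_x | a = i}) ∪ ((A a)ᶜ ∩ {x | f x = i}) := by
        ext x
        by_cases h : x ∈ A a <;> simp [h]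
      rw [e]
      exact ((hA a).inter (.const _)).union ((hA a).compl.inter (hf i))
    · by_cases h : x ∈ A a
      · simp [h]
      · obtain ⟨i, hi, hxi⟩ := hx
        have hne : i ≠ a := by rintro rfl; exact h hxi
        obtain ⟨h1, h2⟩ := hsel x ⟨i, (Finset.mem_insert.1 hi).resolve_left hne, hxi⟩
        simp only [h, if_false]
        exact ⟨Finset.mem_insert_of_mem h1, h2⟩

theorem prod_measure_le {α β : Type*} [MeasurableSpace α] [MeasurableSpace β] (μ : Measure α)
    [IsProbabilityMeasure μ] (ν : Measure β) [IsProbabilityMeasure ν] {A : Set (α × β)}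
    (hA : MeasurableSet A) (G : Set α) (c : ℝ≥0∞) (h : ∀ w ∈ G, ν (Prod.mk w ⁻¹' A) ≤ c) :
    μ.prod ν A ≤ μ Gᶜ + c := by
  rw [Measure.prod_apply hA]
  have hpt : ∀ w, ν (Prod.mk w ⁻¹' A) ≤ c + Gᶜ.indicator (fun _ => 1) w := by
    intro w
    by_cases hw : w ∈ G
    · exact (h w hw).trans le_self_add
    · rw [Set.indicator_of_mem (by simpa using hw)]
      exact prob_le_one.trans le_add_self
  refine (lintegral_mono hpt).trans ?_
  rw [lintegral_add_left measurable_const, lintegral_const, measure_univ, mul_one, add_comm]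
  gcongr
  exact (lintegral_indicator_const_le _ _).trans (by simp)

/-- The law of the coefficients. -/
def coeffLaw (cβ : ℝ) (k p : ℕ) : Measure (Fin p → ℝ) :=
  Measure.pi fun _ : Fin p => gaussianReal 0 (cβ / k).toNNReal

instance (cβ : ℝ) (k p : ℕ) : IsProbabilityMeasure (coeffLaw cβ k p) := by
  unfold coeffLaw; infer_instance

theorem randomnessLaw_eq (cβ σ : ℝ) (k n p : ℕ) :
    randomnessLaw cβ σ k n p = (coeffLaw cβ k p).prod (designLaw n p σ) := rfl

instance (cβ σ : ℝ) (k n p : ℕ) : IsProbabilityMeasure (randomnessLaw cβ σ k n p) := by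
  rw [randomnessLaw_eq]; infer_instance

@[fun_prop]
theorem measurable_sparseVector {p : ℕ} (S : Finset (Fin p)) :
    Measurable (sparseVector S) := by
  unfold sparseVector
  refine measurable_pi_lambda _ fun i => ?_
  split_ifs <;> fun_prop

theorem Decoder.measurableSet_of_est {n p : ℕ} (dec : Decoder n p) (P : Finset (Fin p) → Prop) :
    MeasurableSet {xy : (Fin n → Fin p → ℝ) × (Fin n → ℝ) | P (dec.est xy.1 xy.2)} := by
  have e : {xy : (Fin n → Fin p → ℝ) × (Fin n → ℝ) | P (dec.est xy.1 xy.2)}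
      = ⋃ T : Finset (Fin p), {xy | dec.est xy.1 xy.2 = T} ∩ {_xy | P T} := by
    ext xy; simp
  rw [e]
  exact .iUnion fun T => (dec.measurableSet_est T).inter (.const _)

theorem measurable_observation {n p : ℕ} (S : Finset (Fin p)) :
    Measurable fun ω : (Fin p → ℝ) × (Fin n → Fin p → ℝ) × (Fin n → ℝ) =>
      (ω.2.1, observation (sparseVector S ω.1) ω.2.1 ω.2.2) := by
  have h : Measurable fun ω : (Fin p → ℝ) × (Fin n → Fin p → ℝ) × (Fin n → ℝ) =>
      sparseVector S ω.1 := (measurable_sparseVector S).comp measurable_fst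
  have h' : ∀ j, Measurable fun ω : (Fin p → ℝ) × (Fin n → Fin p → ℝ) × (Fin n → ℝ) =>
      sparseVector S ω.1 j := fun j => (measurable_pi_apply j).comp h
  refine Measurable.prodMk (by fun_prop) (measurable_pi_lambda _ fun i => ?_)
  unfold observation
  fun_prop

theorem Decoder.measurableSet_est_observation {n p : ℕ} (dec : Decoder n p) (S : Finset (Fin p))
    (P : Finset (Fin p) → Prop) :
    MeasurableSet {ω : (Fin p → ℝ) × (Fin n → Fin p → ℝ) × (Fin n → ℝ) |
      P (dec.est ω.2.1 (observation (sparseVector S ω.1) ω.2.1 ω.2.2))} :=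
  measurable_observation S (dec.measurableSet_of_est P)

/-- The quantized coefficient vectors supported on `S`, with levels in `Q`. -/
def candidates {p : ℕ} (Q : Finset ℝ) (S : Finset (Fin p)) : Finset (Fin p → ℝ) :=
  Fintype.piFinset fun j => if j ∈ S then Q else {0}

theorem mem_candidates {p : ℕ} {Q : Finset ℝ} {S : Finset (Fin p)} {b : Fin p → ℝ} :
    b ∈ candidates Q S ↔ (∀ j ∈ S, b j ∈ Q) ∧ ∀ j ∉ S, b j = 0 := by
  rw [candidates, Fintype.mem_piFinset]
  constructor
  · intro h
    refine ⟨fun j hj => ?_, fun j hj => ?_⟩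
    · simpa [hj] using h j
    · simpa [hj] using h j
  · rintro ⟨h1, h2⟩ j
    by_cases hj : j ∈ S
    · simpa [hj] using h1 j hj
    · simpa [hj] using h2 j hj

theorem card_candidates {p : ℕ} (Q : Finset ℝ) (S : Finset (Fin p)) :
    (candidates Q S).card = Q.card ^ S.card := by
  rw [candidates, Fintype.card_piFinset]
  simp only [apply_ite, Finset.card_singleton, Finset.prod_ite, Finset.prod_const, one_pow,
    mul_one]
  congr 2
  ext j; simp

/-- Coefficients that are well quantized and every large part of which has enough energy. -/
def typicalCoeffs {p : ℕ} (Q : Finset ℝ) (S : Finset (Fin p)) (d : ℕ) (ε : ℝ) (e : ℕ → ℝ) :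
    Set (Fin p → ℝ) :=
  {w | (∃ b ∈ candidates Q S, ∑ j, (sparseVector S w j - b j) ^ 2 ≤ ε) ∧
    ∀ D ⊆ S, d < D.card → e D.card ≤ ∑ j ∈ D, w j ^ 2}

/-- Wrong supports are grouped by A = S ∩ T. There are at most 2^k groups, and within a group T is
determined by T \ S, a set of size ℓ = k - |A|, so the group has at most p.choose ℓ members. -/
theorem sum_choose_weight_le {p : ℕ} (S : Finset (Fin p)) (k d : ℕ) (hS : S.card = k)
    (f : ℕ → ℝ) (κ : ℝ) (hκ0 : 0 ≤ κ) (hf : ∀ ℓ, 0 ≤ f ℓ)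
    (hκ : ∀ ℓ, d < ℓ → ℓ ≤ k → p.choose ℓ * f ℓ ≤ κ) :
    ∑ T ∈ (Finset.univ.powersetCard k).filter (fun T : Finset (Fin p) => d < (S \ T).card),
      f (S \ T).card ≤ 2 ^ k * κ := by
  rw [← Finset.sum_fiberwise_of_maps_to (t := S.powerset) (g := fun T => S ∩ T)
    (fun T _ => Finset.mem_powerset.2 Finset.inter_subset_left)]
  have hc : (2 : ℝ) ^ k * κ = ∑ _A ∈ S.powerset, κ := by
    rw [Finset.sum_const, Finset.card_powerset, hS, nsmul_eq_mul]; push_cast; rfl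
  rw [hc]
  refine Finset.sum_le_sum fun A hA => ?_
  have hAS : A ⊆ S := Finset.mem_powerset.1 hA
  have hcard : ∀ T ∈ ((Finset.univ.powersetCard k).filter
      (fun T : Finset (Fin p) => d < (S \ T).card)).filter (fun T => S ∩ T = A),
      (S \ T).card = k - A.card ∧ (T \ S).card = k - A.card ∧ d < k - A.card := by
    intro T hT
    simp only [Finset.mem_filter, Finset.mem_powersetCard] at hT
    obtain ⟨⟨⟨_, hTk⟩, hd⟩, hTA⟩ := hT
    have h1 : (S \ T).card = k - A.card := by
      rw [← hTA, ← hS, ← Finset.card_sdiff_of_subset Finset.inter_subset_left,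
        Finset.sdiff_inter_self_left]
    have h2 : (T \ S).card = (S \ T).card := Finset.card_sdiff_comm (hTk.trans hS.symm)
    exact ⟨h1, h2.trans h1, h1 ▸ hd⟩
  rcases Finset.eq_empty_or_nonempty (((Finset.univ.powersetCard k).filter
      (fun T : Finset (Fin p) => d < (S \ T).card)).filter (fun T => S ∩ T = A)) with h0 | ⟨T₀, h0⟩
  · rw [h0]; simpa using hκ0
  · rw [Finset.sum_congr rfl (g := fun _ => f (k - A.card)) fun T hT => by rw [(hcard T hT).1],
      Finset.sum_const, nsmul_eq_mul]
    refine le_trans ?_ (hκ (k - A.card) (hcard T₀ h0).2.2 (Nat.sub_le _ _))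
    refine mul_le_mul_of_nonneg_right ?_ (hf _)
    norm_cast
    have : (Finset.univ.powersetCard (k - A.card) : Finset (Finset (Fin p))).card
        = p.choose (k - A.card) := by simp
    rw [← this]
    refine Finset.card_le_card_of_injOn (fun T => T \ S) (fun T hT => ?_) (fun T hT T' hT' hEq => ?_)
    · simpa using (hcard T hT).2.1
    · have e : ∀ T ∈ ((Finset.univ.powersetCard k).filter
          (fun T : Finset (Fin p) => d < (S \ T).card)).filter (fun T => S ∩ T = A),
          T = (T \ S) ∪ A := by
        intro T hT
        simp only [Finset.mem_filter] at hT
        rw [← hT.2, Finset.inter_comm, Finset.sdiff_union_inter]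
      simp only at hEq
      rw [e T hT, e T' hT', hEq]

/-- The performance of the decoder which outputs a support some quantized vector on which explains
the observations up to the noise level. -/
theorem exists_decoder_error_le {n p : ℕ} (cβ σ : ℝ) (hσ : 0 < σ) (k d : ℕ) (Q : Finset ℝ)
    (hQ : Q.Nonempty) (ε δ θ κ : ℝ) (hε : 0 ≤ ε) (hδ0 : 0 < δ) (hδ1 : δ < 1) (hθ0 : 0 ≤ θ)
    (hθ : θ ≤ 1 / 2) (hκ0 : 0 ≤ κ) (e : ℕ → ℝ) (he : ∀ ℓ, d < ℓ → ℓ ≤ k → 0 < e ℓ + σ ^ 2)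
    (hκ : ∀ ℓ, d < ℓ → ℓ ≤ k → p.choose ℓ * Real.exp (-(n / 2) *
      Real.log ((e ℓ + σ ^ 2) * (1 - δ) / ((ε + σ ^ 2) * (1 + δ)))) ≤ κ) :
    ∃ dec : Decoder n p, ∀ S : Finset (Fin p), S.card = k →
      randomnessLaw cβ σ k n p
        {ω | IsError d S (dec.est ω.2.1 (observation (sparseVector S ω.1) ω.2.1 ω.2.2))}
      ≤ coeffLaw cβ k p (typicalCoeffs Q S d ε e)ᶜ
        + ENNReal.ofReal ((1 + (2 * Q.card) ^ k) *
            Real.exp (-(1 / 2) * (θ * (n * δ) - n * θ ^ 2)) + (2 * Q.card) ^ k * κ) := by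
  classical
  have hM : (1 : ℝ) ≤ Q.card := by exact_mod_cast hQ.card_pos
  set ρ : ℝ := (ε + σ ^ 2) * (1 + δ) with hρdef
  have hρ : 0 < ρ := by positivity
  let acc : Finset (Fin p) → Set ((Fin n → Fin p → ℝ) × (Fin n → ℝ)) := fun T =>
    ⋃ b ∈ candidates Q T, {xy | ∑ i, (xy.2 i - ∑ j, xy.1 i j * b j) ^ 2 ≤ n * ρ}
  have hacc : ∀ T, MeasurableSet (acc T) := fun T =>
    Finset.measurableSet_biUnion _ fun b _ => measurableSet_le (by fun_prop) (by fun_prop)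
  obtain ⟨f, hf, hsel⟩ := exists_measurable_selection
    (Finset.univ.powersetCard k : Finset (Finset (Fin p))) ∅ acc hacc
  let dec : Decoder n p := ⟨fun X Y => f (X, Y), fun T => hf T⟩
  refine ⟨dec, fun S hS => ?_⟩
  rw [randomnessLaw_eq]
  -- The coefficients are frozen at a typical value; only the design and the noise remain random.
  refine prod_measure_le _ _ (dec.measurableSet_est_observation S _) _ _ fun w hw => ?_
  obtain ⟨⟨b₀, hb₀, hb₀ε⟩, henergy⟩ := hw
  set β := sparseVector S w with hβ
  have hβ0 : ∀ j ∉ S, β j = 0 := fun j hj => by simp [hβ, sparseVector, hj]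
  have hβ1 : ∀ j ∈ S, β j = w j := fun j hj => by simp [hβ, sparseVector, hj]
  set tail : ℝ := Real.exp (-(1 / 2) * (θ * (n * δ) - n * θ ^ 2))
  -- The error is covered by three events. In `U₀` the quantized true vector fails the test; in `U₁`
  -- some residual is small although at least d + 1 true coefficients are unexplained; in `U₂` the
  -- columns of T \ S reduce a large residual to noise level.
  let U₀ : Set ((Fin n → Fin p → ℝ) × (Fin n → ℝ)) :=
    {xz | (ε + σ ^ 2) * (n + n * δ) ≤ residualSq (β - b₀) xz}
  let U₁ : Set ((Fin n → Fin p → ℝ) × (Fin n → ℝ)) :=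
    ⋃ E ∈ S.powerset.filter (fun E => d < (S \ E).card), ⋃ b ∈ candidates Q E,
      {xz | residualSq (β - b) xz ≤ (e (S \ E).card + σ ^ 2) * (n - n * δ)}
  let Wrong := (Finset.univ.powersetCard k).filter
    (fun T : Finset (Fin p) => d < (S \ T).card)
  -- As β vanishes on T \ S, β - b equals `aof - bof` with `bof` supported on T \ S and `aof` off
  -- it: exactly the split that makes `designLaw_cross_le` applicable.
  let aof : Finset (Fin p) → (Fin p → ℝ) → Fin p → ℝ := fun T b j =>
    if j ∈ T \ S then 0 else β j - b j
  let bof : Finset (Fin p) → (Fin p → ℝ) → Fin p → ℝ := fun T b j =>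
    if j ∈ T \ S then b j else 0
  let U₂ : Set ((Fin n → Fin p → ℝ) × (Fin n → ℝ)) :=
    ⋃ T ∈ Wrong, ⋃ b ∈ candidates Q T,
      {xz | n * ((e (S \ T).card + σ ^ 2) * (1 - δ)) ≤ residualSq (aof T b) xz ∧
        residualSq (aof T b - bof T b) xz ≤ n * ρ}
  have hres : ∀ (b : Fin p → ℝ) (xz : (Fin n → Fin p → ℝ) × (Fin n → ℝ)),
      ∑ i, (observation β xz.1 xz.2 i - ∑ j, xz.1 i j * b j) ^ 2 = residualSq (β - b) xz := by
    intro b xz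
    unfold residualSq observation
    refine Finset.sum_congr rfl fun i _ => ?_
    simp only [Pi.sub_apply, mul_sub, Finset.sum_sub_distrib]
    ring
  have hsub : Prod.mk w ⁻¹' {ω : (Fin p → ℝ) × (Fin n → Fin p → ℝ) × (Fin n → ℝ) |
      IsError d S (dec.est ω.2.1 (observation (sparseVector S ω.1) ω.2.1 ω.2.2))}
      ⊆ U₀ ∪ (U₁ ∪ U₂) := by
    intro xz hxz
    by_contra hcon
    simp only [Set.mem_union, not_or] at hcon
    obtain ⟨h0, h1, h2⟩ := hcon
    have h0' : residualSq (β - b₀) xz ≤ n * ρ := by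
      have : residualSq (β - b₀) xz < (ε + σ ^ 2) * (n + n * δ) := not_le.1 h0
      refine this.le.trans (le_of_eq ?_)
      rw [hρdef]; ring
    have hS' : S ∈ (Finset.univ.powersetCard k : Finset (Finset (Fin p))) := by simp [hS]
    have hSacc : (xz.1, observation β xz.1 xz.2) ∈ acc S := by
      refine Set.mem_iUnion₂.2 ⟨b₀, hb₀, ?_⟩
      change ∑ i, (observation β xz.1 xz.2 i - ∑ j, xz.1 i j * b₀ j) ^ 2 ≤ n * ρ
      rw [hres]; exact h0'
    obtain ⟨hT, hTacc⟩ := hsel _ ⟨S, hS', hSacc⟩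
    set T := f (xz.1, observation β xz.1 xz.2) with hTdef
    have hTk : T.card = k := (Finset.mem_powersetCard.1 hT).2
    have herr : d < (S \ T).card := by
      -- Both sets have k elements, so misses and false alarms are equally many.
      have : IsError d S T := hxz
      rcases this with h | h
      · exact h
      · rwa [Finset.card_sdiff_comm (hS.trans hTk.symm)]
    obtain ⟨b, hb, hbT⟩ := Set.mem_iUnion₂.1 hTacc
    have hbT : residualSq (β - b) xz ≤ n * ρ := by rw [← hres]; exact hbT
    obtain ⟨hb1, hb2⟩ := mem_candidates.1 hb
    have hab : aof T b - bof T b = β - b := by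
      ext j
      simp only [aof, bof, Pi.sub_apply]
      by_cases hj : j ∈ T \ S
      · simp only [hj, if_true]
        rw [hβ0 j (Finset.mem_sdiff.1 hj).2]
      · simp only [hj, if_false, sub_zero]
    by_cases hcase : n * ((e (S \ T).card + σ ^ 2) * (1 - δ)) ≤ residualSq (aof T b) xz
    · refine h2 (Set.mem_iUnion₂.2 ⟨T, Finset.mem_filter.2 ⟨hT, herr⟩,
        Set.mem_iUnion₂.2 ⟨b, hb, hcase, ?_⟩⟩)
      rw [hab]; exact hbT
    -- The vector `aof T b` depends on T and b only through S ∩ T and the restriction of b to S.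
    -- Hence `U₁` needs a union over exp(O(k)) events, not over all supports T.
    · refine h1 (Set.mem_iUnion₂.2 ⟨S ∩ T, Finset.mem_filter.2
        ⟨Finset.mem_powerset.2 Finset.inter_subset_left, ?_⟩,
        Set.mem_iUnion₂.2 ⟨fun j => if j ∈ S then b j else 0, ?_, ?_⟩⟩)
      · rwa [Finset.sdiff_inter_self_left]
      · refine mem_candidates.2 ⟨fun j hj => ?_, fun j hj => ?_⟩
        · simp only [(Finset.mem_inter.1 hj).1, if_true]
          exact hb1 j (Finset.mem_inter.1 hj).2
        · by_cases hjS : j ∈ S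
          · simp only [hjS, if_true]
            exact hb2 j fun hjT => hj (Finset.mem_inter.2 ⟨hjS, hjT⟩)
          · simp [hjS]
      · change residualSq _ xz ≤ _
        have ha : (β - fun j => if j ∈ S then b j else 0) = aof T b := by
          ext j
          simp only [aof, Pi.sub_apply, Finset.mem_sdiff]
          by_cases hjS : j ∈ S
          · simp [hjS]
          · by_cases hjT : j ∈ T
            · simp [hjS, hjT, hβ0 j hjS]
            · simp [hjS, hjT, hb2 j hjT]
        rw [ha, Finset.sdiff_inter_self_left]
        refine (not_le.1 hcase).le.trans (le_of_eq ?_)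
        ring
  have hU₀ : designLaw n p σ U₀ ≤ ENNReal.ofReal tail :=
    designLaw_upper_tail σ hσ (β - b₀) (ε + σ ^ 2) (by
      simp only [Pi.sub_apply]; linarith) (n * δ) θ hθ0 hθ (by positivity)
  have hU₁ : designLaw n p σ U₁ ≤ ENNReal.ofReal ((2 * Q.card) ^ k * tail) := by
    have hE : ∀ E ∈ S.powerset.filter (fun E => d < (S \ E).card),
        designLaw n p σ (⋃ b ∈ candidates Q E,
          {xz | residualSq (β - b) xz ≤ (e (S \ E).card + σ ^ 2) * (n - n * δ)})
          ≤ ENNReal.ofReal (Q.card ^ k * tail) := by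
      intro E hE
      rw [Finset.mem_filter, Finset.mem_powerset] at hE
      refine (measure_biUnion_finset_le _ _).trans ?_
      have hb : ∀ b ∈ candidates Q E, designLaw n p σ
          {xz | residualSq (β - b) xz ≤ (e (S \ E).card + σ ^ 2) * (n - n * δ)}
          ≤ ENNReal.ofReal tail := by
        intro b hb
        refine designLaw_lower_tail σ hσ (β - b) _ ?_ (n * δ) θ hθ0 ?_
        · have h1 := henergy (S \ E) Finset.sdiff_subset hE.2
          have h2 : ∑ j ∈ S \ E, w j ^ 2 = ∑ j ∈ S \ E, (β - b) j ^ 2 := by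
            refine Finset.sum_congr rfl fun j hj => ?_
            rw [Finset.mem_sdiff] at hj
            rw [Pi.sub_apply, hβ1 j hj.1, (mem_candidates.1 hb).2 j hj.2, sub_zero]
          have h3 : ∑ j ∈ S \ E, (β - b) j ^ 2 ≤ ∑ j, (β - b) j ^ 2 :=
            Finset.sum_le_sum_of_subset_of_nonneg (Finset.subset_univ _) fun _ _ _ => sq_nonneg _
          linarith
        · exact mul_le_of_le_one_right (by positivity) hδ1.le
      refine (Finset.sum_le_sum hb).trans ?_
      rw [Finset.sum_const, card_candidates, nsmul_eq_mul,
        ENNReal.ofReal_mul (by positivity)]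
      gcongr
      rw [← ENNReal.ofReal_natCast]
      refine ENNReal.ofReal_le_ofReal ?_
      push_cast
      exact pow_le_pow_right₀ hM (hS ▸ Finset.card_le_card hE.1)
    refine (measure_biUnion_finset_le _ _).trans ((Finset.sum_le_sum hE).trans ?_)
    rw [Finset.sum_const, nsmul_eq_mul, ← ENNReal.ofReal_natCast,
      ← ENNReal.ofReal_mul (by positivity)]
    refine ENNReal.ofReal_le_ofReal ?_
    rw [mul_pow, mul_assoc]
    refine mul_le_mul_of_nonneg_right ?_ (by positivity)
    have : (S.powerset.filter (fun E => d < (S \ E).card)).card ≤ 2 ^ k := by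
      refine (Finset.card_filter_le _ _).trans ?_
      rw [Finset.card_powerset, hS]
    exact_mod_cast this
  have hU₂ : designLaw n p σ U₂ ≤ ENNReal.ofReal ((2 * Q.card) ^ k * κ) := by
    set F : ℕ → ℝ := fun ℓ => Real.exp (-(n / 2) *
      Real.log ((e ℓ + σ ^ 2) * (1 - δ) / ρ)) with hF
    have hT : ∀ T ∈ Wrong, designLaw n p σ (⋃ b ∈ candidates Q T,
      {xz | n * ((e (S \ T).card + σ ^ 2) * (1 - δ)) ≤ residualSq (aof T b) xz ∧
        residualSq (aof T b - bof T b) xz ≤ n * ρ})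
          ≤ ENNReal.ofReal (Q.card ^ k * F (S \ T).card) := by
      intro T hT
      simp only [Wrong, Finset.mem_filter, Finset.mem_powersetCard] at hT
      obtain ⟨⟨_, hTk⟩, hd⟩ := hT
      have hle : (S \ T).card ≤ k := hS ▸ Finset.card_le_card Finset.sdiff_subset
      refine (measure_biUnion_finset_le _ _).trans ?_
      refine (Finset.sum_le_sum fun b _ => designLaw_cross_le σ (aof T b) (bof T b) (T \ S)
        (fun j hj => by simp only [aof, hj, if_true]) (fun j hj => by simp only [bof, hj, if_false])
        _ ρ (mul_pos (he _ hd hle) (by linarith)) hρ).trans ?_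
      rw [Finset.sum_const, card_candidates, nsmul_eq_mul, hTk, ENNReal.ofReal_mul (by positivity)]
      gcongr
      rw [← ENNReal.ofReal_natCast]
      push_cast
      exact le_rfl
    refine (measure_biUnion_finset_le _ _).trans ((Finset.sum_le_sum hT).trans ?_)
    rw [← ENNReal.ofReal_sum_of_nonneg fun T _ => by positivity]
    refine ENNReal.ofReal_le_ofReal ?_
    rw [← Finset.mul_sum, mul_pow, mul_comm ((2 : ℝ) ^ k), mul_assoc]
    exact mul_le_mul_of_nonneg_left (sum_choose_weight_le S k d hS F κ hκ0
      (fun ℓ => (Real.exp_pos _).le) hκ) (by positivity)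
  refine (measure_mono hsub).trans ((measure_union_le _ _).trans
    ((add_le_add hU₀ ((measure_union_le _ _).trans (add_le_add hU₁ hU₂))).trans (le_of_eq ?_)))
  have htail : 0 ≤ tail := (Real.exp_pos _).le
  rw [← ENNReal.ofReal_add (by positivity) (by positivity),
    ← ENNReal.ofReal_add (by positivity) (by positivity)]
  congr 1
  ring

/-! ### Typical coefficients: quantization and energy. -/

/-- A finite quantizer of the standard Gaussian law with small mean squared error. -/
theorem exists_quantizer {δ : ℝ} (hδ : 0 < δ) :
    ∃ q : SimpleFunc ℝ ℝ, ∫ w, (w - q w) ^ 2 ∂(gaussianReal 0 1) ≤ δ ∧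
      MemLp (fun w => (w - q w) ^ 2) 2 (gaussianReal 0 1) := by
  have hid : MemLp (id : ℝ → ℝ) 2 (gaussianReal 0 1) := memLp_id_gaussianReal 2
  obtain ⟨q, hq, hq2⟩ := hid.exists_simpleFunc_eLpNorm_sub_lt (by norm_num)
    (ε := ENNReal.ofReal (√δ)) (by simp [hδ])
  refine ⟨q, ?_, ?_⟩
  · have h2 : MemLp (fun w => w - q w) 2 (gaussianReal 0 1) := hid.sub hq2
    have h3 := h2.eLpNorm_eq_integral_rpow_norm (by norm_num) (by norm_num)
    have h4 : eLpNorm (fun w => w - q w) 2 (gaussianReal 0 1) < ENNReal.ofReal (√δ) := hq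
    rw [h3, ENNReal.ofReal_lt_ofReal_iff (by positivity)] at h4
    simp only [ENNReal.toReal_ofNat, Real.rpow_ofNat, Real.norm_eq_abs, sq_abs] at h4
    have h5 : √(∫ w, (w - q w) ^ 2 ∂(gaussianReal 0 1)) < √δ := by
      rw [Real.sqrt_eq_rpow, one_div]; exact h4
    exact ((Real.sqrt_lt_sqrt_iff (integral_nonneg fun w => sq_nonneg _)).1 h5).le
  -- Chebyshev for the squared error needs fourth moments, available because a simple function is
  -- bounded.
  · have h4 : MemLp (fun w => w - q w) 4 (gaussianReal 0 1) :=
      (memLp_id_gaussianReal 4).sub (q.memLp_of_isFiniteMeasure 4 _)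
    rw [memLp_two_iff_integrable_sq
      (Measurable.aestronglyMeasurable (by have := q.measurable; fun_prop))]
    have := h4.integrable_norm_pow (p := 4) (by norm_num)
    refine this.congr (ae_of_all _ fun w => ?_)
    simp only [Real.norm_eq_abs]
    rw [← pow_mul, Even.pow_abs (by decide)]

/-- The coefficients are typical with high probability, uniformly in the dimensions. -/
theorem exists_typicalCoeffs_bound {αs : ℝ} (h0 : 0 < αs) {δ : ℝ} (hδ : 0 < δ) :
    ∃ (M : ℕ) (K : ℝ), 0 ≤ K ∧ ∀ (c : ℝ) (k p : ℕ), 0 < c → 0 < k → ∃ Q : Finset ℝ, Q.Nonempty ∧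
      Q.card ≤ M ∧ ∀ S : Finset (Fin p), S.card = k →
        coeffLaw c k p (typicalCoeffs Q S ⌊αs * (k : ℝ)⌋₊ (c * δ)
          (fun ℓ => c * (g (ℓ / k) - δ)))ᶜ ≤ ENNReal.ofReal (K / k) := by
  classical
  obtain ⟨q, hq1, hq2⟩ := exists_quantizer (half_pos hδ)
  obtain ⟨T, hT0, hT⟩ := exists_finset_affine_g h0 (half_pos hδ)
  set N := gaussianReal 0 1
  set V : ℝ := ∫ w, ((w - q w) ^ 2) ^ 2 ∂N
  have hV0 : 0 ≤ V := integral_nonneg fun w => sq_nonneg _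
  -- The number of levels is that of a fixed quantizer of N(0,1); K adds the Chebyshev constants of
  -- the quantization error and of one truncated deficit per slope t.
  refine ⟨q.range.card, V / (δ / 2) ^ 2 + ∑ t ∈ T, t ^ 2 / (δ / 2) ^ 2, by positivity,
    fun c k p hc hk => ?_⟩
  have hkR : (0 : ℝ) < k := by exact_mod_cast hk
  set v : ℝ := c / k with hv
  have hv0 : 0 < v := by positivity
  have hvk : v * k = c := by rw [hv]; field_simp
  have hs : √v * √v = v := Real.mul_self_sqrt hv0.le
  have hs0 : 0 < √v := Real.sqrt_pos.2 hv0
  -- Rescaling the levels by the standard deviation leaves their number independent of c, k and p.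
  refine ⟨q.range.image (fun t => √v * t), ⟨√v * q 0, Finset.mem_image_of_mem _ (by simp)⟩,
    Finset.card_image_le, fun S hS => ?_⟩
  have hSne : S.Nonempty := Finset.card_pos.1 (hS ▸ hk)
  let B₀ : Set (Fin p → ℝ) := {w | S.card * (δ / 2) ≤
    |∑ j ∈ S, (w j / √v - q (w j / √v)) ^ 2 - S.card * ∫ t, (t - q t) ^ 2 ∂N|}
  let B₁ : ℝ → Set (Fin p → ℝ) := fun t => {w | S.card * (δ / 2) ≤
    |∑ j ∈ S, max 0 (t - (w j / √v) ^ 2) - S.card * ∫ u, max 0 (t - u ^ 2) ∂N|}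
  have hB₀ : coeffLaw c k p B₀ ≤ ENNReal.ofReal (V / (S.card * (δ / 2) ^ 2)) :=
    coeff_chebyshev v hv0 (fun t => (t - q t) ^ 2) (by have := q.measurable; fun_prop) hq2 V le_rfl S hSne _ (half_pos hδ)
  have hB₁ : ∀ t ∈ T, coeffLaw c k p (B₁ t) ≤ ENNReal.ofReal (t ^ 2 / (S.card * (δ / 2) ^ 2)) := by
    intro t ht
    have hb : ∀ u : ℝ, 0 ≤ max 0 (t - u ^ 2) ∧ max 0 (t - u ^ 2) ≤ t := fun u =>
      ⟨le_max_left _ _, max_le (hT0 t ht) (by linarith [sq_nonneg u])⟩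
    have hL : MemLp (fun u : ℝ => max 0 (t - u ^ 2)) 2 N :=
      MemLp.of_bound (Measurable.aestronglyMeasurable (by fun_prop)) t
        (ae_of_all _ fun u => by rw [Real.norm_of_nonneg (hb u).1]; exact (hb u).2)
    refine coeff_chebyshev v hv0 (fun u => max 0 (t - u ^ 2)) (by fun_prop) hL (t ^ 2) ?_ S hSne _ (half_pos hδ)
    refine (integral_mono hL.integrable_sq (integrable_const (t ^ 2)) fun u =>
      pow_le_pow_left₀ (hb u).1 (hb u).2 2).trans ?_
    simp
  have hsub : (typicalCoeffs (q.range.image (fun t => √v * t)) S ⌊αs * (k : ℝ)⌋₊ (c * δ)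
          (fun ℓ => c * (g (ℓ / k) - δ)))ᶜ ⊆ B₀ ∪ ⋃ t ∈ T, B₁ t := by
    intro w hw
    by_contra hcon
    simp only [Set.mem_union, Set.mem_iUnion, not_or, not_exists] at hcon
    obtain ⟨hc0, hc1⟩ := hcon
    refine hw ⟨⟨fun j => if j ∈ S then √v * q (w j / √v) else 0, ?_, ?_⟩, fun D hD hDc => ?_⟩
    · refine mem_candidates.2 ⟨fun j hj => ?_, fun j hj => by simp [hj]⟩
      simp only [hj, if_true]
      exact Finset.mem_image_of_mem _ (by simp)
    · have h1 : ∑ j, (sparseVector S w j - if j ∈ S then √v * q (w j / √v) else 0) ^ 2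
          = v * ∑ j ∈ S, (w j / √v - q (w j / √v)) ^ 2 := by
        rw [Finset.mul_sum, ← Finset.sum_subset (Finset.subset_univ S)]
        · refine Finset.sum_congr rfl fun j hj => ?_
          simp only [sparseVector, hj, if_true]
          have : w j = √v * (w j / √v) := by field_simp
          conv_lhs => rw [this]
          rw [mul_div_cancel_left₀ _ hs0.ne', ← mul_sub, mul_pow, sq (√v), hs]
        · intro j _ hj
          simp [sparseVector, hj]
      rw [h1]
      have h2 : |∑ j ∈ S, (w j / √v - q (w j / √v)) ^ 2 - S.card * ∫ t, (t - q t) ^ 2 ∂N|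
          < S.card * (δ / 2) := not_le.1 hc0
      replace h2 := (abs_lt.1 h2).2
      have h3 : ∑ j ∈ S, (w j / √v - q (w j / √v)) ^ 2 ≤ k * δ := by
        rw [hS] at h2
        have h4 := mul_le_mul_of_nonneg_left hq1 hkR.le
        linarith
      calc _ ≤ v * (k * δ) := mul_le_mul_of_nonneg_left h3 hv0.le
        _ = c * δ := by rw [← hvk]; ring
    · have hDk : D.card ≤ k := hS ▸ Finset.card_le_card hD
      have hα : ((D.card : ℝ) / k) ∈ Set.Icc αs 1 := by
        constructor
        · rw [le_div_iff₀ hkR]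
          exact (Nat.lt_of_floor_lt hDc).le
        · rw [div_le_one hkR]; exact_mod_cast hDk
      obtain ⟨t, ht, hgt⟩ := hT _ hα
      have h2 : |∑ j ∈ S, max 0 (t - (w j / √v) ^ 2) - S.card * ∫ u, max 0 (t - u ^ 2) ∂N|
          < S.card * (δ / 2) := not_le.1 (hc1 t ht)
      replace h2 := (abs_lt.1 h2).2
      have h3 := energy_lower_bound S D hD (fun j => w j / √v) t
        (∫ u, max 0 (t - u ^ 2) ∂N) (δ / 2) (by linarith)
      have h4 : ∑ j ∈ D, w j ^ 2 = v * ∑ j ∈ D, (w j / √v) ^ 2 := by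
        rw [Finset.mul_sum]
        refine Finset.sum_congr rfl fun j _ => ?_
        rw [div_pow, Real.sq_sqrt hv0.le]
        field_simp
      rw [h4]
      rw [hS] at h3
      refine le_trans ?_ (mul_le_mul_of_nonneg_left h3 hv0.le)
      have h5 : v * (t * D.card - k * ((∫ u, max 0 (t - u ^ 2) ∂N) + δ / 2))
          = c * (t * (D.card / k) - (∫ u, max 0 (t - u ^ 2) ∂N) - δ / 2) := by
        rw [hv]; field_simp
        ring
      rw [h5]
      exact mul_le_mul_of_nonneg_left (by linarith) hc.le
  refine (measure_mono hsub).trans ((measure_union_le _ _).trans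
    ((add_le_add hB₀ ((measure_biUnion_finset_le _ _).trans (Finset.sum_le_sum hB₁))).trans
      (le_of_eq ?_)))
  rw [← ENNReal.ofReal_sum_of_nonneg fun t _ => by positivity,
    ← ENNReal.ofReal_add (by positivity) (Finset.sum_nonneg fun t _ => by positivity)]
  congr 1
  rw [hS, add_div, Finset.sum_div]
  congr 1
  · field_simp
  · refine Finset.sum_congr rfl fun t _ => ?_
    field_simp

/-! ### Asymptotic estimates and achievability. -/

theorem exists_bounds_of_isTheta_one {f : ℕ → ℝ} (hf : ∀ p, 0 < f p)
    (h : f =Θ[atTop] (fun _ => (1 : ℝ))) :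
    ∃ A₁ A₂ : ℝ, 0 < A₁ ∧ 0 < A₂ ∧ ∀ᶠ p in atTop, A₁ ≤ f p ∧ f p ≤ A₂ := by
  obtain ⟨C₂, hC₂, h2⟩ := h.1.exists_pos
  obtain ⟨C₁, hC₁, h1⟩ := h.2.exists_pos
  refine ⟨C₁⁻¹, C₂, by positivity, hC₂, ?_⟩
  filter_upwards [h1.bound, h2.bound] with p hp1 hp2
  rw [Real.norm_of_nonneg (hf p).le, norm_one] at hp1 hp2
  refine ⟨?_, by linarith⟩
  rw [inv_le_iff_one_le_mul₀ hC₁]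
  linarith

theorem tendsto_log_div {k : ℕ → ℕ} (hk : Tendsto k atTop atTop)
    (hkp : (fun p => (k p : ℝ)) =o[atTop] (fun p => (p : ℝ))) :
    Tendsto (fun p : ℕ => Real.log ((p : ℝ) / k p)) atTop atTop := by
  refine Real.tendsto_log_atTop.comp ?_
  have h1 : Tendsto (fun p : ℕ => (k p : ℝ) / p) atTop (𝓝[>] 0) := by
    refine tendsto_nhdsWithin_iff.2 ⟨hkp.tendsto_div_nhds_zero, ?_⟩
    filter_upwards [hk.eventually_gt_atTop 0, eventually_gt_atTop 0] with p h1 h2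
    have : (0 : ℝ) < k p := by exact_mod_cast h1
    have : (0 : ℝ) < p := by exact_mod_cast h2
    change (0 : ℝ) < k p / p
    positivity
  refine h1.inv_tendsto_nhdsGT_zero.congr fun p => ?_
  simp

/-- Terms of order `exp (O(k) - Ω(k log (p / k)))` vanish. -/
theorem tendsto_exp_mul_sub {k : ℕ → ℕ} {L : ℕ → ℝ} (hk : Tendsto k atTop atTop)
    (hL : Tendsto L atTop atTop) (A : ℝ) {B : ℝ} (hB : 0 < B) :
    Tendsto (fun p => Real.exp (A * k p - B * (k p * L p))) atTop (𝓝 0) := by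
  have h1 : Tendsto (fun p => (k p : ℝ)) atTop atTop := tendsto_natCast_atTop_atTop.comp hk
  have h2 : Tendsto (fun p => A + -(B * L p)) atTop atBot :=
    tendsto_atBot_add_const_left _ _ (tendsto_neg_atTop_atBot.comp (hL.const_mul_atTop hB))
  refine Real.tendsto_exp_atBot.comp ((h1.atTop_mul_atBot₀ h2).congr fun p => ?_)
  ring

theorem rate_mono {c σ α β : ℝ} (hc : 0 < c) (hα0 : 0 ≤ g α) (hαβ : α ≤ β)
    (hβ : β ≤ 1) : rate c σ α ≤ rate c σ β := by
  have h := monotoneOn_g (hαβ.trans hβ) hβ hαβ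
  have : 0 ≤ c / σ ^ 2 := by positivity
  unfold rate
  gcongr

/-- With `rate_le`, this keeps the rates between constants free of p, although σ varies with p. -/
theorem le_rate {c σ α β A : ℝ} (hc : 0 < c) (hσ : 0 < σ) (hA : σ ^ 2 ≤ A) (hα0 : 0 < α)
    (hαβ : α ≤ β) (hβ : β ≤ 1) : 1 / 2 * Real.log (1 + c / A * g α) ≤ rate c σ β := by
  have h0 := (g_pos hα0 (hαβ.trans hβ)).le
  refine le_trans ?_ (rate_mono hc h0 hαβ hβ)
  have hσ2 : 0 < σ ^ 2 := by positivity
  have : 0 ≤ c / A := div_nonneg hc.le (hσ2.le.trans hA)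
  unfold rate
  gcongr

theorem rate_le {c σ A : ℝ} (hc : 0 < c) (hA0 : 0 < A) (hA : A ≤ σ ^ 2) :
    rate c σ 1 ≤ 1 / 2 * Real.log (1 + c / A * g 1) := by
  have h0 := (g_pos one_pos le_rfl).le
  have : 0 ≤ c / σ ^ 2 := by positivity
  unfold rate
  gcongr

theorem half_log_pos {c A α : ℝ} (hc : 0 < c) (hA : 0 < A) (hα : 0 < α) (hα1 : α ≤ 1) :
    0 < 1 / 2 * Real.log (1 + c / A * g α) := by
  have h0 := g_pos hα hα1
  have : 0 < c / A * g α := by positivity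
  have := Real.log_pos (show 1 < 1 + c / A * g α by linarith)
  positivity

/-- Writes p^ℓ/ℓ! as (k^ℓ/ℓ!)(p/k)^ℓ and uses k^ℓ/ℓ! ≤ e^k; the loss e^k is negligible on the scale
k log(p/k). -/
theorem choose_le_exp {p k ℓ : ℕ} (hk : 0 < k) (hp : 0 < p) :
    (p.choose ℓ : ℝ) ≤ Real.exp (k + ℓ * Real.log ((p : ℝ) / k)) := by
  have hkR : (0 : ℝ) < k := by exact_mod_cast hk
  have hpR : (0 : ℝ) < p := by exact_mod_cast hp
  refine (Nat.choose_le_pow_div ℓ p).trans ?_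
  rw [Real.exp_add, Real.exp_nat_mul, Real.exp_log (by positivity)]
  have h1 : (k : ℝ) ^ ℓ / (Nat.factorial ℓ) ≤ Real.exp k := Real.pow_div_factorial_le_exp _ hkR.le ℓ
  calc (p : ℝ) ^ ℓ / (Nat.factorial ℓ) = (k : ℝ) ^ ℓ / (Nat.factorial ℓ) * ((p : ℝ) / k) ^ ℓ := by
        rw [div_pow]; field_simp
    _ ≤ _ := by gcongr

theorem errorProb_nonneg (cβ σ : ℝ) (k : ℕ) {n p : ℕ} (d : ℕ) (dec : Decoder n p) :
    0 ≤ errorProb cβ σ k d dec :=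
  div_nonneg (Finset.sum_nonneg fun _ _ => measureReal_nonneg) (by positivity)

theorem errorProb_le {cβ σ : ℝ} {k n p d : ℕ} {dec : Decoder n p} {b : ℝ} (hb : 0 ≤ b)
    (h : ∀ S : Finset (Fin p), S.card = k → condErrorProb cβ σ k d dec S ≤ b) :
    errorProb cβ σ k d dec ≤ b := by
  refine div_le_of_le_mul₀ (by positivity) hb ?_
  refine (Finset.sum_le_sum fun S hS => h S (Finset.mem_powersetCard.1 hS).2).trans (le_of_eq ?_)
  rw [Finset.sum_const, Finset.card_powersetCard, Finset.card_univ, Fintype.card_fin, nsmul_eq_mul,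
    mul_comm]

instance (n p : ℕ) : Nonempty (Decoder n p) :=
  ⟨⟨fun _ _ => ∅, fun _ => .const _⟩⟩

/-- The perturbations of the decoder cost an arbitrarily small fraction of the rate. -/
theorem exists_slack {c A₁ R : ℝ} (hc : 0 < c) (hA₁ : 0 < A₁) (hR : 0 < R) :
    ∃ δ : ℝ, 0 < δ ∧ δ < 1 ∧ ∀ σ α : ℝ, 0 < σ → A₁ ≤ σ ^ 2 → 0 ≤ g α →
      0 < c * (g α - δ) + σ ^ 2 ∧
      2 * rate c σ α - R ≤ Real.log ((c * (g α - δ) + σ ^ 2) * (1 - δ)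
        / ((c * δ + σ ^ 2) * (1 + δ))) := by
  -- All perturbations are collected in one function of δ, continuous with value 0 at 0. Since σ² ≥
  -- A₁, each error cδ is at most σ² · cδ/A₁, which makes the estimate uniform in σ and α.
  let h : ℝ → ℝ := fun δ => Real.log ((1 - c * δ / A₁) * (1 - δ) / ((1 + c * δ / A₁) * (1 + δ)))
  have hcont : ContinuousAt h 0 := by
    have : ContinuousAt
        (fun δ : ℝ => (1 - c * δ / A₁) * (1 - δ) / ((1 + c * δ / A₁) * (1 + δ))) 0 := by
      refine ContinuousAt.div (by fun_prop) (by fun_prop) (by simp)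
    exact this.log (by simp)
  have h0 : h 0 = 0 := by simp [h]
  have e1 : ∀ᶠ δ in 𝓝 (0 : ℝ), -R < h δ := hcont.eventually_const_lt (by rw [h0]; linarith)
  have e2 : ∀ᶠ δ in 𝓝 (0 : ℝ), c * δ / A₁ < 1 := by
    have : ContinuousAt (fun δ : ℝ => c * δ / A₁) 0 := by fun_prop
    exact this.eventually_lt_const (by simp)
  have e3 : ∀ᶠ δ in 𝓝 (0 : ℝ), δ < 1 := eventually_lt_nhds (by norm_num)
  obtain ⟨δ, ⟨⟨⟨hδ1, hδ2⟩, hδ3⟩, hδ0⟩⟩ := ((((e1.and e2).and e3).filter_mono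
    nhdsWithin_le_nhds).and (self_mem_nhdsWithin : Set.Ioi (0 : ℝ) ∈ 𝓝[>] 0)).exists
  have hδ0 : 0 < δ := hδ0
  refine ⟨δ, hδ0, hδ3, fun σ α hσ hσA hg => ?_⟩
  have hs : 0 < σ ^ 2 := by positivity
  set y := c * δ / A₁ with hy
  have hy0 : 0 < y := by positivity
  have h1y : 0 < 1 - y := by linarith
  have hcδ : c * δ ≤ σ ^ 2 * y := by
    rw [hy, mul_div_assoc', le_div_iff₀ hA₁]
    nlinarith [mul_pos hc hδ0]
  have hcg : 0 ≤ c * g α := by positivity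
  have hnum : (σ ^ 2 + c * g α) * (1 - y) ≤ c * (g α - δ) + σ ^ 2 := by nlinarith
  have hnum0 : 0 < (σ ^ 2 + c * g α) * (1 - y) := by positivity
  refine ⟨hnum0.trans_le hnum, ?_⟩
  have e4 : 2 * rate c σ α + h δ = Real.log ((σ ^ 2 + c * g α) * (1 - y) * (1 - δ)
      / (σ ^ 2 * (1 + y) * (1 + δ))) := by
    have : 0 < 1 - δ := by linarith
    have hq : 0 < 1 + c / σ ^ 2 * g α := by positivity
    have hh : h δ = Real.log ((1 - y) * (1 - δ) / ((1 + y) * (1 + δ))) := rfl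
    rw [hh, rate, ← mul_assoc, mul_one_div_cancel (by norm_num : (2 : ℝ) ≠ 0), one_mul,
      ← Real.log_mul hq.ne' (by positivity)]
    congr 1
    clear_value y
    field_simp
  have e5 : Real.log ((σ ^ 2 + c * g α) * (1 - y) * (1 - δ) / (σ ^ 2 * (1 + y) * (1 + δ)))
      ≤ Real.log ((c * (g α - δ) + σ ^ 2) * (1 - δ) / ((c * δ + σ ^ 2) * (1 + δ))) := by
    have h1 : 0 < 1 - δ := by linarith
    refine Real.log_le_log (by positivity) ?_
    refine div_le_div₀ ?_ ?_ (by positivity) ?_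
    · have := hnum0.trans_le hnum
      positivity
    · exact mul_le_mul_of_nonneg_right hnum h1.le
    · exact mul_le_mul_of_nonneg_right (by linarith) (by linarith)
  linarith

/-- Achievability: above the threshold, suitable decoders have vanishing error probability. -/
theorem exists_decoders_tendsto_zero (cβ αs : ℝ) (hcβ : 0 < cβ) (hαs : αs ∈ Set.Ioo (0 : ℝ) 1)
    (σ : ℕ → ℝ) (hσ : ∀ p, 0 < σ p)
    (hσΘ : (fun p => σ p ^ 2) =Θ[atTop] (fun _ => (1 : ℝ)))
    (k n : ℕ → ℕ) (hk : Tendsto k atTop atTop)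
    (hkp : (fun p => (k p : ℝ)) =o[atTop] (fun p => (p : ℝ))) (η : ℝ) (hη : 0 < η)
    (hn : ∀ᶠ p in atTop, achThreshold cβ (σ p) αs (k p) p * (1 + η) ≤ (n p : ℝ)) :
    ∃ dec : (p : ℕ) → Decoder (n p) p,
      Tendsto (fun p => errorProb cβ (σ p) (k p) ⌊αs * (k p : ℝ)⌋₊ (dec p)) atTop (𝓝 0) := by
  obtain ⟨hα0, hα1⟩ := hαs
  obtain ⟨A₁, A₂, hA₁, hA₂, hA⟩ := exists_bounds_of_isTheta_one (fun p => pow_pos (hσ p) 2) hσΘ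
  set R₀ : ℝ := 1 / 2 * Real.log (1 + cβ / A₂ * g αs) with hR₀
  set R₁ : ℝ := 1 / 2 * Real.log (1 + cβ / A₁ * g 1) with hR₁
  have hR₀0 : 0 < R₀ := half_log_pos hcβ hA₂ hα0 hα1.le
  have hR₁0 : 0 < R₁ := half_log_pos hcβ hA₁ one_pos le_rfl
  -- The fraction of the rate given up to perturbations: (1 - κ)(1 + η) = 1 + η/2, so half of the
  -- margin η remains.
  set κ : ℝ := η / 2 / (1 + η) with hκ
  have hκ0 : 0 < κ := by positivity
  have hκη : (1 - κ) * (1 + η) = 1 + η / 2 := by rw [hκ]; field_simp; ring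
  have hκ1 : 0 < 1 - κ := by
    by_contra hcon
    nlinarith
  obtain ⟨δ, hδ0, hδ1, hδ⟩ := exists_slack hcβ hA₁ (R := 2 * κ * R₀) (by positivity)
  obtain ⟨M, K, hK0, hMK⟩ := exists_typicalCoeffs_bound hα0 hδ0
  have hL := tendsto_log_div hk hkp
  set L : ℕ → ℝ := fun p => Real.log ((p : ℝ) / k p) with hLdef
  set B₁ : ℝ := δ ^ 2 / 8 / R₁ with hB₁
  have hB₁0 : 0 < B₁ := by positivity
  set bound : ℕ → ℝ := fun p => K / k p + ((1 + (2 * M) ^ k p) * Real.exp (-(B₁ * (k p * L p)))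
    + (2 * M) ^ k p * Real.exp (k p - η / 2 * αs * (k p * L p))) with hbound
  have hev : ∀ᶠ p in atTop, ∃ dec : Decoder (n p) p,
      errorProb cβ (σ p) (k p) ⌊αs * (k p : ℝ)⌋₊ dec ≤ bound p := by
    filter_upwards [hn, hA, hk.eventually_gt_atTop 0, eventually_gt_atTop 0,
      hL.eventually_ge_atTop 0] with p hnp hAp hkp hp hLp
    have hkR : (0 : ℝ) < k p := by exact_mod_cast hkp
    have hrate0 : ∀ α ∈ Set.Icc αs 1, R₀ ≤ rate cβ (σ p) α := fun α hα =>
      le_rate hcβ (hσ p) hAp.2 hα0 hα.1 hα.2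
    -- The real supremum is a genuine upper bound only for a bounded set.
    have hbdd : BddAbove ((fun α : ℝ => α * k p * Real.log ((p : ℝ) / k p) / rate cβ (σ p) α)
        '' Set.Icc αs 1) := by
      refine ⟨k p * L p / R₀, ?_⟩
      rintro _ ⟨α, hα, rfl⟩
      refine div_le_div₀ (by positivity) ?_ hR₀0 (hrate0 α hα)
      rw [mul_assoc]
      exact mul_le_of_le_one_left (by positivity) hα.2
    have hnα : ∀ α ∈ Set.Icc αs 1, (1 + η) * (α * (k p * L p)) ≤ n p * rate cβ (σ p) α := by
      intro α hα
      have h1 : α * k p * Real.log ((p : ℝ) / k p) / rate cβ (σ p) α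
          ≤ achThreshold cβ (σ p) αs (k p) p := le_csSup hbdd ⟨α, hα, rfl⟩
      have hr := hR₀0.trans_le (hrate0 α hα)
      have h2 := (mul_le_mul_of_nonneg_right h1 (by linarith : (0 : ℝ) ≤ 1 + η)).trans hnp
      rw [div_mul_eq_mul_div, div_le_iff₀ hr] at h2
      calc _ = α * k p * Real.log ((p : ℝ) / k p) * (1 + η) := by simp only [hLdef]; ring
        _ ≤ _ := h2
    -- Taking α = 1 shows that n is at least of order k log(p/k), so tails exp(-nδ²/8) beat the
    -- exp(O(k)) candidates.
    have hn1 : k p * L p / R₁ ≤ n p := by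
      have h1 := hnα 1 ⟨hα1.le, le_rfl⟩
      have h2 := rate_le hcβ hA₁ hAp.1
      have h3 : n p * rate cβ (σ p) 1 ≤ n p * R₁ := mul_le_mul_of_nonneg_left h2 (by positivity)
      rw [div_le_iff₀ hR₁0]
      have : 0 ≤ η * (k p * L p) := by positivity
      linarith
    obtain ⟨Q, hQ, hQM, hQS⟩ := hMK cβ (k p) p hcβ hkp
    have hℓ : ∀ ℓ : ℕ, ⌊αs * (k p : ℝ)⌋₊ < ℓ → ℓ ≤ k p → ((ℓ : ℝ) / k p) ∈ Set.Icc αs 1 := by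
      intro ℓ h1 h2
      constructor
      · rw [le_div_iff₀ hkR]
        exact (Nat.lt_of_floor_lt h1).le
      · rw [div_le_one hkR]; exact_mod_cast h2
    obtain ⟨dec, hdec⟩ := exists_decoder_error_le (n := n p) (p := p) cβ (σ p) (hσ p) (k p)
      ⌊αs * (k p : ℝ)⌋₊ Q hQ (cβ * δ) δ (δ / 2) (Real.exp (k p - η / 2 * αs * (k p * L p)))
      (by positivity) hδ0 hδ1 (by positivity) (by linarith) (Real.exp_pos _).le
      (fun ℓ => cβ * (g (ℓ / k p) - δ))
      (fun ℓ h1 h2 => (hδ (σ p) _ (hσ p) hAp.1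
        (g_pos (hα0.trans_le (hℓ ℓ h1 h2).1) (hℓ ℓ h1 h2).2).le).1) (fun ℓ h1 h2 => by
        have hmem := hℓ ℓ h1 h2
        have hg := (hδ (σ p) _ (hσ p) hAp.1 (g_pos (hα0.trans_le hmem.1) hmem.2).le).2
        refine (mul_le_mul_of_nonneg_right (choose_le_exp hkp hp) (Real.exp_pos _).le).trans ?_
        rw [← Real.exp_add]
        refine Real.exp_le_exp.2 ?_
        have h3 := hrate0 _ hmem
        have h4 := hnα _ hmem
        have h5 : (1 - κ) * (n p * rate cβ (σ p) ((ℓ : ℝ) / k p)) ≤ n p / 2 *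
            Real.log ((cβ * (g (ℓ / k p) - δ) + σ p ^ 2) * (1 - δ)
            / ((cβ * δ + σ p ^ 2) * (1 + δ))) := by
          have : 2 * (1 - κ) * rate cβ (σ p) ((ℓ : ℝ) / k p) ≤
            Real.log ((cβ * (g (ℓ / k p) - δ) + σ p ^ 2) * (1 - δ)
            / ((cβ * δ + σ p ^ 2) * (1 + δ))) := by nlinarith
          have := mul_le_mul_of_nonneg_left this (by positivity : (0 : ℝ) ≤ n p / 2)
          linarith
        have h6 := mul_le_mul_of_nonneg_left h4 hκ1.le
        have h7 : (1 - κ) * ((1 + η) * ((ℓ : ℝ) / k p * (k p * L p))) = (1 + η / 2) * (ℓ * L p) := by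
          rw [← mul_assoc, hκη]; field_simp
        have h8 : αs * (k p * L p) ≤ ℓ * L p := by
          have := (le_div_iff₀ hkR).1 hmem.1
          nlinarith
        have h9 : η / 2 * (αs * (k p * L p)) ≤ η / 2 * (ℓ * L p) :=
          mul_le_mul_of_nonneg_left h8 (by positivity)
        rw [h7] at h6
        change (k p : ℝ) + ℓ * L p + _ ≤ _
        linarith)
    refine ⟨dec, errorProb_le (by positivity) fun S hS => ?_⟩
    have h1 := (hdec S hS).trans (add_le_add_left (hQS S hS) _)
    rw [← ENNReal.ofReal_add (by positivity) (by positivity)] at h1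
    have h2 := ENNReal.toReal_le_of_le_ofReal (by positivity) h1
    refine h2.trans ?_
    have hexp : Real.exp (-(1 / 2) * (δ / 2 * (n p * δ) - n p * (δ / 2) ^ 2))
        ≤ Real.exp (-(B₁ * (k p * L p))) := by
      refine Real.exp_le_exp.2 ?_
      have h3 := mul_le_mul_of_nonneg_left hn1 (by positivity : 0 ≤ δ ^ 2 / 8)
      have h4 : δ ^ 2 / 8 * (k p * L p / R₁) = B₁ * (k p * L p) := by rw [hB₁]; ring
      rw [h4] at h3
      linarith
    have hQM' : (Q.card : ℝ) ≤ M := by exact_mod_cast hQM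
    simp only [hbound]
    gcongr
  -- For the finitely many p where the bound may fail, any decoder serves.
  have hex : ∀ p, ∃ dec : Decoder (n p) p,
      (∃ dec' : Decoder (n p) p, errorProb cβ (σ p) (k p) ⌊αs * (k p : ℝ)⌋₊ dec' ≤ bound p) →
        errorProb cβ (σ p) (k p) ⌊αs * (k p : ℝ)⌋₊ dec ≤ bound p := by
    intro p
    by_cases h : ∃ dec' : Decoder (n p) p,
        errorProb cβ (σ p) (k p) ⌊αs * (k p : ℝ)⌋₊ dec' ≤ bound p
    · exact ⟨h.choose, fun _ => h.choose_spec⟩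
    · exact ⟨Classical.arbitrary _, fun h' => absurd h' h⟩
  choose dec hdec using hex
  have hlim : Tendsto bound atTop (𝓝 0) := by
    have hkR : Tendsto (fun p => (k p : ℝ)) atTop atTop := tendsto_natCast_atTop_atTop.comp hk
    have t1 : Tendsto (fun p => K / (k p : ℝ)) atTop (𝓝 0) := hkR.const_div_atTop K
    have t2 := tendsto_exp_mul_sub hk hL 0 hB₁0
    -- The shift by one makes the logarithm's argument positive without knowing that M is.
    have t3 := tendsto_exp_mul_sub hk hL (Real.log (2 * M + 1)) hB₁0
    have t4 := tendsto_exp_mul_sub hk hL (Real.log (2 * M + 1) + 1)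
      (B := η / 2 * αs) (by positivity)
    refine squeeze_zero (fun p => by positivity) (fun p => ?_)
      (by simpa using t1.add ((t2.add t3).add t4))
    have hpow : (2 * (M : ℝ)) ^ k p ≤ Real.exp (Real.log (2 * M + 1) * k p) := by
      rw [mul_comm (Real.log _), Real.exp_nat_mul, Real.exp_log (by positivity)]
      gcongr
      linarith
    simp only [hbound]
    gcongr ?_ + (?_ + ?_)
    · exact le_rfl
    · rw [add_mul, one_mul, sub_eq_add_neg (Real.log _ * _), Real.exp_add]
      gcongr
    · rw [add_mul, one_mul, add_sub_assoc, Real.exp_add]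
      gcongr
  exact ⟨dec, squeeze_zero' (Eventually.of_forall fun p => errorProb_nonneg _ _ _ _ _)
    (hev.mono fun p hp => hdec p hp) hlim⟩

/-! ### Change of measure. -/

theorem pi_withDensity {ι : Type*} [Fintype ι] {α : Type*} [MeasurableSpace α]
    (μ : ι → Measure α) [∀ i, IsProbabilityMeasure (μ i)] (h : ι → α → ℝ≥0∞)
    (hh : ∀ i, Measurable (h i)) [∀ i, IsProbabilityMeasure ((μ i).withDensity (h i))] :
    Measure.pi (fun i => (μ i).withDensity (h i))
      = (Measure.pi μ).withDensity fun ω => ∏ i, h i (ω i) := by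
  refine Measure.pi_eq (μ := fun i => (μ i).withDensity (h i)) fun s hs => ?_
  rw [withDensity_apply _ (MeasurableSet.univ_pi hs),
    ← lintegral_indicator (MeasurableSet.univ_pi hs)]
  have e : ∀ ω, (Set.univ.pi s).indicator (fun ω : ι → α => ∏ i, h i (ω i)) ω
      = ∏ i, (s i).indicator (h i) (ω i) := by
    intro ω
    by_cases hω : ω ∈ Set.univ.pi s
    · rw [Set.indicator_of_mem hω]
      exact Finset.prod_congr rfl fun i _ => (Set.indicator_of_mem (hω i trivial) _).symm
    · rw [Set.indicator_of_notMem hω]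
      simp only [Set.mem_pi, Set.mem_univ, true_implies, not_forall] at hω
      obtain ⟨i, hi⟩ := hω
      exact (Finset.prod_eq_zero (Finset.mem_univ i) (Set.indicator_of_notMem hi _)).symm
  rw [lintegral_congr e, lintegral_prod_pi _ _ fun i => (hh i).indicator (hs i)]
  refine Finset.prod_congr rfl fun i _ => ?_
  rw [withDensity_apply _ (hs i), lintegral_indicator (hs i)]

/-- The density of one nondegenerate Gaussian law with respect to another. -/
theorem gaussianReal_eq_withDensity (m : ℝ) (v w : ℝ) (hv : 0 < v) (hw : 0 < w) :
    gaussianReal m v.toNNReal = (gaussianReal 0 w.toNNReal).withDensity fun y =>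
      ENNReal.ofReal (Real.exp (1 / 2 * Real.log (w / v) - (y - m) ^ 2 / (2 * v)
        + y ^ 2 / (2 * w))) := by
  have hv' : v.toNNReal ≠ 0 := by simpa using hv
  have hw' : w.toNNReal ≠ 0 := by simpa using hw
  rw [gaussianReal_of_var_ne_zero _ hv', gaussianReal_of_var_ne_zero _ hw',
    ← withDensity_mul _ (measurable_gaussianPDF _ _) (by fun_prop)]
  congr 1
  ext y
  rw [Pi.mul_apply, gaussianPDF, gaussianPDF, ← ENNReal.ofReal_mul (gaussianPDFReal_nonneg _ _ _)]
  congr 1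
  rw [gaussianPDFReal, gaussianPDFReal, Real.coe_toNNReal _ hv.le, Real.coe_toNNReal _ hw.le,
    mul_assoc (√(2 * Real.pi * w))⁻¹, ← Real.exp_add]
  have e1 : -(y - 0) ^ 2 / (2 * w) + (1 / 2 * Real.log (w / v) - (y - m) ^ 2 / (2 * v)
      + y ^ 2 / (2 * w)) = 1 / 2 * Real.log (w / v) + -(y - m) ^ 2 / (2 * v) := by ring
  have e2 : Real.exp (1 / 2 * Real.log (w / v)) = √w / √v := by
    rw [← Real.sqrt_div hw.le, Real.sqrt_eq_rpow, Real.rpow_def_of_pos (by positivity), mul_comm]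
  rw [e1, Real.exp_add, e2, ← mul_assoc]
  congr 1
  rw [Real.sqrt_mul (by positivity) v, Real.sqrt_mul (by positivity) w]
  have : √w ≠ 0 := by positivity
  field_simp

/-- Change of measure: on outcomes with typical norms, the law of a shifted Gaussian vector is
dominated by that of a wider centred one. -/
theorem pi_gaussian_shift_le {n : ℕ} (u : Fin n → ℝ) (v w x : ℝ) (hv : 0 < v) (hw : 0 < w)
    (C : Set (Fin n → ℝ)) (hC : MeasurableSet C) :
    (Measure.pi fun _ : Fin n => gaussianReal 0 v.toNNReal)
        {z | u + z ∈ C ∧ v * (n - x) ≤ ∑ i, z i ^ 2 ∧ ∑ i, (u i + z i) ^ 2 ≤ w * (n + x)}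
      ≤ ENNReal.ofReal (Real.exp (n / 2 * Real.log (w / v) + x))
        * (Measure.pi fun _ : Fin n => gaussianReal 0 w.toNNReal) C := by
  let C' : Set (Fin n → ℝ) := C ∩ ({y | v * (n - x) ≤ ∑ i, (y i - u i) ^ 2} ∩
    {y | ∑ i, y i ^ 2 ≤ w * (n + x)})
  have hC' : MeasurableSet C' := hC.inter
    ((measurableSet_le (by fun_prop) (by fun_prop)).inter
      (measurableSet_le (by fun_prop) (by fun_prop)))
  have hmap : (Measure.pi fun _ : Fin n => gaussianReal 0 v.toNNReal).map (fun z i => u i + z i)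
      = Measure.pi fun i : Fin n => gaussianReal (u i) v.toNNReal := by
    rw [Measure.pi_map_pi (f := fun i t => u i + t) (fun i => by fun_prop)]
    simp_rw [gaussianReal_map_const_add, zero_add]
  have e : {z : Fin n → ℝ | u + z ∈ C ∧ v * (n - x) ≤ ∑ i, z i ^ 2 ∧
      ∑ i, (u i + z i) ^ 2 ≤ w * (n + x)} = (fun z i => u i + z i) ⁻¹' C' := by
    ext z
    have : (fun i => u i + z i) = u + z := rfl
    simp [C', this]
  rw [e, ← Measure.map_apply (by fun_prop) hC', hmap]
  have hd : ∀ i, gaussianReal (u i) v.toNNReal = _ := fun i =>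
    gaussianReal_eq_withDensity (u i) v w hv hw
  have inst : ∀ i, IsProbabilityMeasure ((gaussianReal 0 w.toNNReal).withDensity fun y =>
      ENNReal.ofReal (Real.exp (1 / 2 * Real.log (w / v) - (y - u i) ^ 2 / (2 * v)
        + y ^ 2 / (2 * w)))) := fun i => by rw [← hd i]; infer_instance
  simp_rw [hd]
  rw [pi_withDensity (fun _ => gaussianReal 0 w.toNNReal) _ (fun i => by fun_prop),
    withDensity_apply _ hC']
  have hle : ∀ y ∈ C', ∏ i, ENNReal.ofReal (Real.exp (1 / 2 * Real.log (w / v)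
      - (y i - u i) ^ 2 / (2 * v) + y i ^ 2 / (2 * w)))
      ≤ ENNReal.ofReal (Real.exp (n / 2 * Real.log (w / v) + x)) := by
    rintro y ⟨_, h1, h2⟩
    rw [Set.mem_ofPred_eq] at h1 h2
    rw [← ENNReal.ofReal_prod_of_nonneg fun i _ => (Real.exp_pos _).le, ← Real.exp_sum]
    refine ENNReal.ofReal_le_ofReal (Real.exp_le_exp.2 ?_)
    rw [Finset.sum_add_distrib, Finset.sum_sub_distrib, ← Finset.sum_div, ← Finset.sum_div]
    simp only [Finset.sum_const, Finset.card_univ, Fintype.card_fin, nsmul_eq_mul]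
    -- On `C'` the two quadratic terms of the log-density nearly cancel: together they contribute at
    -- most (n + x)/2 - (n - x)/2 = x.
    have h3 : (n - x) / 2 ≤ (∑ i, (y i - u i) ^ 2) / (2 * v) := by
      rw [div_le_div_iff₀ (by norm_num) (by positivity)]; linarith
    have h4 : (∑ i, y i ^ 2) / (2 * w) ≤ (n + x) / 2 := by
      rw [div_le_div_iff₀ (by positivity) (by norm_num)]; linarith
    linarith
  refine (setLIntegral_mono measurable_const hle).trans ?_
  rw [setLIntegral_const]
  gcongr
  exact Set.inter_subset_left

/-- For fixed X the vector Xa + Z is a shifted Gaussian, compared with independent noise of variance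
σ'² by `pi_gaussian_shift_le`. The two atypical events, ‖Z‖² too small and ‖Xa + Z‖² too large, give
the additive tails; the second is rare because ‖a‖² + σ² ≤ σ'². -/
theorem designLaw_change_of_measure {n p : ℕ} (σ σ' : ℝ) (hσ : 0 < σ) (hσ' : 0 < σ')
    (a : Fin p → ℝ) (ha : (∑ j, a j ^ 2) + σ ^ 2 ≤ σ' ^ 2) (x θ : ℝ) (hx : 0 ≤ x) (h0 : 0 ≤ θ)
    (h1 : θ ≤ 1 / 2) (C : Set ((Fin n → Fin p → ℝ) × (Fin n → ℝ))) (hC : MeasurableSet C) :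
    designLaw n p σ {xz | (xz.1, fun i => (∑ j, xz.1 i j * a j) + xz.2 i) ∈ C}
      ≤ ENNReal.ofReal (2 * Real.exp (-(1 / 2) * (θ * x - n * θ ^ 2)))
        + ENNReal.ofReal (Real.exp (n / 2 * Real.log (σ' ^ 2 / σ ^ 2) + x))
          * designLaw n p σ' C := by
  have hσ2 : 0 < σ ^ 2 := by positivity
  set γ := ENNReal.ofReal (Real.exp (n / 2 * Real.log (σ' ^ 2 / σ ^ 2) + x))
  set tail := Real.exp (-(1 / 2) * (θ * x - n * θ ^ 2))
  have htail : 0 ≤ tail := (Real.exp_pos _).le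
  let U₁ : Set ((Fin n → Fin p → ℝ) × (Fin n → ℝ)) := {xz | σ' ^ 2 * (n + x) ≤ residualSq a xz}
  let U₂ : Set ((Fin n → Fin p → ℝ) × (Fin n → ℝ)) :=
    {xz | residualSq (0 : Fin p → ℝ) xz ≤ σ ^ 2 * (n - x)}
  let U₃ : Set ((Fin n → Fin p → ℝ) × (Fin n → ℝ)) :=
    (fun xz => (xz.1, (fun i => ∑ j, xz.1 i j * a j) + xz.2)) ⁻¹' C ∩
      ({xz | σ ^ 2 * (n - x) ≤ ∑ i, xz.2 i ^ 2} ∩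
      {xz | ∑ i, ((∑ j, xz.1 i j * a j) + xz.2 i) ^ 2 ≤ σ' ^ 2 * (n + x)})
  have hU₃m : MeasurableSet U₃ := by
    have hm : Measurable fun xz : (Fin n → Fin p → ℝ) × (Fin n → ℝ) =>
        (xz.1, (fun i => ∑ j, xz.1 i j * a j) + xz.2) :=
      Measurable.prodMk (by fun_prop) (measurable_pi_lambda _ fun i => by
        simp only [Pi.add_apply]; fun_prop)
    exact (hm hC).inter ((measurableSet_le (by fun_prop) (by fun_prop)).inter
      (measurableSet_le (by fun_prop) (by fun_prop)))
  have hsub : {xz : (Fin n → Fin p → ℝ) × (Fin n → ℝ) |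
      (xz.1, fun i => (∑ j, xz.1 i j * a j) + xz.2 i) ∈ C} ⊆ U₁ ∪ (U₂ ∪ U₃) := by
    intro xz hxz
    by_contra hcon
    simp only [Set.mem_union, not_or] at hcon
    obtain ⟨c1, c2, c3⟩ := hcon
    have c1 : residualSq a xz < σ' ^ 2 * (n + x) := not_le.1 c1
    have c2 : σ ^ 2 * (n - x) < residualSq (0 : Fin p → ℝ) xz := not_le.1 c2
    refine c3 ⟨hxz, ?_, c1.le⟩
    simpa [residualSq] using c2.le
  have hU₁ : designLaw n p σ U₁ ≤ ENNReal.ofReal tail :=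
    designLaw_upper_tail σ hσ a _ ha x θ h0 h1 (by positivity)
  have hU₂ : designLaw n p σ U₂ ≤ ENNReal.ofReal tail := by
    rcases le_or_gt x n with hxn | hxn
    · exact designLaw_lower_tail σ hσ 0 _ (by simp) x θ h0 hxn
    -- For x > n the prescribed bound on the squared norm is negative.
    · have : U₂ = ∅ := by
        refine Set.eq_empty_iff_forall_notMem.2 fun xz hxz => ?_
        have h2 : residualSq (0 : Fin p → ℝ) xz ≤ σ ^ 2 * (n - x) := hxz
        have h3 : 0 ≤ residualSq (0 : Fin p → ℝ) xz := Finset.sum_nonneg fun _ _ => sq_nonneg _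
        nlinarith
      rw [this]; simp
  have hU₃ : designLaw n p σ U₃ ≤ γ * designLaw n p σ' C := by
    rw [designLaw, designLaw, Measure.prod_apply hU₃m, Measure.prod_apply hC,
      ← lintegral_const_mul _ (measurable_measure_prodMk_left hC)]
    refine lintegral_mono fun X => ?_
    exact pi_gaussian_shift_le (fun i => ∑ j, X i j * a j) (σ ^ 2) (σ' ^ 2) x hσ2 (by positivity)
      (Prod.mk X ⁻¹' C) (measurable_prodMk_left hC)
  refine (measure_mono hsub).trans ((measure_union_le _ _).trans
    ((add_le_add hU₁ ((measure_union_le _ _).trans (add_le_add hU₂ hU₃))).trans (le_of_eq ?_)))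
  rw [← add_assoc, ← ENNReal.ofReal_add htail htail, two_mul]

/-! ### Counting the hidden parts compatible with one estimate. -/

/-- Double counting: integrate the number of events that occur. It serves when one decoder output is
tested against many hidden parts under the same law. -/
theorem sum_measure_le_of_card_le {α ι : Type*} [MeasurableSpace α] (μ : Measure α)
    [IsProbabilityMeasure μ] (I : Finset ι) (A : ι → Set α) (hA : ∀ i, MeasurableSet (A i)) (N : ℕ)
    (hN : ∀ x, ∀ J ⊆ I, (∀ i ∈ J, x ∈ A i) → J.card ≤ N) : ∑ i ∈ I, μ (A i) ≤ N := by
  classical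
  calc ∑ i ∈ I, μ (A i) = ∑ i ∈ I, ∫⁻ x, (A i).indicator 1 x ∂μ :=
        Finset.sum_congr rfl fun i _ => (lintegral_indicator_one (hA i)).symm
    _ = ∫⁻ x, ∑ i ∈ I, (A i).indicator 1 x ∂μ :=
        (lintegral_finsetSum _ fun i _ => measurable_one.indicator (hA i)).symm
    _ ≤ ∫⁻ _x, (N : ℝ≥0∞) ∂μ := by
        refine lintegral_mono fun x => ?_
        simp only [Set.indicator_apply, Pi.one_apply, Finset.sum_boole]
        exact_mod_cast hN x (I.filter fun i => x ∈ A i) (Finset.filter_subset _ _)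
          fun i hi => (Finset.mem_filter.1 hi).2
    _ = N := by simp

/-- One success already forces |T| ≤ k + d ≤ 2k. Then D is determined by D ∩ T, for which there are
at most 4^k choices, and by D \ T, which has at most d elements. The allowance of d misses is what
turns α into α - α* in the converse. -/
theorem card_le_of_not_isError {p k d ℓ : ℕ} (hd : d ≤ k) (E T : Finset (Fin p))
    (hE : E.card + ℓ = k) (J : Finset (Finset (Fin p))) (hJ : J ⊆ Eᶜ.powersetCard ℓ)
    (h : ∀ D ∈ J, ¬ IsError d (E ∪ D) T) :
    J.card ≤ 4 ^ k * ∑ j ∈ Finset.range (d + 1), p.choose j := by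
  classical
  rcases J.eq_empty_or_nonempty with rfl | ⟨D₀, hD₀⟩
  · simp
  have hsucc : ∀ D ∈ J, ((E ∪ D) \ T).card ≤ d ∧ (T \ (E ∪ D)).card ≤ d := by
    intro D hD
    have := h D hD
    simp only [IsError, not_or, not_lt] at this
    exact this
  have hT : T.card ≤ 2 * k := by
    have h1 : (E ∪ D₀).card ≤ k := by
      refine (Finset.card_union_le _ _).trans ?_
      rw [(Finset.mem_powersetCard.1 (hJ hD₀)).2, hE]
    have h2 : T.card ≤ (T \ (E ∪ D₀)).card + (E ∪ D₀).card := by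
      rw [← Finset.card_sdiff_add_card_inter T (E ∪ D₀)]
      exact Nat.add_le_add_left (Finset.card_le_card Finset.inter_subset_right) _
    have := (hsucc D₀ hD₀).2
    omega
  have hcard : (Finset.univ.filter fun X : Finset (Fin p) => X.card ≤ d).card
      = ∑ j ∈ Finset.range (d + 1), p.choose j := by
    rw [Finset.card_eq_sum_card_fiberwise (f := Finset.card) (t := Finset.range (d + 1))
      (fun X hX => by
        simp only [Finset.coe_filter, Finset.mem_univ, true_and] at hX
        exact Finset.mem_coe.2 (Finset.mem_range.2 (Nat.lt_succ_of_le hX)))]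
    refine Finset.sum_congr rfl fun j hj => ?_
    have e : (Finset.univ.filter fun X : Finset (Fin p) => X.card ≤ d).filter (fun X => X.card = j)
        = Finset.univ.powersetCard j := by
      ext X
      have := Finset.mem_range.1 hj
      simp only [Finset.mem_filter, Finset.mem_univ, true_and, Finset.mem_powersetCard,
        Finset.subset_univ]
      omega
    rw [e, Finset.card_powersetCard, Finset.card_univ, Fintype.card_fin]
  have hinj : J.card ≤ (T.powerset ×ˢ
      (Finset.univ.filter fun X : Finset (Fin p) => X.card ≤ d)).card := by
    refine Finset.card_le_card_of_injOn (fun D => (D ∩ T, D \ T)) (fun D hD => ?_)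
      (fun D _ D' _ hEq => ?_)
    · simp only [Finset.coe_product, Set.mem_prod, Finset.mem_coe, Finset.mem_powerset,
        Finset.mem_filter, Finset.mem_univ, true_and]
      refine ⟨Finset.inter_subset_right, le_trans (Finset.card_le_card ?_) (hsucc D hD).1⟩
      exact Finset.sdiff_subset_sdiff Finset.subset_union_right le_rfl
    · simp only [Prod.mk.injEq] at hEq
      rw [← Finset.sdiff_union_inter D T, ← Finset.sdiff_union_inter D' T, hEq.1, hEq.2]
  rw [Finset.card_product, Finset.card_powerset, hcard] at hinj
  refine hinj.trans (Nat.mul_le_mul_right _ ?_)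
  calc 2 ^ T.card ≤ 2 ^ (2 * k) := Nat.pow_le_pow_right (by norm_num) hT
    _ = 4 ^ k := by rw [pow_mul]; norm_num

/-- Exchanges "support, then hidden part" for "revealed part, then hidden part in its complement",
since the counting bound needs E fixed and D varying. -/
theorem sum_powersetCard_powerset {p k : ℕ} {R : Type*} [AddCommMonoid R]
    (F : Finset (Fin p) → Finset (Fin p) → R) :
    ∑ S ∈ Finset.univ.powersetCard k, ∑ D ∈ S.powerset, F (S \ D) D
      = ∑ E ∈ Finset.univ.filter (fun E : Finset (Fin p) => E.card ≤ k),
          ∑ D ∈ Eᶜ.powersetCard (k - E.card), F E D := by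
  classical
  rw [Finset.sum_sigma', Finset.sum_sigma']
  refine Finset.sum_bij' (fun q _ => ⟨q.1 \ q.2, q.2⟩) (fun q _ => ⟨q.1 ∪ q.2, q.2⟩) ?_ ?_ ?_ ?_ ?_
  · rintro ⟨S, D⟩ h
    simp only [Finset.mem_sigma, Finset.mem_powersetCard, Finset.subset_univ, true_and,
      Finset.mem_powerset, Finset.mem_filter, Finset.mem_univ] at h ⊢
    obtain ⟨hS, hD⟩ := h
    have h1 := Finset.card_sdiff_add_card_eq_card hD
    refine ⟨by omega, fun j hj => ?_, by omega⟩
    simp [hj]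
  · rintro ⟨E, D⟩ h
    simp only [Finset.mem_sigma, Finset.mem_powersetCard, Finset.subset_univ, true_and,
      Finset.mem_powerset, Finset.mem_filter, Finset.mem_univ] at h ⊢
    obtain ⟨hE, hD, hDc⟩ := h
    have hdis : Disjoint E D := Finset.disjoint_left.2 fun j hj hjD => by
      simpa [hj] using hD hjD
    refine ⟨?_, Finset.subset_union_right⟩
    rw [Finset.card_union_of_disjoint hdis]; omega
  · rintro ⟨S, D⟩ h
    simp only [Finset.mem_sigma, Finset.mem_powersetCard, Finset.mem_powerset] at h
    simp [Finset.sdiff_union_of_subset h.2]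
  · rintro ⟨E, D⟩ h
    simp only [Finset.mem_sigma, Finset.mem_powersetCard] at h
    have hdis : Disjoint E D := Finset.disjoint_left.2 fun j hj hjD => by
      simpa [hj] using h.2.1 hjD
    simp [Finset.union_sdiff_cancel_right hdis]
  · rintro ⟨S, D⟩ _
    rfl

/-- Coordinates of a product measure over disjoint index sets integrate separately. -/
theorem lintegral_prod_indicator_mul {p : ℕ} (ρ : Measure ℝ) [IsProbabilityMeasure ρ]
    (B : Set ℝ) (hB : MeasurableSet B) (E D : Finset (Fin p)) (hED : Disjoint E D)
    (H : (Fin p → ℝ) → ℝ≥0∞) (hH : Measurable H) (hHE : ∀ w, H w = H (sparseVector E w)) :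
    ∫⁻ w, (∏ j ∈ D, B.indicator 1 (w j)) * H w ∂(Measure.pi fun _ : Fin p => ρ)
      = ρ B ^ D.card * ∫⁻ w, H w ∂(Measure.pi fun _ : Fin p => ρ) := by
  classical
  set π := Measure.pi fun _ : Fin p => ρ
  have hBm : Measurable (B.indicator (1 : ℝ → ℝ≥0∞)) := measurable_one.indicator hB
  have hind : iIndepFun (fun j (x : Fin p → ℝ) => x j) π :=
    iIndepFun_pi (X := fun _ (t : ℝ) => t) fun j => by fun_prop
  have hext : Measurable fun (y : E → ℝ) (j : Fin p) =>
      if h : j ∈ E then y ⟨j, h⟩ else 0 := by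
    refine measurable_pi_lambda _ fun j => ?_
    split_ifs <;> fun_prop
  have h1 := hind.indepFun_finset D E hED.symm (fun j => by fun_prop)
  have h2 := h1.comp (φ := fun y : D → ℝ => ∏ j, B.indicator (1 : ℝ → ℝ≥0∞) (y j))
    (ψ := fun y : E → ℝ => H fun j => if h : j ∈ E then y ⟨j, h⟩ else 0)
    (Finset.measurable_prod _ fun j _ => hBm.comp (measurable_pi_apply j)) (hH.comp hext)
  have e1 : (fun w : Fin p → ℝ => ∏ j ∈ D, B.indicator (1 : ℝ → ℝ≥0∞) (w j))
      = (fun y : D → ℝ => ∏ j, B.indicator (1 : ℝ → ℝ≥0∞) (y j)) ∘ fun w (j : D) => w j := by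
    ext w
    simp only [Function.comp]
    rw [Finset.prod_coe_sort D (fun j => B.indicator (1 : ℝ → ℝ≥0∞) (w j))]
  have e2 : H = (fun y : E → ℝ => H fun j => if h : j ∈ E then y ⟨j, h⟩ else 0)
      ∘ fun w (j : E) => w j := by
    ext w
    rw [hHE w]
    simp only [Function.comp]
    congr 1
  rw [← e1, ← e2] at h2
  have hPm : Measurable fun w : Fin p → ℝ => ∏ j ∈ D, B.indicator (1 : ℝ → ℝ≥0∞) (w j) :=
    Finset.measurable_prod _ fun j _ => hBm.comp (measurable_pi_apply j)
  rw [lintegral_mul_eq_lintegral_mul_lintegral_of_indepFun'' hPm.aemeasurable hH.aemeasurable h2]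
  congr 1
  have hind2 : iIndepFun (fun j (x : Fin p → ℝ) => B.indicator (1 : ℝ → ℝ≥0∞) (x j)) π :=
    iIndepFun_pi (X := fun _ => B.indicator (1 : ℝ → ℝ≥0∞)) fun j => hBm.aemeasurable
  rw [lintegral_prod_eq_prod_lintegral_of_indepFun D _ hind2
    (fun j => hBm.comp (measurable_pi_apply j)), Finset.prod_congr rfl (g := fun _ => ρ B),
    Finset.prod_const]
  intro j _
  rw [← lintegral_indicator_one hB]
  exact (measurePreserving_eval (fun _ : Fin p => ρ) j).lintegral_comp hBm

theorem exp_le_choose {p k ℓ : ℕ} (hk : 0 < k) (hp : 2 * k ≤ p) (hℓ : ℓ ≤ k) :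
    Real.exp (ℓ * Real.log ((p : ℝ) / k) - k) ≤ ((p - (k - ℓ)).choose ℓ : ℝ) := by
  have hkR : (0 : ℝ) < k := by exact_mod_cast hk
  have hpR : (2 : ℝ) * k ≤ p := by exact_mod_cast hp
  have hp0 : (0 : ℝ) < p := by linarith
  refine le_trans ?_ (Nat.pow_le_choose ℓ (p - (k - ℓ)))
  have h1 : ((p : ℝ) / 2) ≤ ((p - (k - ℓ) + 1 - ℓ : ℕ) : ℝ) := by
    have : p - (k - ℓ) + 1 - ℓ = p - k + 1 := by omega
    rw [this, Nat.cast_add, Nat.cast_sub (by omega)]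
    push_cast
    linarith
  have h2 : ((Nat.factorial ℓ : ℕ) : ℝ) ≤ (k : ℝ) ^ ℓ := by
    have : Nat.factorial ℓ ≤ k ^ ℓ :=
      (Nat.factorial_le_pow ℓ).trans (Nat.pow_le_pow_left hℓ ℓ)
    exact_mod_cast this
  have h3 : (2 : ℝ) ^ ℓ ≤ Real.exp k := by
    have h4 : (2 : ℝ) ≤ Real.exp 1 := by linarith [Real.add_one_le_exp 1]
    calc (2 : ℝ) ^ ℓ ≤ Real.exp 1 ^ ℓ := pow_le_pow_left₀ (by norm_num) h4 _
      _ = Real.exp ℓ := by rw [← Real.exp_nat_mul, mul_one]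
      _ ≤ Real.exp k := Real.exp_le_exp.2 (by exact_mod_cast hℓ)
  rw [Real.exp_sub, Real.exp_nat_mul, Real.exp_log (by positivity)]
  calc ((p : ℝ) / k) ^ ℓ / Real.exp k ≤ ((p : ℝ) / k) ^ ℓ / 2 ^ ℓ := by gcongr
    _ = ((p : ℝ) / 2) ^ ℓ / k ^ ℓ := by rw [div_pow, div_pow]; field_simp
    _ ≤ _ := by
      refine div_le_div₀ (by positivity) ?_ (by positivity) h2
      exact pow_le_pow_left₀ (by positivity) h1 ℓ

/-- The 5k gathers 2k from 4^k, k from each binomial coefficient, k from the d + 1 summands and k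
from `exp_le_choose`. -/
theorem count_ratio_le {p k d ℓ : ℕ} (hk : 0 < k) (hp : 2 * k ≤ p) (hd : d ≤ k) (hℓ : ℓ ≤ k)
    {ℓ₀ : ℝ} (hℓ₀ : ℓ₀ ≤ ℓ) :
    ((4 ^ k * ∑ j ∈ Finset.range (d + 1), p.choose j : ℕ) : ℝ)
      ≤ Real.exp (5 * k - (ℓ₀ - d) * Real.log ((p : ℝ) / k)) * ((p - (k - ℓ)).choose ℓ : ℝ) := by
  have hkR : (0 : ℝ) < k := by exact_mod_cast hk
  have hpR : (2 : ℝ) * k ≤ p := by exact_mod_cast hp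
  set L := Real.log ((p : ℝ) / k)
  have hL : 0 ≤ L := Real.log_nonneg (by rw [le_div_iff₀ hkR]; linarith)
  have h1 : ∑ j ∈ Finset.range (d + 1), (p.choose j : ℝ) ≤ Real.exp (2 * k + d * L) := by
    have h2 : ∀ j ∈ Finset.range (d + 1), (p.choose j : ℝ) ≤ Real.exp (k + d * L) := by
      intro j hj
      refine (choose_le_exp hk (by omega)).trans (Real.exp_le_exp.2 ?_)
      have : (j : ℝ) ≤ d := by exact_mod_cast Nat.lt_succ_iff.1 (Finset.mem_range.1 hj)
      have := mul_le_mul_of_nonneg_right this hL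
      simp only [L] at *
      linarith
    refine (Finset.sum_le_sum h2).trans ?_
    rw [Finset.sum_const, Finset.card_range, nsmul_eq_mul]
    have h3 : ((d + 1 : ℕ) : ℝ) ≤ Real.exp k := by
      have : (d : ℝ) ≤ k := by exact_mod_cast hd
      push_cast
      linarith [Real.add_one_le_exp (k : ℝ)]
    calc _ ≤ Real.exp k * Real.exp (k + d * L) := by gcongr
      _ = _ := by rw [← Real.exp_add]; congr 1; ring
  have h4 : (4 : ℝ) ^ k ≤ Real.exp (2 * k) := by
    have h2 : (2 : ℝ) ≤ Real.exp 1 := by linarith [Real.add_one_le_exp 1]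
    have h5 : (4 : ℝ) ≤ Real.exp 2 := by
      have : Real.exp 2 = Real.exp 1 * Real.exp 1 := by rw [← Real.exp_add]; norm_num
      rw [this]
      nlinarith
    calc (4 : ℝ) ^ k ≤ Real.exp 2 ^ k := pow_le_pow_left₀ (by norm_num) h5 _
      _ = _ := by rw [← Real.exp_nat_mul]; congr 1; ring
  have h6 := exp_le_choose hk hp hℓ
  push_cast
  calc (4 : ℝ) ^ k * ∑ j ∈ Finset.range (d + 1), (p.choose j : ℝ)
      ≤ Real.exp (2 * k) * Real.exp (2 * k + d * L) := by gcongr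
    _ ≤ Real.exp (5 * k - (ℓ₀ - d) * L) * Real.exp (ℓ * L - k) := by
        rw [← Real.exp_add, ← Real.exp_add]
        refine Real.exp_le_exp.2 ?_
        have := mul_le_mul_of_nonneg_right hℓ₀ hL
        linarith
    _ ≤ _ := by gcongr

theorem sparseVector_sparseVector {p : ℕ} (E : Finset (Fin p)) (w : Fin p → ℝ) :
    sparseVector E (sparseVector E w) = sparseVector E w := by
  ext j
  by_cases hj : j ∈ E <;> simp [sparseVector, hj]

/-! ### The genie argument. -/

/-- The success probability when the coefficients outside `E` are replaced by noise. -/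
def genieSuccess {n p : ℕ} (dec : Decoder n p) (d : ℕ) (σ' : ℝ) (E S : Finset (Fin p))
    (w : Fin p → ℝ) : ℝ≥0∞ :=
  designLaw n p σ' {xz | ¬ IsError d S (dec.est xz.1 (observation (sparseVector E w) xz.1 xz.2))}

theorem measurable_genieSuccess {n p : ℕ} (dec : Decoder n p) (d : ℕ) (σ' : ℝ)
    (E S : Finset (Fin p)) : Measurable (genieSuccess dec d σ' E S) :=
  measurable_measure_prodMk_left
    (dec.measurableSet_est_observation E fun T => ¬ IsError d S T)

theorem lintegral_prod_indicator {p : ℕ} (ρ : Measure ℝ) [IsProbabilityMeasure ρ]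
    (B : Set ℝ) (hB : MeasurableSet B) (D : Finset (Fin p)) :
    ∫⁻ w, (∏ j ∈ D, B.indicator 1 (w j)) ∂(Measure.pi fun _ : Fin p => ρ) = ρ B ^ D.card := by
  have := lintegral_prod_indicator_mul ρ B hB ∅ D (Finset.disjoint_empty_left _) (fun _ => 1)
    measurable_const (fun _ => rfl)
  simpa using this

theorem measurable_prod_indicator {p : ℕ} {B : Set ℝ} (hB : MeasurableSet B)
    (D : Finset (Fin p)) :
    Measurable fun w : Fin p → ℝ => ∏ j ∈ D, B.indicator (1 : ℝ → ℝ≥0∞) (w j) :=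
  Finset.measurable_prod _ fun j _ => (measurable_one.indicator hB).comp (measurable_pi_apply j)

open Classical in
/-- The contribution of the split of the support into a revealed part `E` and a hidden part `D` to
the success probability. -/
def splitTerm {n p : ℕ} (dec : Decoder n p) (d : ℕ) (σ' : ℝ) (B : Set ℝ) (ℓ₀ : ℝ)
    (E D : Finset (Fin p)) (w : Fin p → ℝ) : ℝ≥0∞ :=
  if ℓ₀ ≤ D.card then (∏ j ∈ D, B.indicator 1 (w j)) *
    ((∏ j ∈ E, Bᶜ.indicator 1 (w j)) * genieSuccess dec d σ' E (E ∪ D) w) else 0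

theorem measurable_splitTerm {n p : ℕ} (dec : Decoder n p) (d : ℕ) (σ' : ℝ) {B : Set ℝ}
    (hB : MeasurableSet B) (ℓ₀ : ℝ) (E D : Finset (Fin p)) :
    Measurable (splitTerm dec d σ' B ℓ₀ E D) := by
  unfold splitTerm
  split_ifs
  · exact (measurable_prod_indicator hB D).mul
      ((measurable_prod_indicator hB.compl E).mul (measurable_genieSuccess _ _ _ _ _))
  · exact measurable_const

/-- For fixed E the event that the coefficients on D lie in B is independent of the rest of the
term, with probability depending only on |D|. What remains is the average over D of the genie
success, bounded by the counting ratio. -/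
theorem sum_lintegral_splitTerm_le {n p k : ℕ} (hk : 0 < k) (hp : 2 * k ≤ p) (dec : Decoder n p)
    (d : ℕ) (hd : d ≤ k) (σ' : ℝ) (ρ : Measure ℝ) [IsProbabilityMeasure ρ] {B : Set ℝ}
    (hB : MeasurableSet B) (ℓ₀ : ℝ) :
    ∑ S ∈ Finset.univ.powersetCard k, ∑ D ∈ S.powerset,
      ∫⁻ w, splitTerm dec d σ' B ℓ₀ (S \ D) D w ∂(Measure.pi fun _ : Fin p => ρ)
      ≤ ENNReal.ofReal (Real.exp (5 * k - (ℓ₀ - d) * Real.log ((p : ℝ) / k))) * p.choose k := by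
  classical
  set κ := ENNReal.ofReal (Real.exp (5 * k - (ℓ₀ - d) * Real.log ((p : ℝ) / k)))
  set π := Measure.pi fun _ : Fin p => ρ
  -- For each S the probabilities of its splits sum to (ρ(B) + ρ(Bᶜ))^|S| = 1.
  have hsum : ∑ S ∈ (Finset.univ : Finset (Fin p)).powersetCard k, ∑ D ∈ S.powerset,
      κ * (ρ B ^ D.card * ρ Bᶜ ^ (S \ D).card) = κ * p.choose k := by
    rw [Finset.sum_congr rfl (g := fun _ => κ)]
    · simp [mul_comm]
    · intro S _
      rw [← Finset.mul_sum]
      have : ∑ D ∈ S.powerset, ρ B ^ D.card * ρ Bᶜ ^ (S \ D).card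
          = (ρ B + ρ Bᶜ) ^ S.card := by
        rw [← Finset.sum_pow_mul_eq_add_pow]
        refine Finset.sum_congr rfl fun D hD => ?_
        rw [Finset.card_sdiff_of_subset (Finset.mem_powerset.1 hD)]
      rw [this, prob_add_prob_compl hB, one_pow, mul_one]
  rw [← hsum]
  rw [sum_powersetCard_powerset (fun E D => ∫⁻ w, splitTerm dec d σ' B ℓ₀ E D w ∂π),
    sum_powersetCard_powerset (fun E D => κ * (ρ B ^ D.card * ρ Bᶜ ^ E.card))]
  refine Finset.sum_le_sum fun E hE => ?_
  have hEk : E.card ≤ k := (Finset.mem_filter.1 hE).2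
  set ℓ := k - E.card with hℓ
  have hcard : ∀ D ∈ Eᶜ.powersetCard ℓ, D.card = ℓ := fun D hD => (Finset.mem_powersetCard.1 hD).2
  by_cases h0 : ℓ₀ ≤ ℓ
  · have hterm : ∀ D ∈ Eᶜ.powersetCard ℓ, ∫⁻ w, splitTerm dec d σ' B ℓ₀ E D w ∂π
        = ρ B ^ ℓ * ∫⁻ w, (∏ j ∈ E, Bᶜ.indicator 1 (w j)) * genieSuccess dec d σ' E (E ∪ D) w ∂π := by
      intro D hD
      have hdis : Disjoint E D := Finset.disjoint_left.2 fun j hj hjD => by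
        simpa [hj] using (Finset.mem_powersetCard.1 hD).1 hjD
      simp only [splitTerm, hcard D hD, h0, if_true]
      rw [lintegral_prod_indicator_mul ρ B hB E D hdis (fun w =>
        (∏ j ∈ E, Bᶜ.indicator 1 (w j)) * genieSuccess dec d σ' E (E ∪ D) w)
        ((measurable_prod_indicator hB.compl E).mul (measurable_genieSuccess _ _ _ _ _)), hcard D hD]
      intro w
      simp only [genieSuccess, sparseVector_sparseVector]
      congr 1
      refine Finset.prod_congr rfl fun j hj => ?_
      simp [sparseVector, hj]
    have hMm : ∀ D, Measurable fun w : Fin p → ℝ => (∏ j ∈ E, Bᶜ.indicator (1 : ℝ → ℝ≥0∞) (w j)) *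
        genieSuccess dec d σ' E (E ∪ D) w := fun D =>
      (measurable_prod_indicator hB.compl E).mul (measurable_genieSuccess _ _ _ _ _)
    rw [Finset.sum_congr rfl hterm, ← Finset.mul_sum, ← lintegral_finsetSum _ fun D _ => hMm D]
    set N : ℕ := 4 ^ k * ∑ j ∈ Finset.range (d + 1), p.choose j with hN
    -- The simulated observation involves E only, so all D are tested against the same estimate.
    have hgenie : ∀ w, ∑ D ∈ Eᶜ.powersetCard ℓ, genieSuccess dec d σ' E (E ∪ D) w ≤ N := by
      intro w
      refine sum_measure_le_of_card_le (designLaw n p σ') (Eᶜ.powersetCard ℓ) (fun D => {xz |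
        ¬ IsError d (E ∪ D) (dec.est xz.1 (observation (sparseVector E w) xz.1 xz.2))})
        (fun D => measurable_prodMk_left
          (dec.measurableSet_est_observation E fun T => ¬ IsError d (E ∪ D) T)) N ?_
      intro xz J hJ h
      exact card_le_of_not_isError hd E _ (by omega) J hJ h
    have hint : ∫⁻ w, ∑ D ∈ Eᶜ.powersetCard ℓ, (∏ j ∈ E, Bᶜ.indicator 1 (w j)) *
        genieSuccess dec d σ' E (E ∪ D) w ∂π ≤ ρ Bᶜ ^ E.card * N := by
      calc _ ≤ ∫⁻ w, (∏ j ∈ E, Bᶜ.indicator 1 (w j)) * N ∂π := by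
            refine lintegral_mono fun w => ?_
            rw [← Finset.mul_sum]
            gcongr
            exact hgenie w
        _ = _ := by
            rw [lintegral_mul_const _ (measurable_prod_indicator hB.compl E),
              lintegral_prod_indicator ρ Bᶜ hB.compl E]
    have hNκ : (N : ℝ≥0∞) ≤ κ * ((p - (k - ℓ)).choose ℓ : ℕ) := by
      have := count_ratio_le hk hp hd (Nat.sub_le k E.card) h0
      rw [← ENNReal.ofReal_natCast, ← ENNReal.ofReal_natCast,
        ← ENNReal.ofReal_mul (Real.exp_pos _).le]
      exact ENNReal.ofReal_le_ofReal this
    have hcc : (Eᶜ.powersetCard ℓ).card = (p - (k - ℓ)).choose ℓ := by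
      rw [Finset.card_powersetCard, Finset.card_compl, Fintype.card_fin]
      congr 1; omega
    calc _ ≤ ρ B ^ ℓ * (ρ Bᶜ ^ E.card * (κ * ((p - (k - ℓ)).choose ℓ : ℕ))) := by
          gcongr
          exact hint.trans (by gcongr)
      _ = ∑ D ∈ Eᶜ.powersetCard ℓ, κ * (ρ B ^ ℓ * ρ Bᶜ ^ E.card) := by
          rw [Finset.sum_const, hcc, nsmul_eq_mul]; ring
      _ = _ := Finset.sum_congr rfl fun D hD => by rw [hcard D hD]
  · refine (le_of_eq (Finset.sum_eq_zero fun D hD => ?_)).trans zero_le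
    simp [splitTerm, hcard D hD, h0]

open Classical in
/-- Coefficients with a large enough part in `B`, of small enough energy. -/
def splittable {p : ℕ} (B : Set ℝ) (ℓ₀ vbar : ℝ) (S : Finset (Fin p)) : Set (Fin p → ℝ) :=
  {w | ℓ₀ ≤ (S.filter fun j => w j ∈ B).card ∧ ∑ j ∈ S.filter (fun j => w j ∈ B), w j ^ 2 ≤ vbar}

/-- The hidden part is the set of coordinates of S with coefficient in B; its signal is traded for
noise of variance `vbar`. The indicators in `splitTerm` are 1 at this split, and summing over all
splits replaces a D depending on w by a sum that can be averaged. -/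
theorem success_section_le {n p : ℕ} (dec : Decoder n p) (d : ℕ) (σ : ℝ) (hσ : 0 < σ)
    (B : Set ℝ) (ℓ₀ vbar x θ : ℝ) (hv : 0 ≤ vbar) (hx : 0 ≤ x) (h0 : 0 ≤ θ) (h1 : θ ≤ 1 / 2)
    (S : Finset (Fin p)) (w : Fin p → ℝ) (hw : w ∈ splittable B ℓ₀ vbar S) :
    designLaw n p σ
        {xz | ¬ IsError d S (dec.est xz.1 (observation (sparseVector S w) xz.1 xz.2))}
      ≤ ENNReal.ofReal (2 * Real.exp (-(1 / 2) * (θ * x - n * θ ^ 2)))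
        + ENNReal.ofReal (Real.exp (n / 2 * Real.log (1 + vbar / σ ^ 2) + x))
          * ∑ D ∈ S.powerset, splitTerm dec d √(vbar + σ ^ 2) B ℓ₀ (S \ D) D w := by
  classical
  obtain ⟨hw1, hw2⟩ := hw
  set D := S.filter (fun j => w j ∈ B) with hD
  have hDS : D ⊆ S := Finset.filter_subset _ _
  have hs : 0 < vbar + σ ^ 2 := by positivity
  have hσ' : √(vbar + σ ^ 2) ^ 2 = vbar + σ ^ 2 := Real.sq_sqrt hs.le
  have hterm : splitTerm dec d √(vbar + σ ^ 2) B ℓ₀ (S \ D) D w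
      = genieSuccess dec d √(vbar + σ ^ 2) (S \ D) S w := by
    have hw1' : ℓ₀ ≤ D.card := by rw [hD]; convert hw1
    rw [splitTerm, if_pos hw1', Finset.sdiff_union_of_subset hDS]
    have e1 : ∏ j ∈ D, B.indicator (1 : ℝ → ℝ≥0∞) (w j) = 1 :=
      Finset.prod_eq_one fun j hj => by
        rw [Set.indicator_of_mem (Finset.mem_filter.1 hj).2]; rfl
    have e2 : ∏ j ∈ S \ D, Bᶜ.indicator (1 : ℝ → ℝ≥0∞) (w j) = 1 :=
      Finset.prod_eq_one fun j hj => by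
        obtain ⟨hjS, hjD⟩ := Finset.mem_sdiff.1 hj
        rw [Set.indicator_of_mem (show w j ∈ Bᶜ from fun hjB => hjD
          (Finset.mem_filter.2 ⟨hjS, hjB⟩))]
        rfl
    rw [e1, e2, one_mul, one_mul]
  have hCM := designLaw_change_of_measure (n := n) (p := p) σ √(vbar + σ ^ 2) hσ
    (Real.sqrt_pos.2 hs) (sparseVector D w) (by
      rw [hσ']
      have : ∑ j, sparseVector D w j ^ 2 = ∑ j ∈ D, w j ^ 2 := by
        rw [← Finset.sum_subset (Finset.subset_univ D)]
        · exact Finset.sum_congr rfl fun j hj => by simp [sparseVector, hj]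
        · intro j _ hj; simp [sparseVector, hj]
      rw [this]
      have hw2' : ∑ j ∈ D, w j ^ 2 ≤ vbar := by rw [hD]; convert hw2
      linarith) x θ hx h0 h1
    {xz | ¬ IsError d S (dec.est xz.1 (observation (sparseVector (S \ D) w) xz.1 xz.2))}
    (measurable_prodMk_left (dec.measurableSet_est_observation (S \ D) fun T => ¬ IsError d S T))
  have hobs : ∀ xz : (Fin n → Fin p → ℝ) × (Fin n → ℝ),
      observation (sparseVector (S \ D) w) xz.1
        (fun i => (∑ j, xz.1 i j * sparseVector D w j) + xz.2 i)
      = observation (sparseVector S w) xz.1 xz.2 := by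
    intro xz
    ext i
    simp only [observation]
    rw [← add_assoc, ← Finset.sum_add_distrib]
    congr 1
    refine Finset.sum_congr rfl fun j _ => ?_
    rw [← mul_add]
    congr 1
    by_cases hj : j ∈ D
    · simp [sparseVector, hj, hDS hj]
    · by_cases hjS : j ∈ S <;> simp [sparseVector, hj, hjS]
  have e : {xz : (Fin n → Fin p → ℝ) × (Fin n → ℝ) |
      ¬ IsError d S (dec.est xz.1 (observation (sparseVector S w) xz.1 xz.2))}
      = {xz | (xz.1, fun i => (∑ j, xz.1 i j * sparseVector D w j) + xz.2 i) ∈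
        {xz : (Fin n → Fin p → ℝ) × (Fin n → ℝ) | ¬ IsError d S (dec.est xz.1
          (observation (sparseVector (S \ D) w) xz.1 xz.2))}} := by
    ext xz
    simp only [Set.mem_ofPred_eq, hobs]
  rw [e]
  refine hCM.trans ?_
  have hlog : √(vbar + σ ^ 2) ^ 2 / σ ^ 2 = 1 + vbar / σ ^ 2 := by
    rw [hσ']; field_simp; ring
  rw [hlog]
  gcongr
  refine le_trans ?_ (Finset.single_le_sum (f := fun D =>
    splitTerm dec d √(vbar + σ ^ 2) B ℓ₀ (S \ D) D w) (fun _ _ => zero_le)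
    (Finset.mem_powerset.2 hDS))
  rw [hterm]
  exact le_rfl

/-- The strong converse bound. -/
theorem one_sub_errorProb_le {n p k : ℕ} (hk : 0 < k) (hp : 2 * k ≤ p) (dec : Decoder n p)
    (d : ℕ) (hd : d ≤ k) (cβ σ : ℝ) (hσ : 0 < σ) {B : Set ℝ} (hB : MeasurableSet B)
    (ℓ₀ vbar x θ τ : ℝ) (hv : 0 ≤ vbar) (hx : 0 ≤ x) (h0 : 0 ≤ θ) (h1 : θ ≤ 1 / 2) (hτ0 : 0 ≤ τ)
    (hτ : ∀ S : Finset (Fin p), S.card = k →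
      coeffLaw cβ k p (splittable B ℓ₀ vbar S)ᶜ ≤ ENNReal.ofReal τ) :
    1 - errorProb cβ σ k d dec ≤ τ + 2 * Real.exp (-(1 / 2) * (θ * x - n * θ ^ 2))
      + Real.exp (n / 2 * Real.log (1 + vbar / σ ^ 2) + x)
        * Real.exp (5 * k - (ℓ₀ - d) * Real.log ((p : ℝ) / k)) := by
  set tail : ℝ := 2 * Real.exp (-(1 / 2) * (θ * x - n * θ ^ 2)) with htail
  set γ : ℝ := Real.exp (n / 2 * Real.log (1 + vbar / σ ^ 2) + x) with hγ
  set κ : ℝ := Real.exp (5 * k - (ℓ₀ - d) * Real.log ((p : ℝ) / k)) with hκ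
  let succ : Finset (Fin p) → Set ((Fin p → ℝ) × (Fin n → Fin p → ℝ) × (Fin n → ℝ)) := fun S =>
    {ω | ¬ IsError d S (dec.est ω.2.1 (observation (sparseVector S ω.1) ω.2.1 ω.2.2))}
  have hsm : ∀ S, MeasurableSet (succ S) := fun S =>
    dec.measurableSet_est_observation S fun T => ¬ IsError d S T
  set term : Finset (Fin p) → (Fin p → ℝ) → ℝ≥0∞ := fun S w =>
    ∑ D ∈ S.powerset, splitTerm dec d √(vbar + σ ^ 2) B ℓ₀ (S \ D) D w with hterm
  have htm : ∀ S, Measurable (term S) := fun S =>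
    Finset.measurable_sum _ fun D _ => measurable_splitTerm dec d _ hB ℓ₀ _ _
  have hS : ∀ S ∈ (Finset.univ : Finset (Fin p)).powersetCard k,
      randomnessLaw cβ σ k n p (succ S) ≤ ENNReal.ofReal (τ + tail)
        + ENNReal.ofReal γ * ∫⁻ w, term S w ∂(coeffLaw cβ k p) := by
    intro S hS
    have hSk : S.card = k := (Finset.mem_powersetCard.1 hS).2
    rw [randomnessLaw_eq, Measure.prod_apply (hsm S)]
    have hpt : ∀ w, designLaw n p σ (Prod.mk w ⁻¹' succ S)
        ≤ (splittable B ℓ₀ vbar S)ᶜ.indicator (fun _ => 1) w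
          + (ENNReal.ofReal tail + ENNReal.ofReal γ * term S w) := by
      intro w
      by_cases hw : w ∈ splittable B ℓ₀ vbar S
      · exact (success_section_le dec d σ hσ B ℓ₀ vbar x θ hv hx h0 h1 S w hw).trans le_add_self
      · rw [Set.indicator_of_mem (by exact hw)]
        exact prob_le_one.trans le_self_add
    refine (lintegral_mono hpt).trans ?_
    have hm2 : Measurable fun w => ENNReal.ofReal tail + ENNReal.ofReal γ * term S w :=
      measurable_const.add ((htm S).const_mul _)
    rw [lintegral_add_right _ hm2,
      lintegral_add_left measurable_const, lintegral_const, measure_univ, mul_one,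
      lintegral_const_mul _ (htm S), ← add_assoc, ENNReal.ofReal_add hτ0 (by positivity)]
    gcongr
    refine (lintegral_indicator_const_le _ _).trans ?_
    rw [one_mul]
    exact hτ S hSk
  have hsum := Finset.sum_le_sum hS
  rw [Finset.sum_add_distrib, ← Finset.mul_sum] at hsum
  have hterms : ∑ S ∈ (Finset.univ : Finset (Fin p)).powersetCard k,
      ∫⁻ w, term S w ∂(coeffLaw cβ k p) ≤ ENNReal.ofReal κ * p.choose k := by
    have e : ∀ S ∈ (Finset.univ : Finset (Fin p)).powersetCard k,
        ∫⁻ w, term S w ∂(coeffLaw cβ k p) = ∑ D ∈ S.powerset,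
          ∫⁻ w, splitTerm dec d √(vbar + σ ^ 2) B ℓ₀ (S \ D) D w ∂(coeffLaw cβ k p) :=
      fun S _ => lintegral_finsetSum _ fun D _ => measurable_splitTerm dec d _ hB ℓ₀ _ _
    rw [Finset.sum_congr rfl e]
    exact sum_lintegral_splitTerm_le hk hp dec d hd _ (gaussianReal 0 (cβ / k).toNNReal) hB ℓ₀
  have hC : 0 < p.choose k := Nat.choose_pos (by omega)
  have hCR : (0 : ℝ) < p.choose k := by exact_mod_cast hC
  have hcardS : ((Finset.univ : Finset (Fin p)).powersetCard k).card = p.choose k := by simp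
  have hfin : ∑ S ∈ (Finset.univ : Finset (Fin p)).powersetCard k,
      randomnessLaw cβ σ k n p (succ S) ≤ ENNReal.ofReal ((τ + tail + γ * κ) * p.choose k) := by
    refine hsum.trans ?_
    have e : ENNReal.ofReal ((τ + tail + γ * κ) * p.choose k)
        = p.choose k * ENNReal.ofReal (τ + tail)
          + ENNReal.ofReal γ * (ENNReal.ofReal κ * p.choose k) := by
      rw [← ENNReal.ofReal_natCast, ← ENNReal.ofReal_mul (by positivity),
        ← ENNReal.ofReal_mul (by positivity), ← ENNReal.ofReal_mul (by positivity),
        ← ENNReal.ofReal_add (by positivity) (by positivity)]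
      congr 1
      ring
    rw [Finset.sum_const, hcardS, nsmul_eq_mul, e]
    gcongr
  have hreal : ∑ S ∈ (Finset.univ : Finset (Fin p)).powersetCard k,
      (1 - condErrorProb cβ σ k d dec S) ≤ (τ + tail + γ * κ) * p.choose k := by
    have e : ∀ S ∈ (Finset.univ : Finset (Fin p)).powersetCard k,
        1 - condErrorProb cβ σ k d dec S = (randomnessLaw cβ σ k n p (succ S)).toReal := by
      intro S _
      have hm := dec.measurableSet_est_observation S fun T => IsError d S T
      rw [condErrorProb, ← probReal_compl_eq_one_sub hm]
      rfl
    rw [Finset.sum_congr rfl e, ← ENNReal.toReal_sum fun S _ => measure_ne_top _ _]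
    exact ENNReal.toReal_le_of_le_ofReal (by positivity) hfin
  have hE : (1 - errorProb cβ σ k d dec) * p.choose k
      = ∑ S ∈ (Finset.univ : Finset (Fin p)).powersetCard k,
        (1 - condErrorProb cβ σ k d dec S) := by
    rw [Finset.sum_sub_distrib, Finset.sum_const, hcardS, errorProb, sub_mul, one_mul,
      div_mul_cancel₀ _ hCR.ne']
    simp
  rw [← hE] at hreal
  exact le_of_mul_le_mul_right hreal hCR

/-! ### The converse: concentration and choice of constants. -/

theorem integrable_pow_four_gaussianReal : Integrable (fun w : ℝ => w ^ 4) (gaussianReal 0 1) := by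
  have := (memLp_id_gaussianReal (μ := 0) (v := 1) 4).integrable_norm_pow (p := 4) (by norm_num)
  refine this.congr (ae_of_all _ fun w => ?_)
  simp [Even.pow_abs (by decide : Even 4)]

/-- The coefficients are splittable with high probability, uniformly in all parameters. -/
theorem exists_splittable_bound {δ : ℝ} (hδ : 0 < δ) :
    ∃ K : ℝ, 0 ≤ K ∧ ∀ (c α : ℝ) (k : ℕ), 0 < c → 0 < k → 0 < α → α ≤ 1 →
      ∃ B : Set ℝ, MeasurableSet B ∧ ∀ (p : ℕ) (S : Finset (Fin p)), S.card = k →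
        coeffLaw c k p (splittable B ((α - δ) * k) (c * (g α + δ)) S)ᶜ ≤ ENNReal.ofReal (K / k) := by
  classical
  set N := gaussianReal 0 1
  set V : ℝ := ∫ w, w ^ 4 ∂N
  have hV0 : 0 ≤ V := integral_nonneg fun w => by positivity
  refine ⟨1 / δ ^ 2 + V / δ ^ 2, by positivity, fun c α k hc hk hα0 hα1 => ?_⟩
  have hkR : (0 : ℝ) < k := by exact_mod_cast hk
  obtain ⟨B, hB, hBα, hBg⟩ := exists_measurableSet_g hα0 hα1
  set v : ℝ := c / k with hv
  have hv0 : 0 < v := by positivity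
  have hvk : v * k = c := by rw [hv]; field_simp
  -- Whether a coordinate is hidden depends on its own coefficient alone, which keeps the hidden and
  -- revealed coefficients independent.
  refine ⟨{w | w / √v ∈ B}, (measurable_id.div_const _) hB, fun p S hS => ?_⟩
  have hSne : S.Nonempty := Finset.card_pos.1 (hS ▸ hk)
  have hm1 : Measurable (B.indicator (1 : ℝ → ℝ)) := measurable_one.indicator hB
  have hm2 : Measurable (B.indicator fun t : ℝ => t ^ 2) :=
    (by fun_prop : Measurable fun t : ℝ => t ^ 2).indicator hB
  have hb1 : ∀ t, 0 ≤ B.indicator (1 : ℝ → ℝ) t ∧ B.indicator (1 : ℝ → ℝ) t ≤ 1 := by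
    intro t
    by_cases ht : t ∈ B <;> simp [ht]
  have hL1 : MemLp (B.indicator (1 : ℝ → ℝ)) 2 N :=
    MemLp.of_bound hm1.aestronglyMeasurable 1
      (ae_of_all _ fun u => by rw [Real.norm_of_nonneg (hb1 u).1]; exact (hb1 u).2)
  have hle4 : ∀ t, (B.indicator (fun t : ℝ => t ^ 2) t) ^ 2 ≤ t ^ 4 := by
    intro t
    by_cases ht : t ∈ B
    · simp only [ht, Set.indicator_of_mem]; exact le_of_eq (by ring)
    · have : 0 ≤ t ^ 4 := by positivity
      simpa [ht] using this
  have hL2 : MemLp (B.indicator fun t : ℝ => t ^ 2) 2 N := by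
    rw [memLp_two_iff_integrable_sq hm2.aestronglyMeasurable]
    refine integrable_pow_four_gaussianReal.mono' (hm2.pow_const 2).aestronglyMeasurable
      (ae_of_all _ fun t => ?_)
    rw [Real.norm_of_nonneg (sq_nonneg _)]
    exact hle4 t
  have h1 := coeff_chebyshev v hv0 _ hm1 hL1 1 (by
    refine (integral_mono hL1.integrable_sq (integrable_const 1) fun u =>
      pow_le_one₀ (hb1 u).1 (hb1 u).2).trans ?_
    simp) S hSne δ hδ
  have h2 := coeff_chebyshev v hv0 _ hm2 hL2 V
    (integral_mono hL2.integrable_sq integrable_pow_four_gaussianReal hle4) S hSne δ hδ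
  rw [integral_indicator_one hB, hBα] at h1
  rw [integral_indicator hB, hBg] at h2
  rw [hS] at h1 h2
  have hsub : (splittable {w | w / √v ∈ B} ((α - δ) * k) (c * (g α + δ)) S)ᶜ
      ⊆ {w | k * δ ≤ |∑ j ∈ S, B.indicator 1 (w j / √v) - k * α|} ∪
        {w | k * δ ≤ |∑ j ∈ S, B.indicator (fun t : ℝ => t ^ 2) (w j / √v) - k * g α|} := by
    intro w hw
    by_contra hcon
    simp only [Set.mem_union, not_or, Set.mem_ofPred_eq, not_le] at hcon
    obtain ⟨c1, c2⟩ := hcon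
    refine hw ⟨?_, ?_⟩
    · have e : ∑ j ∈ S, B.indicator (1 : ℝ → ℝ) (w j / √v)
          = ((S.filter fun j => w j / √v ∈ B).card : ℝ) := by
        simp only [Set.indicator_apply, Pi.one_apply, Finset.sum_boole]
      have h3 := (abs_lt.1 c1).1
      rw [e] at h3
      have h4 : (α - δ) * k ≤ ((S.filter fun j => w j / √v ∈ B).card : ℝ) := by linarith
      exact h4
    · have e : ∑ j ∈ S.filter (fun j => w j / √v ∈ B), w j ^ 2
          = v * ∑ j ∈ S, B.indicator (fun t : ℝ => t ^ 2) (w j / √v) := by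
        rw [Finset.sum_filter, Finset.mul_sum]
        refine Finset.sum_congr rfl fun j _ => ?_
        by_cases hj : w j / √v ∈ B
        · rw [if_pos hj, Set.indicator_of_mem hj, div_pow, Real.sq_sqrt hv0.le]
          field_simp
        · rw [if_neg hj, Set.indicator_of_notMem hj, mul_zero]
      have h3 := (abs_lt.1 c2).2
      have h4 : ∑ j ∈ S.filter (fun j => w j / √v ∈ B), w j ^ 2 ≤ c * (g α + δ) := by
        rw [e]
        calc _ ≤ v * (k * (g α + δ)) := mul_le_mul_of_nonneg_left (by linarith) hv0.le
          _ = _ := by rw [← mul_assoc, hvk]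
      exact h4
  refine (measure_mono hsub).trans ((measure_union_le _ _).trans
    ((add_le_add h1 h2).trans (le_of_eq ?_)))
  rw [← ENNReal.ofReal_add (by positivity) (by positivity)]
  congr 1
  field_simp

/-- A relative error ε in the energy costs at most the same relative error in the rate. -/
theorem log_one_add_mul_le {y ε : ℝ} (hy : 0 ≤ y) (hε : 0 ≤ ε) :
    Real.log (1 + (1 + ε) * y) ≤ (1 + ε) * Real.log (1 + y) := by
  have h1 : 0 < 1 + y := by linarith
  have h2 : 0 < 1 + (1 + ε) * y := by positivity
  have h3 := Real.log_le_sub_one_of_pos (x := (1 + (1 + ε) * y) / (1 + y)) (by positivity)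
  rw [Real.log_div h2.ne' h1.ne'] at h3
  have h4 := Real.one_sub_inv_le_log_of_pos h1
  have h5 : (1 + (1 + ε) * y) / (1 + y) - 1 = ε * (1 - (1 + y)⁻¹) := by
    field_simp
    ring
  have h6 := mul_le_mul_of_nonneg_left h4 hε
  linarith

theorem mul_sq_le_of_le {θ δ R m t : ℝ} (hθ : 0 ≤ θ) (hδ : 0 ≤ δ) (hm : 0 ≤ m)
    (hmR : m * R ≤ t) (hθR : θ ≤ δ * R / 2) : m * θ ^ 2 ≤ θ * δ / 2 * t := by
  calc m * θ ^ 2 = θ * (m * θ) := by ring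
    _ ≤ θ * (m * (δ * R / 2)) := by gcongr
    _ = θ * δ / 2 * (m * R) := by ring
    _ ≤ _ := by gcongr

theorem half_mul_log_le {c σ α δ ζ m t : ℝ} (hc : 0 < c) (hσ : 0 < σ) (hδ : 0 ≤ δ)
    (hg : 0 ≤ g α) (hζ : 0 ≤ ζ) (hδg : δ ≤ g α * (ζ / 4)) (hm : 0 ≤ m)
    (hmt : m * rate c σ α ≤ (1 - ζ / 2) * t) (ht : 0 ≤ t) :
    m / 2 * Real.log (1 + c * (g α + δ) / σ ^ 2) ≤ (1 - ζ / 4) * t := by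
  have hσ2 : 0 < σ ^ 2 := pow_pos hσ 2
  have h1 : Real.log (1 + c * (g α + δ) / σ ^ 2) ≤ (1 + ζ / 4) * (2 * rate c σ α) := by
    have h2 : c * (g α + δ) / σ ^ 2 ≤ (1 + ζ / 4) * (c / σ ^ 2 * g α) := by
      have h3 : g α + δ ≤ (1 + ζ / 4) * g α := by linarith
      calc _ ≤ c * ((1 + ζ / 4) * g α) / σ ^ 2 := by gcongr
        _ = _ := by ring
    have h4 := log_one_add_mul_le (y := c / σ ^ 2 * g α) (ε := ζ / 4) (by positivity)
      (by positivity)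
    have h5 : Real.log (1 + c * (g α + δ) / σ ^ 2)
        ≤ Real.log (1 + (1 + ζ / 4) * (c / σ ^ 2 * g α)) :=
      Real.log_le_log (by positivity) (by linarith)
    refine h5.trans (h4.trans (le_of_eq ?_))
    rw [rate]; ring
  calc _ ≤ m / 2 * ((1 + ζ / 4) * (2 * rate c σ α)) := by gcongr
    _ = (1 + ζ / 4) * (m * rate c σ α) := by ring
    _ ≤ (1 + ζ / 4) * ((1 - ζ / 2) * t) := by gcongr
    _ ≤ _ := by
      rw [← mul_assoc]
      refine mul_le_mul_of_nonneg_right ?_ ht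
      linarith [mul_nonneg hζ hζ]

theorem errorProb_le_one (cβ σ : ℝ) (k : ℕ) {n p : ℕ} (d : ℕ) (dec : Decoder n p) :
    errorProb cβ σ k d dec ≤ 1 :=
  errorProb_le zero_le_one fun _ _ => measureReal_le_one

set_option maxHeartbeats 1000000 in
/-- The strong converse: below the threshold, the error probability of all decoders tends to one. -/
theorem tendsto_errorProb_one (cβ αs : ℝ) (hcβ : 0 < cβ) (hαs : αs ∈ Set.Ioo (0 : ℝ) 1)
    (σ : ℕ → ℝ) (hσ : ∀ p, 0 < σ p)
    (hσΘ : (fun p => σ p ^ 2) =Θ[atTop] (fun _ => (1 : ℝ)))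
    (k n : ℕ → ℕ) (hk : Tendsto k atTop atTop)
    (hkp : (fun p => (k p : ℝ)) =o[atTop] (fun p => (p : ℝ))) (η : ℝ) (hη : 0 < η)
    (hn : ∀ᶠ p in atTop, (n p : ℝ) ≤ convThreshold cβ (σ p) αs (k p) p * (1 - η))
    (dec : (p : ℕ) → Decoder (n p) p) :
    Tendsto (fun p => errorProb cβ (σ p) (k p) ⌊αs * (k p : ℝ)⌋₊ (dec p)) atTop (𝓝 1) := by
  obtain ⟨hα0, hα1⟩ := hαs
  obtain ⟨A₁, A₂, hA₁, hA₂, hA⟩ := exists_bounds_of_isTheta_one (fun p => pow_pos (hσ p) 2) hσΘ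
  set R₀ : ℝ := 1 / 2 * Real.log (1 + cβ / A₂ * g αs) with hR₀
  set R₁ : ℝ := 1 / 2 * Real.log (1 + cβ / A₁ * g 1) with hR₁
  have hR₀0 : 0 < R₀ := half_log_pos hcβ hA₂ hα0 hα1.le
  have hR₁0 : 0 < R₁ := half_log_pos hcβ hA₁ one_pos le_rfl
  -- η may exceed 1; the truncation keeps 1 - ζ and 1 - ζ/2 positive.
  set ζ : ℝ := min η (1 / 2) with hζ
  have hζ0 : 0 < ζ := lt_min hη (by norm_num)
  have hζη : ζ ≤ η := min_le_left _ _
  have hζ1 : ζ ≤ 1 / 2 := min_le_right _ _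
  -- A near-maximizing α has at least half the value of the maximum, hence half the value at α = 1;
  -- this keeps α - α* above `κ₀`.
  set κ₀ : ℝ := R₀ * (1 - αs) / (2 * R₁) with hκ₀
  have h1αs : 0 < 1 - αs := by linarith
  have hκ₀0 : 0 < κ₀ := by positivity
  have hg0 : 0 < g αs := g_pos hα0 hα1.le
  set δ : ℝ := min (g αs * (ζ / 4)) (ζ * κ₀ / 16) with hδ
  have hδ0 : 0 < δ := lt_min (by positivity) (by positivity)
  have hδ1 : δ ≤ g αs * (ζ / 4) := min_le_left _ _
  have hδ2 : δ ≤ ζ * κ₀ / 16 := min_le_right _ _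
  set θ : ℝ := min (1 / 2) (δ * R₀ / 2) with hθ
  have hθ0 : 0 < θ := lt_min (by norm_num) (by positivity)
  have hθ1 : θ ≤ 1 / 2 := min_le_left _ _
  have hθ2 : θ ≤ δ * R₀ / 2 := min_le_right _ _
  obtain ⟨K, hK0, hK⟩ := exists_splittable_bound hδ0
  have hL := tendsto_log_div hk hkp
  set L : ℕ → ℝ := fun p => Real.log ((p : ℝ) / k p) with hLdef
  set bound : ℕ → ℝ := fun p => K / k p + 2 * Real.exp (0 * k p - θ * δ / 4 * (k p * L p))
    + Real.exp (5 * k p - ζ * κ₀ / 8 * (k p * L p)) with hbound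
  have hev : ∀ᶠ p in atTop,
      1 - bound p ≤ errorProb cβ (σ p) (k p) ⌊αs * (k p : ℝ)⌋₊ (dec p) := by
    filter_upwards [hn, hA, hk.eventually_gt_atTop 0, eventually_gt_atTop 0,
      hL.eventually_gt_atTop 0, hkp.def (c := 1 / 2) (by norm_num)] with p hnp hAp hkp hp hLp hp2
    have hkR : (0 : ℝ) < k p := by exact_mod_cast hkp
    have hkL : 0 < k p * L p := by positivity
    have h2kp : 2 * k p ≤ p := by
      rw [Real.norm_natCast, Real.norm_natCast] at hp2
      have : (2 : ℝ) * k p ≤ p := by linarith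
      exact_mod_cast this
    have hrate0 : ∀ α ∈ Set.Icc αs 1, R₀ ≤ rate cβ (σ p) α := fun α hα =>
      le_rate hcβ (hσ p) hAp.2 hα0 hα.1 hα.2
    let val : ℝ → ℝ := fun α => (α - αs) * k p * Real.log ((p : ℝ) / k p) / rate cβ (σ p) α
    have hval : ∀ α, val α = (α - αs) * (k p * L p) / rate cβ (σ p) α := fun α => by
      simp only [val, hLdef, mul_assoc]
    have hbdd : BddAbove (val '' Set.Icc αs 1) := by
      refine ⟨k p * L p / R₀, ?_⟩
      rintro _ ⟨α, hα, rfl⟩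
      rw [hval]
      refine div_le_div₀ hkL.le ?_ hR₀0 (hrate0 α hα)
      exact mul_le_of_le_one_left hkL.le (by linarith [hα.2])
    set s := convThreshold cβ (σ p) αs (k p) p with hs
    have h1mem : (1 : ℝ) ∈ Set.Icc αs 1 := ⟨hα1.le, le_rfl⟩
    have hval1 : val 1 ≤ s := le_csSup hbdd ⟨1, h1mem, rfl⟩
    have hr1 : 0 < rate cβ (σ p) 1 := hR₀0.trans_le (hrate0 1 h1mem)
    have hval1' : (1 - αs) * (k p * L p) / R₁ ≤ val 1 := by
      rw [hval]
      exact div_le_div_of_nonneg_left (by positivity) hr1 (rate_le hcβ hA₁ hAp.1)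
    have hs0 : 0 < s := lt_of_lt_of_le (by positivity) (hval1'.trans hval1)
    have hnζ : (n p : ℝ) ≤ s * (1 - ζ) := hnp.trans
      (mul_le_mul_of_nonneg_left (by linarith) hs0.le)
    have hζ2 : 0 < 1 - ζ / 2 := by linarith
    -- Half of the margin ζ is spent on choosing α near the supremum, so attainment of the maximum
    -- is not needed.
    have hlt : s * (1 - ζ) / (1 - ζ / 2) < sSup (val '' Set.Icc αs 1) := by
      change _ < s
      rw [div_lt_iff₀ hζ2]
      exact mul_lt_mul_of_pos_left (by linarith) hs0
    obtain ⟨_, ⟨α, hα, rfl⟩, hαlt⟩ := exists_lt_of_lt_csSup (Set.Nonempty.image val ⟨1, h1mem⟩) hlt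
    have hr := hR₀0.trans_le (hrate0 α hα)
    have hα00 : 0 < α := hα0.trans_le hα.1
    rw [div_lt_iff₀ hζ2] at hαlt
    have hnrate : n p * rate cβ (σ p) α ≤ (1 - ζ / 2) * ((α - αs) * (k p * L p)) := by
      have h1 := mul_le_mul_of_nonneg_right (hnζ.trans hαlt.le) hr.le
      refine h1.trans (le_of_eq ?_)
      rw [hval]
      field_simp
    have hακ : κ₀ ≤ α - αs := by
      have h1 : s / 2 ≤ val α := by
        have hv0 : 0 ≤ val α := by
          rw [hval]
          have : 0 ≤ α - αs := by linarith [hα.1]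
          positivity
        nlinarith
      have h2 : (1 - αs) * (k p * L p) / R₁ / 2 ≤ (α - αs) * (k p * L p) / R₀ := by
        have h3 : val α ≤ (α - αs) * (k p * L p) / R₀ := by
          rw [hval]
          have : 0 ≤ α - αs := by linarith [hα.1]
          exact div_le_div_of_nonneg_left (by positivity) hR₀0 (hrate0 α hα)
        have := hval1'.trans hval1
        linarith
      rw [le_div_iff₀ hR₀0] at h2
      have h4 : (1 - αs) * (k p * L p) / R₁ / 2 * R₀ = κ₀ * (k p * L p) := by
        rw [hκ₀]; field_simp
      rw [h4] at h2
      exact le_of_mul_le_mul_right h2 hkL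
    have hnR : (n p : ℝ) * R₀ ≤ k p * L p := by
      have h1 : (n p : ℝ) * R₀ ≤ n p * rate cβ (σ p) α :=
        mul_le_mul_of_nonneg_left (hrate0 α hα) (by positivity)
      have h2 : (1 - ζ / 2) * ((α - αs) * (k p * L p)) ≤ 1 * (1 * (k p * L p)) := by
        have : 0 ≤ α - αs := by linarith [hα.1]
        gcongr
        · linarith
        · linarith [hα.2]
      linarith
    have hgα : 0 < g α := g_pos hα00 hα.2
    obtain ⟨B, hB, hBS⟩ := hK cβ α (k p) hcβ hkp hα00 hα.2
    have hd : ⌊αs * (k p : ℝ)⌋₊ ≤ k p :=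
      Nat.floor_le_of_le (mul_le_of_le_one_left hkR.le hα1.le)
    have hdR : ((⌊αs * (k p : ℝ)⌋₊ : ℕ) : ℝ) ≤ αs * k p := Nat.floor_le (by positivity)
    -- The slack x is δ k log(p/k) rather than a multiple of n, because n has no lower bound here; n
    -- R₀ ≤ k log(p/k) then controls nθ².
    have hmain := one_sub_errorProb_le hkp h2kp (dec p) ⌊αs * (k p : ℝ)⌋₊ hd cβ (σ p) (hσ p) hB
      ((α - δ) * k p) (cβ * (g α + δ)) (δ * (k p * L p)) θ (K / k p) (by positivity)
      (by positivity) hθ0.le hθ1 (by positivity) (hBS p)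
    have hexp1 : Real.exp (-(1 / 2) * (θ * (δ * (k p * L p)) - n p * θ ^ 2))
        ≤ Real.exp (0 * k p - θ * δ / 4 * (k p * L p)) := by
      exact Real.exp_le_exp.2 (by linarith [mul_sq_le_of_le hθ0.le hδ0.le (Nat.cast_nonneg (n p)) hnR hθ2])
    have hexp2 : Real.exp (n p / 2 * Real.log (1 + cβ * (g α + δ) / σ p ^ 2) + δ * (k p * L p))
        * Real.exp (5 * k p - ((α - δ) * k p - ⌊αs * (k p : ℝ)⌋₊) * L p)
        ≤ Real.exp (5 * k p - ζ * κ₀ / 8 * (k p * L p)) := by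
      rw [← Real.exp_add]
      refine Real.exp_le_exp.2 ?_
      -- The gain ζκ₀/4 exceeds the two losses δ, from the slack x and from the size of the hidden
      -- part, since 2δ ≤ ζκ₀/8.
      have h6 := half_mul_log_le hcβ (hσ p) hδ0.le hgα.le hζ0.le
        (hδ1.trans (mul_le_mul_of_nonneg_right (monotoneOn_g hα1.le hα.2 hα.1) (by positivity)))
        (Nat.cast_nonneg (n p)) hnrate (mul_nonneg (hκ₀0.le.trans hακ) hkL.le)
      have h7 := mul_le_mul_of_nonneg_right hdR hLp.le
      have h8 := mul_le_mul_of_nonneg_left (mul_le_mul_of_nonneg_right hακ hkL.le)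
        (by positivity : (0 : ℝ) ≤ ζ / 4)
      have h9 := mul_le_mul_of_nonneg_right hδ2 hkL.le
      linarith
    simp only [hbound]
    have : 1 - errorProb cβ (σ p) (k p) ⌊αs * (k p : ℝ)⌋₊ (dec p)
        ≤ K / k p + 2 * Real.exp (0 * k p - θ * δ / 4 * (k p * L p))
          + Real.exp (5 * k p - ζ * κ₀ / 8 * (k p * L p)) := by
      refine hmain.trans ?_
      exact add_le_add (add_le_add le_rfl (mul_le_mul_of_nonneg_left hexp1 (by norm_num))) hexp2
    linarith
  have hlim : Tendsto (fun p => 1 - bound p) atTop (𝓝 1) := by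
    have hkR : Tendsto (fun p => (k p : ℝ)) atTop atTop := tendsto_natCast_atTop_atTop.comp hk
    have t1 : Tendsto (fun p => K / (k p : ℝ)) atTop (𝓝 0) := hkR.const_div_atTop K
    have t2 := tendsto_exp_mul_sub hk hL 0 (B := θ * δ / 4) (by positivity)
    have t3 := tendsto_exp_mul_sub hk hL 5 (B := ζ * κ₀ / 8) (by positivity)
    have t4 := ((t1.add (t2.const_mul 2)).add t3).const_sub 1
    rw [mul_zero, add_zero, add_zero, sub_zero] at t4
    exact t4
  exact tendsto_of_tendsto_of_tendsto_of_le_of_le' hlim tendsto_const_nhds hev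
    (Eventually.of_forall fun p => errorProb_le_one _ _ _ _ _)

end SupportRecovery

end

theorem corollary2
    (cβ αs : ℝ) (hcβ : 0 < cβ) (hαs : αs ∈ Set.Ioo (0 : ℝ) 1)
    (σ : ℕ → ℝ) (hσ : ∀ p, 0 < σ p)
    (hσΘ : (fun p => σ p ^ 2) =Θ[atTop] (fun _ => (1 : ℝ)))
    (k n : ℕ → ℕ) (hk : Tendsto k atTop atTop)
    (hkp : (fun p => (k p : ℝ)) =o[atTop] (fun p => (p : ℝ))) :
    ((∃ η : ℝ, 0 < η ∧ ∀ᶠ p in atTop,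
        SupportRecovery.achThreshold cβ (σ p) αs (k p) p * (1 + η) ≤ (n p : ℝ)) →
      ∃ dec : (p : ℕ) → SupportRecovery.Decoder (n p) p,
        Tendsto
          (fun p => SupportRecovery.errorProb cβ (σ p) (k p) ⌊αs * (k p : ℝ)⌋₊ (dec p))
          atTop (𝓝 0)) ∧
    ((∃ η : ℝ, 0 < η ∧ ∀ᶠ p in atTop,
        (n p : ℝ) ≤ SupportRecovery.convThreshold cβ (σ p) αs (k p) p * (1 - η)) →
      ∀ dec : (p : ℕ) → SupportRecovery.Decoder (n p) p,
        Tendsto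
          (fun p => SupportRecovery.errorProb cβ (σ p) (k p) ⌊αs * (k p : ℝ)⌋₊ (dec p))
          atTop (𝓝 1)) := by
  refine ⟨?_, ?_⟩
  · rintro ⟨η, hη, hn⟩
    exact SupportRecovery.exists_decoders_tendsto_zero cβ αs hcβ hαs σ hσ hσΘ k n hk hkp η hη hn
  · rintro ⟨η, hη, hn⟩ dec
    exact SupportRecovery.tendsto_errorProb_one cβ αs hcβ hαs σ hσ hσΘ k n hk hkp η hη hn dec
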